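/- **The problem.** An instance $\mathcal J$ of the flexible storage allocation problem (FSAP) consists of an integer $W>0$ and $n$ jobs. Job $J_i$ is a half-open interval $[s_i,e_i)$ with rational endpoints $0\le s_i\le e_i$, with an integer maximum requirement $r_{\max}(i)\ge 0$ and a rational profit $p_i\ge 1$ per unit. A feasible solution $c$ assigns to each job $J_i$ a (possibly empty) block $c(J_i)$ of at most $r_{\max}(i)$ consecutive colors from $\{1,\dots,W\}$, such that distinct jobs whose intervals intersect receive disjoint blocks. Its profit is $\sum_i p_i|c(J_i)|$, and $OPT(\mathcal J)$ is the maximum profit of a feasible solution. The instance is *uniform* if $p_i=1$ and $r_{\max}(i)=\mathtt{Max}$ for all $i$, for some integer $1\le\mathtt{Max}\le W$. The interval graph $G$ has the jobs as vertices, two distinct jobs being adjacent when their intervals intersect. All numbers in the input are written in binary, and a solution is output by listing the first color and the length of each block. **Theorem.** There is a polynomial-time approximation scheme for uniform FSAP instances: for every fixed real $\varepsilon>0$ there is an algorithm $A_\varepsilon$ that on every uniform instance $\mathcal J$ halts in time polynomial in the input size and outputs a feasible solution of profit at least $(1-\varepsilon)\,OPT(\mathcal J)$. Moreover, the algorithms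 can be chosen so that, for every rational $\varepsilon>0$ and every uniform instance, with $k=\lceil W/\mathtt{Max}\rceil$ and $d=\lfloor\varepsilon\,\mathtt{Max}/4\rfloor$, the output $c$ of $A_\varepsilon$ is as follows. 1. If $k\le 1/\varepsilon$ and $d\ge 1$: cut $\{1,\dots,W\}$ into consecutive strips of $d$ colors (the last one possibly shorter). Then every $c(J_i)$ is a union of strips, and $c$ has maximum profit among all feasible solutions with this property. (In particular, there is a feasible solution of this form with profit at least $(1-\varepsilon)\,OPT(\mathcal J)$.) 2. If $k\le 1/\varepsilon$ and $d=0$: $c$ is an optimal solution. 3. If $k>1/\varepsilon$: $c$ assigns $\mathtt{Max}$ colors from $\{1,\dots,(k-1)\mathtt{Max}\}$ to each job of some maximum $(k-1)$-colorable induced subgraph of $G$ and no color to the other jobs, and $c$ has maximum profit among all feasible solutions that use only the colors $1,\dots,(k-1)\mathtt{Max}$. -/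

import Mathlib

/-! ## Model of computation

Data are binary trees whose leaves carry natural numbers written in binary.  A program is built
from elementary operations (arithmetic, projections, comparison) by pairing, composition,
branching and unbounded `while` loops.  Time is counted at logarithmic cost: an elementary
operation costs the full bit size of its argument and of its result, and every copy and every test
costs the full bit size of the datum to which it is applied.  Hence a run of cost `t` can be
carried out by a multitape Turing machine in time polynomial in `t` and the input size, and
conversely. -/

namespace FSAP

/-- Binary trees with natural numbers at the leaves. -/
inductive Data : Type
  | leaf (a : ℕ) : Data
  | node (x y : Data) : Data

namespace Data

/-- The bit size of a datum; the number at a leaf is counted by its binary length. -/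
def size : Data → ℕ
  | leaf a => Nat.size a + 1
  | node x y => size x + size y + 1

/-- A list of data as one datum: `leaf 0` is the empty list, `node x l` is `x` followed by `l`. -/
def ofList : List Data → Data
  | [] => leaf 0
  | x :: l => node x (ofList l)

/-- A nonnegative rational as the pair of its numerator and its denominator. -/
def ofRat (q : ℚ≥0) : Data := node (leaf q.num) (leaf q.den)

end Data

/-- The elementary operations.  The binary ones expect a pair of numbers. -/
inductive Op : Type
  | id
  | const (d : Data)
  | fst
  | snd
  | isLeaf
  | add
  | sub
  | mul
  | div
  | le

/-- Apply a binary operation on numbers to a pair of numbers (on any other datum the result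
is `leaf 0`). -/
def Data.arith (f : ℕ → ℕ → ℕ) : Data → Data
  | .node (.leaf a) (.leaf b) => .leaf (f a b)
  | _ => .leaf 0

/-- The result of an elementary operation.  Subtraction is truncated, division is the floor
division with `a / 0 = 0`, and truth values are the numbers `1` and `0`. -/
def Op.apply : Op → Data → Data
  | .id, x => x
  | .const d, _ => d
  | .fst, .node x _ => x
  | .fst, .leaf _ => .leaf 0
  | .snd, .node _ y => y
  | .snd, .leaf _ => .leaf 0
  | .isLeaf, .leaf _ => .leaf 1
  | .isLeaf, .node _ _ => .leaf 0
  | .add, x => x.arith (fun a b => a + b)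
  | .sub, x => x.arith (fun a b => a - b)
  | .mul, x => x.arith (fun a b => a * b)
  | .div, x => x.arith (fun a b => a / b)
  | .le, x => x.arith (fun a b => if a ≤ b then 1 else 0)

/-- Programs. -/
inductive Prog : Type
  /-- an elementary operation -/
  | op (o : Op) : Prog
  /-- run both programs on the input and pair the results -/
  | pair (p q : Prog) : Prog
  /-- run `p`, then run `q` on the result of `p` -/
  | seq (p q : Prog) : Prog
  /-- if the result of `b` on the input is not `0` then run `p`, else run `q` -/
  | cond (b p q : Prog) : Prog
  /-- while the result of `b` is not `0`, replace the current datum by the result of `p` -/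
  | loop (b p : Prog) : Prog

/-- `Runs p x y t`: the program `p`, started on `x`, halts with the result `y` at cost `t`. -/
inductive Runs : Prog → Data → Data → ℕ → Prop
  | op (o : Op) (x : Data) : Runs (.op o) x (o.apply x) (x.size + (o.apply x).size + 1)
  | pair {p q : Prog} {x y z : Data} {t u : ℕ} (hp : Runs p x y t) (hq : Runs q x z u) :
      Runs (.pair p q) x (.node y z) (t + u + x.size + 1)
  | seq {p q : Prog} {x y z : Data} {t u : ℕ} (hp : Runs p x y t) (hq : Runs q y z u) :
      Runs (.seq p q) x z (t + u + 1)
  | cond_true {b p q : Prog} {x v y : Data} {t u : ℕ} (hb : Runs b x v t) (hv : v ≠ .leaf 0)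
      (hp : Runs p x y u) : Runs (.cond b p q) x y (t + u + x.size + 1)
  | cond_false {b p q : Prog} {x y : Data} {t u : ℕ} (hb : Runs b x (.leaf 0) t)
      (hq : Runs q x y u) : Runs (.cond b p q) x y (t + u + x.size + 1)
  | loop_done {b p : Prog} {x : Data} {t : ℕ} (hb : Runs b x (.leaf 0) t) :
      Runs (.loop b p) x x (t + x.size + 1)
  | loop_step {b p : Prog} {x v y z : Data} {t u w : ℕ} (hb : Runs b x v t) (hv : v ≠ .leaf 0)
      (hp : Runs p x y u) (hl : Runs (.loop b p) y z w) :
      Runs (.loop b p) x z (t + u + w + x.size + 1)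

/-- Programs are deterministic: the result and the cost are determined by the input. -/
theorem Runs.deterministic {p : Prog} {x y : Data} {t : ℕ} (h : Runs p x y t) :
    ∀ {y' : Data} {t' : ℕ}, Runs p x y' t' → y = y' ∧ t = t' := by
  induction h with
  | op o x => intro y' t' h'; cases h'; exact ⟨rfl, rfl⟩
  | pair _ _ ih1 ih2 =>
    intro y' t' h'
    cases h' with
    | pair h1 h2 =>
      obtain ⟨rfl, rfl⟩ := ih1 h1
      obtain ⟨rfl, rfl⟩ := ih2 h2
      exact ⟨rfl, rfl⟩
  | seq _ _ ih1 ih2 =>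
    intro y' t' h'
    cases h' with
    | seq h1 h2 =>
      obtain ⟨rfl, rfl⟩ := ih1 h1
      obtain ⟨rfl, rfl⟩ := ih2 h2
      exact ⟨rfl, rfl⟩
  | cond_true _ hv _ ih1 ih2 =>
    intro y' t' h'
    cases h' with
    | cond_true h1 _ h2 =>
      obtain ⟨rfl, rfl⟩ := ih1 h1
      obtain ⟨rfl, rfl⟩ := ih2 h2
      exact ⟨rfl, rfl⟩
    | cond_false h1 _ => exact absurd (ih1 h1).1 hv
  | cond_false _ _ ih1 ih2 =>
    intro y' t' h'
    cases h' with
    | cond_true h1 hv _ => exact absurd (ih1 h1).1.symm hv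
    | cond_false h1 h2 =>
      obtain ⟨_, rfl⟩ := ih1 h1
      obtain ⟨rfl, rfl⟩ := ih2 h2
      exact ⟨rfl, rfl⟩
  | loop_done _ ih =>
    intro y' t' h'
    cases h' with
    | loop_done h1 => obtain ⟨_, rfl⟩ := ih h1; exact ⟨rfl, rfl⟩
    | loop_step h1 hv _ _ => exact absurd (ih h1).1.symm hv
  | loop_step _ hv _ _ ih1 ih2 ih3 =>
    intro y' t' h'
    cases h' with
    | loop_done h1 => exact absurd (ih1 h1).1 hv
    | loop_step h1 _ h2 h3 =>
      obtain ⟨rfl, rfl⟩ := ih1 h1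
      obtain ⟨rfl, rfl⟩ := ih2 h2
      obtain ⟨rfl, rfl⟩ := ih3 h3
      exact ⟨rfl, rfl⟩

/-! ## The flexible storage allocation problem -/

/-- An instance: `n` jobs and `W` units of the resource; job `i` is the half-open interval
`[s i, e i)`, may receive at most `rmax i` units, and yields the profit `p i` per unit. -/
structure Instance where
  n : ℕ
  W : ℕ
  s : Fin n → ℚ≥0
  e : Fin n → ℚ≥0
  rmax : Fin n → ℕ
  p : Fin n → ℚ≥0
  W_pos : 0 < W
  s_le_e : ∀ i, s i ≤ e i
  one_le_p : ∀ i, 1 ≤ p i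

namespace Instance

/-- The job `i` as an interval on the real line. -/
def interval (I : Instance) (i : Fin I.n) : Set ℝ := Set.Ico (I.s i : ℝ) (I.e i : ℝ)

/-- The interval graph: two distinct jobs are adjacent when their intervals intersect. -/
def graph (I : Instance) : SimpleGraph (Fin I.n) where
  Adj i j := i ≠ j ∧ (I.interval i ∩ I.interval j).Nonempty
  symm := ⟨fun i j h => ⟨h.1.symm, by rw [Set.inter_comm]; exact h.2⟩⟩
  loopless := ⟨fun _ h => h.1 rfl⟩

/-- An assignment of a set of colors (resource units) to every job. -/
abbrev Coloring (I : Instance) : Type := Fin I.n → Finset ℕ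

/-- Feasible solutions: every job receives a block of at most `rmax i` consecutive colors (possibly
none) from `{1, …, W}`, and intersecting jobs receive disjoint blocks. -/
structure IsFeasible (I : Instance) (c : I.Coloring) : Prop where
  subset : ∀ i, c i ⊆ Finset.Icc 1 I.W
  contiguous : ∀ i, ∃ a b, c i = Finset.Ico a b
  card_le : ∀ i, (c i).card ≤ I.rmax i
  disjoint : ∀ i j, I.graph.Adj i j → Disjoint (c i) (c j)

/-- The total profit of a coloring. -/
noncomputable def profit (I : Instance) (c : I.Coloring) : ℝ :=
  ∑ i, (I.p i : ℝ) * ((c i).card : ℝ)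

/-- The optimal profit. -/
noncomputable def opt (I : Instance) : ℝ := sSup {v | ∃ c, I.IsFeasible c ∧ I.profit c = v}

/-- The optimal profit is attained by a feasible solution and bounds all of them. -/
theorem isGreatest_opt (I : Instance) :
    IsGreatest {v | ∃ c, I.IsFeasible c ∧ I.profit c = v} I.opt := by
  have hfin : Set.Finite {v | ∃ c, I.IsFeasible c ∧ I.profit c = v} := by
    have h1 : Set.Finite {c : I.Coloring | I.IsFeasible c} := by
      refine (Set.Finite.pi' (t := fun _ : Fin I.n => ((Finset.Icc 1 I.W).powerset : Set (Finset ℕ)))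
        (fun _ => Finset.finite_toSet _)).subset ?_
      intro c hc i
      exact Finset.mem_coe.2 (Finset.mem_powerset.2 (hc.subset i))
    exact (h1.image I.profit).subset (by rintro v ⟨c, hc, rfl⟩; exact ⟨c, hc, rfl⟩)
  have hne : Set.Nonempty {v | ∃ c, I.IsFeasible c ∧ I.profit c = v} :=
    ⟨_, fun _ => ∅, ⟨fun i => by simp, fun i => ⟨0, 0, by simp⟩, fun i => by simp,
      fun i j _ => by simp⟩, rfl⟩
  exact ⟨hne.csSup_mem hfin, fun v hv => le_csSup hfin.bddAbove hv⟩

/-- The instance as an input of a program, with all numbers in binary. -/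
def encode (I : Instance) : Data :=
  .node (.leaf I.W) (Data.ofList (List.ofFn fun i =>
    .node (.node (Data.ofRat (I.s i)) (Data.ofRat (I.e i)))
      (.node (.leaf (I.rmax i)) (Data.ofRat (I.p i)))))

/-- The datum `y` describes the coloring `c`: it is the list, in the order of the jobs, of the
first color and the length of the block of each job. -/
def Describes (I : Instance) (y : Data) (c : I.Coloring) : Prop :=
  ∃ a m : Fin I.n → ℕ,
    y = Data.ofList (List.ofFn fun i => .node (.leaf (a i)) (.leaf (m i))) ∧
      ∀ i, c i = Finset.Ico (a i) (a i + m i)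

/-- Uniform instances: all jobs have the maximum requirement `Max` and unit profit. -/
structure IsUniform (I : Instance) (Max : ℕ) : Prop where
  one_le : 1 ≤ Max
  le_W : Max ≤ I.W
  rmax_eq : ∀ i, I.rmax i = Max
  p_eq : ∀ i, I.p i = 1

/-- The `j`-th strip (`j = 0, 1, …`) when the colors `1, …, W` are cut into consecutive strips of
`d` colors each, the last one possibly shorter. -/
def strip (I : Instance) (d j : ℕ) : Finset ℕ :=
  Finset.Icc (j * d + 1) (min ((j + 1) * d) I.W)

/-- Every job receives a union of strips of width `d`. -/
def IsStripColoring (I : Instance) (d : ℕ) (c : I.Coloring) : Prop :=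
  ∀ i j, I.strip d j ⊆ c i ∨ Disjoint (I.strip d j) (c i)

/-- `S` is the vertex set of a maximum `m`-colorable induced subgraph of the interval graph. -/
def IsMaxColorable (I : Instance) (m : ℕ) (S : Finset (Fin I.n)) : Prop :=
  (I.graph.induce (S : Set (Fin I.n))).Colorable m ∧
    ∀ T : Finset (Fin I.n), (I.graph.induce (T : Set (Fin I.n))).Colorable m → T.card ≤ S.card

/-- The coloring `c` is a possible outcome of the scheme with parameter `ε` on a uniform instance
with maximum requirement `Max`, where `k = ⌈W / Max⌉` and `d = ⌊ε Max / 4⌋`: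
* if `k ≤ 1 / ε` and `d ≥ 1`, a best feasible coloring among those made of strips of width `d`;
* if `k ≤ 1 / ε` and `d = 0`, an optimal coloring;
* if `k > 1 / ε`, a coloring that gives `Max` colors out of `{1, …, (k - 1) Max}` to each job of a
  maximum `(k - 1)`-colorable subgraph and nothing to the others, and that is optimal among the
  feasible colorings with the colors `{1, …, (k - 1) Max}`. -/
def IsSchemeOutcome (I : Instance) (Max : ℕ) (ε : ℚ) (c : I.Coloring) : Prop :=
  let k : ℕ := ⌈(I.W : ℚ) / (Max : ℚ)⌉₊
  let d : ℕ := ⌊ε * (Max : ℚ) / 4⌋₊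
  ((k : ℚ) ≤ 1 / ε → 1 ≤ d →
    I.IsStripColoring d c ∧
      ∀ c', I.IsFeasible c' → I.IsStripColoring d c' → I.profit c' ≤ I.profit c) ∧
  ((k : ℚ) ≤ 1 / ε → d = 0 → I.profit c = I.opt) ∧
  (1 / ε < (k : ℚ) →
    (∃ S, I.IsMaxColorable (k - 1) S ∧
      (∀ i ∈ S, (c i).card = Max ∧ c i ⊆ Finset.Icc 1 ((k - 1) * Max)) ∧
      (∀ i ∉ S, c i = ∅)) ∧
    ∀ c', I.IsFeasible c' → (∀ i, c' i ⊆ Finset.Icc 1 ((k - 1) * Max)) →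
      I.profit c' ≤ I.profit c)

end Instance

/-- The family of programs `A` is a polynomial-time approximation scheme for the instances that
satisfy `U`: for every fixed `ε > 0`, the program `A ε` halts on each such instance within a time
that is polynomial in the size of the input and returns a feasible solution with at least
`1 - ε` times the optimal profit. -/
def IsPTAS (U : Instance → Prop) (A : ℝ → Prog) : Prop :=
  ∀ ε : ℝ, 0 < ε → ∃ P : Polynomial ℕ, ∀ I : Instance, U I →
    ∃ (y : Data) (t : ℕ) (c : I.Coloring),
      Runs (A ε) I.encode y t ∧ t ≤ P.eval I.encode.size ∧
      I.Describes y c ∧ I.IsFeasible c ∧ (1 - ε) * I.opt ≤ I.profit c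

end FSAP

/-! ## Polynomial-time functions on typed data -/

namespace FSAP

/-! Put k = ⌈W/Max⌉. If k > 1/ε, only the first (k-1)Max colors are used. Residues of the colors
modulo Max split any feasible solution into Max families of jobs: a block of at most Max consecutive
colors meets each residue at most once, and the jobs that meet a given residue are properly colored
by the quotients (`exists_residue_classes`). With m·Max colors every family is m-colorable, so a
maximum (k-1)-colorable set of jobs, each with a full block, is optimal for (k-1)Max colors. With
all W ≤ k·Max colors every family is k-colorable, and omitting its smallest class costs a factor 1 -
1/k > 1 - ε (`card_mul_le_of_colorable`). The maximum set is found by a sweep over the starts: when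
m kept jobs still run and another one starts, the one that ends last is discarded
(`countP_le_greedy`).

If k ≤ 1/ε, the number of strips is bounded in terms of ε alone, so a dynamic program whose state is
the time at which each strip becomes free has polynomially many states (`dp_sound`, `dp_complete`,
`best_dp`). Strips lose little: take q sample points in every Max consecutive positions, at distance
at least d, and send a block boundary z to d times the number of samples before z. This map is
monotone, so disjoint blocks stay disjoint, and on average over the Max shifts of the samples a
block of length l keeps the length l·dq/Max. For q = ⌊Max/d⌋ - 1 some shift keeps a factor of at
least 1 - 2d/Max ≥ 1 - ε/2 (`exists_stripColoring`). When d = 0, strips of width 1 lose nothing.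

The programs are not written out. `PT` is closed under composition, branching, arithmetic and folds
with polynomially bounded intermediate states, and `fun_prop` derives it for most parts of the
algorithm. Endpoints are replaced by their ranks, so that times are bounded in value, not only in
bit length, by a polynomial. -/

/-- Types whose elements are represented by data. -/
class Enc (α : Type) where
  enc : α → Data

open Enc

instance : Enc ℕ := ⟨Data.leaf⟩
instance : Enc Bool := ⟨fun b => Data.leaf (if b then 1 else 0)⟩
instance {α β : Type} [Enc α] [Enc β] : Enc (α × β) := ⟨fun x => .node (enc x.1) (enc x.2)⟩
instance {α : Type} [Enc α] : Enc (List α) := ⟨fun l => Data.ofList (l.map enc)⟩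

/-- The bit size of the representation. -/
def sz {α : Type} [Enc α] (a : α) : ℕ := (enc a).size

/-! ### Bit sizes of encoded numbers, pairs and lists. -/

section sizes
variable {α β : Type} [Enc α] [Enc β]

theorem enc_pair (a : α) (b : β) : enc (a, b) = .node (enc a) (enc b) := rfl
theorem enc_nat (n : ℕ) : enc n = .leaf n := rfl
theorem enc_nil : enc ([] : List α) = .leaf 0 := rfl
theorem enc_cons (a : α) (l : List α) : enc (a :: l) = .node (enc a) (enc l) := rfl
theorem enc_true : enc true = .leaf 1 := rfl

theorem sz_pair (x : α × β) : sz x = sz x.1 + sz x.2 + 1 := rfl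
theorem sz_nat (n : ℕ) : sz n = n.size + 1 := rfl
theorem sz_nil : sz ([] : List α) = 1 := rfl
theorem sz_cons (a : α) (l : List α) : sz (a :: l) = sz a + sz l + 1 := rfl
theorem sz_bool_le (b : Bool) : sz b ≤ 2 := by cases b <;> simp [sz, enc, Data.size]

theorem size_nat_le_self (n : ℕ) : n.size ≤ n := Nat.size_le.2 n.lt_two_pow_self

theorem sz_nat_le (n : ℕ) : sz n ≤ n + 1 := by
  rw [sz_nat]; exact Nat.add_le_add_right (size_nat_le_self n) 1

theorem sz_nat_mono {m n : ℕ} (h : m ≤ n) : sz m ≤ sz n := by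
  rw [sz_nat, sz_nat]; exact Nat.add_le_add_right (Nat.size_le_size h) 1

/-- A sum may have one more bit than its longer summand; the extra unit charged for each leaf
absorbs this carry. -/
theorem sz_add_le (m n : ℕ) : sz (m + n) ≤ sz m + sz n := by
  simp only [sz_nat]
  have : (m + n).size ≤ m.size + n.size + 1 := by
    refine Nat.size_le.2 ?_
    have h1 := Nat.lt_size_self m
    have h2 := Nat.lt_size_self n
    have h3 : 2 ^ m.size ≤ 2 ^ (m.size + n.size) := Nat.pow_le_pow_right (by norm_num) (by omega)
    have h4 : 2 ^ n.size ≤ 2 ^ (m.size + n.size) := Nat.pow_le_pow_right (by norm_num) (by omega)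
    rw [pow_succ]; omega
  omega

theorem sz_mul_le (m n : ℕ) : sz (m * n) ≤ sz m + sz n := by
  simp only [sz_nat]
  have : (m * n).size ≤ m.size + n.size := by
    refine Nat.size_le.2 ?_
    rw [pow_add]
    exact Nat.mul_lt_mul'' (Nat.lt_size_self m) (Nat.lt_size_self n)
  omega

theorem sz_append (l l' : List α) : sz (l ++ l') + 1 = sz l + sz l' := by
  induction l with
  | nil => simp [sz_nil, Nat.add_comm]
  | cons a l ih => simp only [List.cons_append, sz_cons]; omega

theorem length_lt_sz (l : List α) : l.length < sz l := by
  induction l with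
  | nil => simp [sz_nil]
  | cons a l ih => simp only [List.length_cons, sz_cons]; omega

theorem sz_lt_of_mem {l : List α} {a : α} (h : a ∈ l) : sz a < sz l := by
  induction l with
  | nil => simp at h
  | cons b l ih =>
    rw [sz_cons]
    rcases List.mem_cons.1 h with rfl | h
    · omega
    · have := ih h; omega

theorem sz_list_le {l : List α} {B : ℕ} (h : ∀ a ∈ l, sz a ≤ B) :
    sz l ≤ l.length * (B + 1) + 1 := by
  induction l with
  | nil => simp [sz_nil]
  | cons a l ih =>
    have h1 := h a (by simp)
    have h2 := ih fun b hb => h b (by simp [hb])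
    rw [sz_cons, List.length_cons, Nat.add_mul]; omega

theorem sz_le_of_sublist {l l' : List α} (h : l.Sublist l') : sz l ≤ sz l' := by
  induction h with
  | slnil => exact le_rfl
  | cons a _ ih => rw [sz_cons]; omega
  | cons_cons a _ ih => rw [sz_cons, sz_cons]; omega

end sizes

/-- Every result is paid for when it is produced, so a time bound also bounds the output. This lets
polynomial bounds pass through compositions. -/
theorem Runs.size_le {p : Prog} {x y : Data} {t : ℕ} (h : Runs p x y t) : y.size ≤ t := by
  induction h with
  | op o x => omega
  | pair _ _ _ _ => simp only [Data.size]; omega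
  | seq _ _ _ _ => omega
  | cond_true _ _ _ _ _ => omega
  | cond_false _ _ _ _ => omega
  | loop_done _ _ => omega
  | loop_step _ _ _ _ _ _ _ => omega

theorem eval_mono (P : Polynomial ℕ) {m n : ℕ} (h : m ≤ n) : P.eval m ≤ P.eval n := by
  simp only [Polynomial.eval_eq_sum]
  exact Finset.sum_le_sum fun i _ => Nat.mul_le_mul_left _ (Nat.pow_le_pow_left h i)

/-- `g` is bounded by a polynomial in the bit size of the argument. -/
def PB {α : Type} [Enc α] (g : α → ℕ) : Prop := ∃ P : Polynomial ℕ, ∀ a, g a ≤ P.eval (sz a)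

/-- `f` is computed by a program in polynomial time. -/
@[fun_prop]
def PT {α β : Type} [Enc α] [Enc β] (f : α → β) : Prop :=
  ∃ (p : Prog) (P : Polynomial ℕ), ∀ a, ∃ t, Runs p (enc a) (enc (f a)) t ∧ t ≤ P.eval (sz a)

/-! ### Closure properties of polynomial bounds. -/

section bounds
variable {α β : Type} [Enc α] [Enc β] {f g : α → ℕ}

theorem PB.const (n : ℕ) : PB fun _ : α => n := ⟨Polynomial.C n, fun a => by simp⟩
theorem PB.sz : PB fun a : α => FSAP.sz a := ⟨Polynomial.X, fun a => by simp⟩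
theorem PB.add (hf : PB f) (hg : PB g) : PB fun a => f a + g a := by
  obtain ⟨P, hP⟩ := hf
  obtain ⟨Q, hQ⟩ := hg
  exact ⟨P + Q, fun a => by rw [Polynomial.eval_add]; exact Nat.add_le_add (hP a) (hQ a)⟩
theorem PB.mul (hf : PB f) (hg : PB g) : PB fun a => f a * g a := by
  obtain ⟨P, hP⟩ := hf
  obtain ⟨Q, hQ⟩ := hg
  exact ⟨P * Q, fun a => by rw [Polynomial.eval_mul]; exact Nat.mul_le_mul (hP a) (hQ a)⟩
theorem PB.pow (hf : PB f) (n : ℕ) : PB fun a => f a ^ n := by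
  obtain ⟨P, hP⟩ := hf
  exact ⟨P ^ n, fun a => by rw [Polynomial.eval_pow]; exact Nat.pow_le_pow_left (hP a) n⟩
theorem PB.mono (hg : PB g) (h : ∀ a, f a ≤ g a) : PB f := by
  obtain ⟨P, hP⟩ := hg
  exact ⟨P, fun a => (h a).trans (hP a)⟩
theorem PT.pb_sz {f : α → β} (hf : PT f) : PB fun a => FSAP.sz (f a) := by
  obtain ⟨p, P, h⟩ := hf
  refine ⟨P, fun a => ?_⟩
  obtain ⟨t, ht, hle⟩ := h a
  exact ht.size_le.trans hle
theorem PB.comp {g : β → ℕ} {f : α → β} (hg : PB g) (hf : PT f) : PB fun a => g (f a) := by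
  obtain ⟨Q, hQ⟩ := hg
  obtain ⟨P, hP⟩ := hf.pb_sz
  refine ⟨Q.comp P, fun a => ?_⟩
  rw [Polynomial.eval_comp]
  exact (hQ _).trans (eval_mono Q (hP a))
theorem PB.eval (hf : PB f) (Q : Polynomial ℕ) : PB fun a => Q.eval (f a) := by
  obtain ⟨P, hP⟩ := hf
  exact ⟨Q.comp P, fun a => by rw [Polynomial.eval_comp]; exact eval_mono Q (hP a)⟩
theorem PB.length {f : α → List β} (hf : PT f) : PB fun a => (f a).length :=
  hf.pb_sz.mono fun a => (length_lt_sz (f a)).le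

end bounds

/-! ### Closure properties of polynomial-time functions. -/

namespace PT
variable {α β γ σ : Type} [Enc α] [Enc β] [Enc γ] [Enc σ]

/-- The cost of an elementary operation is the size of its argument and its result, so only the size
of the result has to be controlled. -/
theorem ofOp (o : Op) {f : α → β} (h : ∀ a, o.apply (enc a) = enc (f a))
    (hb : PB fun a => FSAP.sz (f a)) : PT f := by
  obtain ⟨P, hP⟩ := (PB.sz.add hb).add (PB.const 1)
  refine ⟨.op o, P, fun a => ⟨_, by rw [← h a]; exact Runs.op o _, ?_⟩⟩
  rw [h a]; exact hP a

@[fun_prop]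
theorem id : PT fun a : α => a := ofOp .id (fun _ => rfl) PB.sz
@[fun_prop]
theorem const (b : β) : PT fun _ : α => b := ofOp (.const (enc b)) (fun _ => rfl) (PB.const _)

@[fun_prop]
theorem comp {g : β → γ} {f : α → β} (hg : PT g) (hf : PT f) : PT fun a => g (f a) := by
  obtain ⟨q, Q, hq⟩ := hg
  obtain ⟨R, hR⟩ := hf.pb_sz.eval Q
  obtain ⟨p, P, hp⟩ := hf
  refine ⟨.seq p q, P + R + 1, fun a => ?_⟩
  obtain ⟨t, ht, hle⟩ := hp a
  obtain ⟨u, hu, hle'⟩ := hq (f a)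
  have : Q.eval (FSAP.sz (f a)) ≤ R.eval (FSAP.sz a) := hR a
  refine ⟨_, ht.seq hu, ?_⟩
  simp only [Polynomial.eval_add, Polynomial.eval_one]
  omega

@[fun_prop]
theorem prodMk {f : α → β} {g : α → γ} (hf : PT f) (hg : PT g) : PT fun a => (f a, g a) := by
  obtain ⟨p, P, hp⟩ := hf
  obtain ⟨q, Q, hq⟩ := hg
  refine ⟨.pair p q, P + Q + Polynomial.X + 1, fun a => ?_⟩
  obtain ⟨t, ht, hle⟩ := hp a
  obtain ⟨u, hu, hle'⟩ := hq a
  refine ⟨_, ht.pair hu, ?_⟩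
  simp only [Polynomial.eval_add, Polynomial.eval_one, Polynomial.eval_X]
  have : (enc a).size = FSAP.sz a := rfl
  omega

theorem _root_.FSAP.PB.of_le_sz {f : α → β} (h : ∀ a, FSAP.sz (f a) ≤ FSAP.sz a) :
    PB fun a => FSAP.sz (f a) := PB.sz.mono h

theorem fst_aux : PT (fun x : α × β => x.1) :=
  ofOp .fst (fun _ => rfl) (PB.of_le_sz fun x => by rw [sz_pair x]; omega)
theorem snd_aux : PT (fun x : α × β => x.2) :=
  ofOp .snd (fun _ => rfl) (PB.of_le_sz fun x => by rw [sz_pair x]; omega)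

@[fun_prop]
theorem fst {f : α → β × γ} (hf : PT f) : PT fun a => (f a).1 := comp fst_aux hf
@[fun_prop]
theorem snd {f : α → β × γ} (hf : PT f) : PT fun a => (f a).2 := comp snd_aux hf

/-- Branching. -/
@[fun_prop]
theorem ite {c : α → Bool} {f g : α → β} (hc : PT c) (hf : PT f) (hg : PT g) :
    PT fun a => if c a = true then f a else g a := by
  obtain ⟨r, R, hr⟩ := hc
  obtain ⟨p, P, hp⟩ := hf
  obtain ⟨q, Q, hq⟩ := hg
  refine ⟨.cond r p q, P + Q + R + Polynomial.X + 1, fun a => ?_⟩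
  obtain ⟨t, ht, hle⟩ := hp a
  obtain ⟨u, hu, hle'⟩ := hq a
  obtain ⟨w, hw, hle''⟩ := hr a
  have : (enc a).size = FSAP.sz a := rfl
  by_cases h : c a = true
  · rw [h] at hw
    refine ⟨_, by simp only [h, if_true]; exact Runs.cond_true hw (by rw [enc_true]; simp) ht, ?_⟩
    simp only [Polynomial.eval_add, Polynomial.eval_one, Polynomial.eval_X]
    omega
  · rw [Bool.not_eq_true] at h
    rw [h] at hw
    refine ⟨_, by simp only [h, Bool.false_eq_true, if_false]; exact Runs.cond_false hw hu, ?_⟩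
    simp only [Polynomial.eval_add, Polynomial.eval_one, Polynomial.eval_X]
    omega

section arith
variable {f g : α → ℕ}

@[fun_prop]
theorem add (hf : PT f) (hg : PT g) : PT fun a => f a + g a :=
  comp (f := fun a => (f a, g a)) (g := fun x : ℕ × ℕ => x.1 + x.2)
    (ofOp .add (fun _ => rfl) (PB.of_le_sz fun x => by
      have := sz_add_le x.1 x.2; rw [sz_pair x]; omega)) (prodMk hf hg)
@[fun_prop]
theorem mul (hf : PT f) (hg : PT g) : PT fun a => f a * g a :=
  comp (f := fun a => (f a, g a)) (g := fun x : ℕ × ℕ => x.1 * x.2)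
    (ofOp .mul (fun _ => rfl) (PB.of_le_sz fun x => by
      have := sz_mul_le x.1 x.2; rw [sz_pair x]; omega)) (prodMk hf hg)
@[fun_prop]
theorem sub (hf : PT f) (hg : PT g) : PT fun a => f a - g a :=
  comp (f := fun a => (f a, g a)) (g := fun x : ℕ × ℕ => x.1 - x.2)
    (ofOp .sub (fun _ => rfl) (PB.of_le_sz fun x => by
      have := sz_nat_mono (Nat.sub_le x.1 x.2); rw [sz_pair x]; omega)) (prodMk hf hg)
@[fun_prop]
theorem div (hf : PT f) (hg : PT g) : PT fun a => f a / g a :=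
  comp (f := fun a => (f a, g a)) (g := fun x : ℕ × ℕ => x.1 / x.2)
    (ofOp .div (fun _ => rfl) (PB.of_le_sz fun x => by
      have := sz_nat_mono (Nat.div_le_self x.1 x.2); rw [sz_pair x]; omega)) (prodMk hf hg)
@[fun_prop]
theorem ble (hf : PT f) (hg : PT g) : PT fun a => Nat.ble (f a) (g a) :=
  comp (f := fun a => (f a, g a)) (g := fun x : ℕ × ℕ => Nat.ble x.1 x.2)
    (ofOp .le (fun x => by
      by_cases h : x.1 ≤ x.2 <;> simp [enc, Op.apply, Data.arith, h])
      ((PB.const 2).mono fun x => sz_bool_le _)) (prodMk hf hg)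

end arith

section bool
variable {f g : α → Bool}

@[fun_prop]
theorem and (hf : PT f) (hg : PT g) : PT fun a => (f a && g a) := by
  have : (fun a => (f a && g a)) = fun a => if f a = true then g a else false := by
    funext a; cases f a <;> simp
  rw [this]; fun_prop
@[fun_prop]
theorem not (hf : PT f) : PT fun a => !(f a) := by
  have : (fun a => !(f a)) = fun a => if f a = true then false else true := by
    funext a; cases f a <;> simp
  rw [this]; fun_prop
@[fun_prop]
theorem or (hf : PT f) (hg : PT g) : PT fun a => (f a || g a) := by
  have : (fun a => (f a || g a)) = fun a => if f a = true then true else g a := by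
    funext a; cases f a <;> simp
  rw [this]; fun_prop
@[fun_prop]
theorem beq {f g : α → ℕ} (hf : PT f) (hg : PT g) : PT fun a => Nat.beq (f a) (g a) := by
  have : (fun a => Nat.beq (f a) (g a)) = fun a => Nat.ble (f a) (g a) && Nat.ble (g a) (f a) := by
    funext a
    rw [Bool.eq_iff_iff]
    simp [Nat.le_antisymm_iff]
  rw [this]; fun_prop
@[fun_prop]
theorem min {f g : α → ℕ} (hf : PT f) (hg : PT g) : PT fun a => Nat.min (f a) (g a) := by
  have : (fun a => Nat.min (f a) (g a)) = fun a =>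
      if Nat.ble (f a) (g a) = true then f a else g a := by
    funext a
    simp only [Nat.ble_eq]
    exact min_def _ _
  rw [this]; fun_prop

end bool

section lists

-- A nonempty list is encoded exactly like the pair of its head and its tail, so the pairing program
-- serves unchanged.
@[fun_prop]
theorem cons {f : α → β} {l : α → List β} (hf : PT f) (hl : PT l) : PT fun a => f a :: l a := by
  obtain ⟨p, P, h⟩ := prodMk hf hl
  exact ⟨p, P, h⟩

theorem isEmpty_aux : PT fun l : List α => l.isEmpty :=
  ofOp .isLeaf (fun l => by cases l <;> rfl) ((PB.const 2).mono fun x => sz_bool_le _)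
@[fun_prop]
theorem isEmpty {l : α → List β} (hl : PT l) : PT fun a => (l a).isEmpty := comp isEmpty_aux hl

theorem tail_aux : PT fun l : List α => l.tail :=
  ofOp .snd (fun l => by cases l <;> rfl) (PB.of_le_sz fun l => sz_le_of_sublist l.tail_sublist)
@[fun_prop]
theorem tail {l : α → List β} (hl : PT l) : PT fun a => (l a).tail := comp tail_aux hl

/-- The branch is needed for the empty list: there the first projection gives `leaf 0`, which need
not encode the default element. -/
theorem headI_aux [Inhabited α] : PT fun l : List α => l.headI := by
  obtain ⟨r, R, hr⟩ := isEmpty_aux (α := α)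
  refine ⟨.cond r (.op (.const (enc (default : α)))) (.op .fst),
    R + 3 * Polynomial.X + Polynomial.C (FSAP.sz (default : α)) + 2, fun l => ?_⟩
  obtain ⟨w, hw, hle⟩ := hr l
  cases l with
  | nil =>
    refine ⟨_, Runs.cond_true hw (by simp [enc]) (Runs.op _ _), ?_⟩
    simp only [Polynomial.eval_add, Polynomial.eval_X, Polynomial.eval_C, Polynomial.eval_mul,
      Polynomial.eval_ofNat, Op.apply, sz] at *
    omega
  | cons b l =>
    refine ⟨_, Runs.cond_false hw (Runs.op _ _), ?_⟩
    simp only [Polynomial.eval_add, Polynomial.eval_X, Polynomial.eval_C, Polynomial.eval_mul,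
      Polynomial.eval_ofNat, Op.apply, sz, enc_cons, Data.size] at *
    omega
@[fun_prop]
theorem headI [Inhabited β] {l : α → List β} (hl : PT l) : PT fun a => (l a).headI :=
  comp headI_aux hl

/-- If all states have size at most `B`, every round costs at most the last factor; the last of the
`k + 1` rounds is the failing test. The bound `B` is a hypothesis because a polynomial-time step can
still square the size each time it is iterated. -/
theorem loop_runs {b : α → Bool} {g : α → α} {pb pg : Prog} {Pb Pg : Polynomial ℕ}
    (hb : ∀ a, ∃ t, Runs pb (enc a) (enc (b a)) t ∧ t ≤ Pb.eval (FSAP.sz a))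
    (hg : ∀ a, ∃ t, Runs pg (enc a) (enc (g a)) t ∧ t ≤ Pg.eval (FSAP.sz a)) (B : ℕ) :
    ∀ (k : ℕ) (a : α), (∀ i < k, b (g^[i] a) = true) → b (g^[k] a) = false →
      (∀ i ≤ k, FSAP.sz (g^[i] a) ≤ B) →
      ∃ t, Runs (.loop pb pg) (enc a) (enc (g^[k] a)) t ∧
        t ≤ (k + 1) * (Pb.eval B + Pg.eval B + B + 1) := by
  intro k
  induction k with
  | zero =>
    intro a _ h0 hB
    obtain ⟨t, ht, hle⟩ := hb a
    have h1 := hB 0 le_rfl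
    simp only [Function.iterate_zero, id_eq] at h0 h1
    rw [h0] at ht
    refine ⟨_, Runs.loop_done ht, ?_⟩
    have h2 := eval_mono Pb h1
    have : (enc a).size = FSAP.sz a := rfl
    omega
  | succ k ih =>
    intro a h1 h0 hB
    obtain ⟨t, ht, hle⟩ := hb a
    obtain ⟨u, hu, hle'⟩ := hg a
    have hB0 := hB 0 (by omega)
    have hb0 := h1 0 (by omega)
    simp only [Function.iterate_zero, id_eq] at hB0 hb0
    rw [hb0] at ht
    obtain ⟨w, hw, hle''⟩ := ih (g a) (fun i hi => h1 (i + 1) (by omega)) h0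
      fun i hi => hB (i + 1) (by omega)
    refine ⟨_, Runs.loop_step ht (by rw [enc_true]; simp) hu hw, ?_⟩
    have h2 := eval_mono Pb hB0
    have h3 := eval_mono Pg hB0
    have : (enc a).size = FSAP.sz a := rfl
    rw [Nat.add_mul (k + 1) 1]
    omega

/-- Iteration over a list, with polynomially bounded intermediate states. -/
theorem foldl [Inhabited β] {l : α → List β} {i : α → σ} {f : α → σ → β → σ} {B : α → ℕ}
    (hl : PT l) (hi : PT i) (hf : PT fun x : α × σ × β => f x.1 x.2.1 x.2.2) (hB : PB B)
    (h : ∀ a p, p <+: l a → FSAP.sz (p.foldl (f a) (i a)) ≤ B a) :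
    PT fun a => (l a).foldl (f a) (i a) := by
  -- The loop state carries the parameter, the accumulator and the unread part of the list, since a
  -- program sees nothing but its current datum.
  let g : α × σ × List β → α × σ × List β := fun x => (x.1, f x.1 x.2.1 x.2.2.headI, x.2.2.tail)
  let b : α × σ × List β → Bool := fun x => !x.2.2.isEmpty
  have hb : PT b := by fun_prop
  have hg : PT g := prodMk (by fun_prop) (prodMk
    (comp (f := fun x : α × σ × List β => (x.1, x.2.1, x.2.2.headI)) hf (by fun_prop))
    (by fun_prop))
  obtain ⟨pb, Pb, hpb⟩ := hb
  obtain ⟨pg, Pg, hpg⟩ := hg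
  have hiter : ∀ (a : α) (s : σ) (l : List β) (k : ℕ), k ≤ l.length →
      g^[k] (a, s, l) = (a, (l.take k).foldl (f a) s, l.drop k) := by
    intro a s l k
    induction k with
    | zero => intro _; simp
    | succ k ih =>
      intro hk
      rw [Function.iterate_succ_apply', ih (by omega)]
      have hd : l.drop k = l[k] :: l.drop (k + 1) := List.drop_eq_getElem_cons (by omega)
      have ht : l.take (k + 1) = l.take k ++ [l[k]] := (List.take_concat_get' l k (by omega)).symm
      simp only [g, hd, ht, List.foldl_append, List.foldl_cons, List.foldl_nil, List.tail_cons,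
        List.headI_cons]
  obtain ⟨p0, P0, h0⟩ : PT fun a => (a, i a, l a) := by fun_prop
  obtain ⟨p1, P1, h1⟩ : PT fun x : α × σ × List β => x.2.1 := by fun_prop
  let S : α → ℕ := fun a => FSAP.sz a + B a + FSAP.sz (l a) + 2
  have hS : PB S := ((PB.sz.add hB).add hl.pb_sz).add (PB.const 2)
  obtain ⟨Q, hQ⟩ := ((((PB.length hl).add (PB.const 1)).mul
    ((((hS.eval Pb).add (hS.eval Pg)).add hS).add (PB.const 1))).add (hS.eval P1)).add (PB.const 2)
  refine ⟨.seq p0 (.seq (.loop pb pg) p1), P0 + Q, fun a => ?_⟩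
  have hsz : ∀ k ≤ (l a).length, FSAP.sz (g^[k] (a, i a, l a)) ≤ S a := by
    intro k hk
    rw [hiter _ _ _ _ hk, sz_pair, sz_pair]
    have h2 := h a _ (List.take_prefix k (l a))
    have h3 := sz_le_of_sublist (List.drop_sublist k (l a))
    simp only [S]; omega
  obtain ⟨t, ht, hle⟩ := h0 a
  obtain ⟨u, hu, hle'⟩ := loop_runs hpb hpg (S a) (l a).length (a, i a, l a)
    (fun k hk => by rw [hiter _ _ _ _ hk.le]; simpa [b] using hk)
    (by rw [hiter _ _ _ _ le_rfl]; simp [b]) hsz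
  obtain ⟨w, hw, hle''⟩ := h1 (g^[(l a).length] (a, i a, l a))
  have h4 := eval_mono P1 (hsz _ le_rfl)
  refine ⟨_, ht.seq (hu.seq (u := w) (z := enc ((l a).foldl (f a) (i a))) ?_), ?_⟩
  · rw [hiter _ _ _ _ le_rfl, List.take_length] at hw ⊢
    exact hw
  · have h5 := hQ a
    simp only at h5
    rw [Polynomial.eval_add]
    omega

/-- Iteration over a list where every step adds a polynomially bounded amount of data. -/
theorem foldl_of_growth [Inhabited β] {l : α → List β} {i : α → σ} {f : α → σ → β → σ} {G : α → ℕ}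
    (hl : PT l) (hi : PT i) (hf : PT fun x : α × σ × β => f x.1 x.2.1 x.2.2) (hG : PB G)
    (h : ∀ a s, ∀ b ∈ l a, FSAP.sz (f a s b) ≤ FSAP.sz s + G a) :
    PT fun a => (l a).foldl (f a) (i a) := by
  refine foldl hl hi hf (B := fun a => FSAP.sz (i a) + (l a).length * G a)
    (hi.pb_sz.add ((PB.length hl).mul hG)) fun a p hp => ?_
  have key : ∀ p : List β, (∀ b ∈ p, b ∈ l a) →
      FSAP.sz (p.foldl (f a) (i a)) ≤ FSAP.sz (i a) + p.length * G a := by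
    intro p
    induction p using List.reverseRecOn with
    | nil => intro _; simp
    | append_singleton p b ih =>
      intro hb
      have h1 := ih fun c hc => hb c (by simp [hc])
      have h2 := h a (p.foldl (f a) (i a)) b (hb b (by simp))
      simp only [List.foldl_append, List.foldl_cons, List.foldl_nil, List.length_append,
        List.length_singleton, Nat.add_mul, one_mul]
      omega
  refine (key p fun b hb => hp.subset hb).trans ?_
  exact Nat.add_le_add_left (Nat.mul_le_mul_right _ hp.length_le) _

/-- An element of a list is no larger than the list, so the size of a value computed from it is
bounded in terms of `a` alone, as `foldl_of_growth` requires. -/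
theorem pb_elem {l : α → List β} {g : α × β → γ} (hl : PT l) (hg : PT g) :
    ∃ G : α → ℕ, PB G ∧ ∀ a, ∀ b ∈ l a, FSAP.sz (g (a, b)) ≤ G a := by
  obtain ⟨P, hP⟩ := hg.pb_sz
  refine ⟨_, ((PB.sz.add hl.pb_sz).add (PB.const 1)).eval P, fun a b hb => (hP _).trans ?_⟩
  refine eval_mono P ?_
  have := sz_lt_of_mem hb
  rw [sz_pair]
  dsimp only
  omega

variable [Inhabited β]

@[fun_prop]
theorem reverse {l : α → List β} (hl : PT l) : PT fun a => (l a).reverse := by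
  have : (fun a => (l a).reverse) = fun a => (l a).foldl (fun s b => b :: s) [] := by
    funext a; simp
  rw [this]
  refine foldl_of_growth (f := fun _ s b => b :: s) (G := fun a => FSAP.sz (l a)) hl (const _)
    (by fun_prop) hl.pb_sz fun a s b hb => ?_
  have := sz_lt_of_mem hb
  rw [sz_cons]; omega

@[fun_prop]
theorem append {l l' : α → List β} (hl : PT l) (hl' : PT l') : PT fun a => l a ++ l' a := by
  have : (fun a => l a ++ l' a) = fun a => (l a).reverse.foldl (fun s b => b :: s) (l' a) := by
    funext a; simp
  rw [this]
  refine foldl_of_growth (f := fun _ s b => b :: s) (G := fun a => FSAP.sz (l a)) (by fun_prop) hl'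
    (by fun_prop) hl.pb_sz fun a s b hb => ?_
  have := sz_lt_of_mem (List.mem_reverse.1 hb)
  rw [sz_cons]; omega

@[fun_prop]
theorem length {l : α → List β} (hl : PT l) : PT fun a => (l a).length := by
  have : (fun a => (l a).length) = fun a => (l a).foldl (fun s _ => s + 1) 0 := by
    funext a; simp
  rw [this]
  refine foldl_of_growth (f := fun _ s _ => s + 1) (G := fun _ => 2) hl (const _)
    (by fun_prop) (PB.const _) fun a s b hb => ?_
  exact sz_add_le s 1

variable [Inhabited γ]

@[fun_prop]
theorem flatMap {l : α → List β} {f : α → β → List γ} (hl : PT l)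
    (hf : PT fun x : α × β => f x.1 x.2) : PT fun a => (l a).flatMap (f a) := by
  have : (fun a => (l a).flatMap (f a)) = fun a => (l a).foldl (fun s b => s ++ f a b) [] := by
    funext a; simp [List.flatMap_def]
  rw [this]
  obtain ⟨G, hG, h⟩ := pb_elem hl hf
  refine foldl_of_growth (f := fun a s b => s ++ f a b) (G := G) hl (const _)
    (append (by fun_prop) (comp (f := fun x : α × List γ × β => (x.1, x.2.2)) hf (by fun_prop)))
    hG fun a s b hb => ?_
  have h1 := h a b hb
  have h2 := sz_append s (f a b)
  dsimp only at h1
  omega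

@[fun_prop]
theorem map {l : α → List β} {f : α → β → γ} (hl : PT l)
    (hf : PT fun x : α × β => f x.1 x.2) : PT fun a => (l a).map (f a) := by
  have : (fun a => (l a).map (f a)) = fun a => (l a).flatMap fun b => [f a b] := by
    funext a; simp [List.map_eq_flatMap]
  rw [this]
  exact flatMap hl (cons hf (const _))

@[fun_prop]
theorem filter {l : α → List β} {f : α → β → Bool} (hl : PT l)
    (hf : PT fun x : α × β => f x.1 x.2) : PT fun a => (l a).filter (f a) := by
  have : (fun a => (l a).filter (f a)) = fun a =>
      (l a).flatMap fun b => if f a b = true then [b] else [] := by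
    funext a
    induction l a with
    | nil => rfl
    | cons b l ih => by_cases h : f a b = true <;> simp [h, ih]
  rw [this]
  exact flatMap hl (by fun_prop)

@[fun_prop]
theorem all {l : α → List β} {f : α → β → Bool} (hl : PT l)
    (hf : PT fun x : α × β => f x.1 x.2) : PT fun a => (l a).all (f a) := by
  have : (fun a => (l a).all (f a)) = fun a =>
      ((l a).filter fun b => !f a b).isEmpty := by
    funext a
    rw [Bool.eq_iff_iff]
    simp
  rw [this]
  exact isEmpty (filter hl (by fun_prop))

-- The step reads the next index off the accumulator, so its growth has no bound valid for all
-- states. The state after each prefix is identified instead, and its indices are below the length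
-- of the list.
@[fun_prop]
theorem zipIdx {l : α → List β} (hl : PT l) : PT fun a => (l a).zipIdx := by
  have : (fun a => (l a).zipIdx) = fun a => (l a).foldl (fun s b => s ++ [(b, s.length)]) [] := by
    funext a
    induction l a using List.reverseRecOn with
    | nil => rfl
    | append_singleton p b ih => rw [List.foldl_append, ← ih]; simp [List.zipIdx_append]
  rw [this]
  refine foldl (f := fun _ s b => s ++ [(b, s.length)])
    (B := fun a => (l a).length * ((FSAP.sz (l a) + (FSAP.sz (l a) + 1) + 1) + 1) + 1) hl (const _)
    (by fun_prop)
    (((PB.length hl).mul ((((hl.pb_sz.add (hl.pb_sz.add (PB.const 1))).add (PB.const 1)).add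
      (PB.const 1)))).add (PB.const 1)) fun a p hp => ?_
  have h1 : p.foldl (fun s b => s ++ [(b, s.length)]) [] = p.zipIdx := by
    induction p using List.reverseRecOn with
    | nil => rfl
    | append_singleton p b ih =>
      rw [List.foldl_append, ih ((List.prefix_append _ _).trans hp)]; simp [List.zipIdx_append]
  rw [h1]
  refine (sz_list_le (B := FSAP.sz (l a) + (FSAP.sz (l a) + 1) + 1) fun x hx => ?_).trans ?_
  · have h2 := sz_lt_of_mem (hp.subset (List.fst_mem_of_mem_zipIdx hx))
    have h3 := List.snd_lt_of_mem_zipIdx hx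
    have h4 := hp.length_le
    have h5 := length_lt_sz (l a)
    have h6 := sz_nat_le x.2
    rw [sz_pair]
    omega
  · rw [List.length_zipIdx]
    exact Nat.add_le_add_right (Nat.mul_le_mul_right _ hp.length_le) _

-- The bound of the range is the length of a list, hence given in unary; the range up to a number
-- given in binary would be exponentially long.
@[fun_prop]
theorem range_length {l : α → List β} (hl : PT l) : PT fun a => List.range (l a).length := by
  have : (fun a => List.range (l a).length) = fun a => (l a).zipIdx.map fun x => x.2 := by
    funext a
    induction l a using List.reverseRecOn with
    | nil => rfl
    | append_singleton p b ih =>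
      simp [List.zipIdx_append, List.range_succ, ih]
  rw [this]
  fun_prop

end lists

end PT

end FSAP

/-! ## The algorithm -/

namespace FSAP

/-- A job with its index, and with endpoints replaced by natural numbers. -/
abbrev Job : Type := ℕ × ℕ × ℕ

/-- The input of the algorithm: `W`, and for each job the endpoints, the maximum requirement and
the profit. -/
abbrev Raw : Type := ℕ × List (((ℕ × ℕ) × (ℕ × ℕ)) × (ℕ × (ℕ × ℕ)))

/-- A partial solution of the dynamic program: the time at which each strip becomes free, the
profit, and for each job its index and the first color and the length of its block. -/
abbrev Cand : Type := List ℕ × ℕ × List (ℕ × ℕ × ℕ)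

/-- An element of `d :: l` with the largest value of `f`. -/
def argmax {β : Type} (f : β → ℕ) (l : List β) (d : β) : β :=
  l.foldl (fun b x => if Nat.ble (f x) (f b) = true then b else x) d

/-- The least natural number outside a list. -/
def mex (cs : List ℕ) : ℕ :=
  -- One candidate more than there are forbidden values, so one is left. The number is written as a
  -- length to make the range polynomial.
  ((List.range (0 :: cs).length).filter fun c => cs.all fun x => !Nat.beq x c).headI

/-- The jobs of `K` that are still running when `j` starts. -/
def active (K : List (Job × ℕ)) (j : Job) : List (Job × ℕ) :=
  K.filter fun k => !Nat.ble k.1.2.2 j.2.1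

/-- Replace the job of `l` by `j`, with the same color, if it ends later. -/
def exchange (K : List (Job × ℕ)) (j : Job) (l : Job × ℕ) : List (Job × ℕ) :=
  if Nat.ble l.1.2.2 j.2.2 = true then K
  else (j, l.2) :: K.filter fun k => !Nat.beq k.1.1 l.1.1

/-- One step of the greedy algorithm for maximum `m`-colorable subgraphs. -/
def greedyStep (m : ℕ) (K : List (Job × ℕ)) (j : Job) : List (Job × ℕ) :=
  -- A job with an empty interval conflicts with no job and may take any color.
  if Nat.ble j.2.2 j.2.1 = true then (j, 0) :: K
  else if Nat.ble m (active K j).length = true then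
    -- The new job is the initial candidate, so it is itself the one rejected when no active job
    -- ends later.
    exchange K j (argmax (fun k => k.1.2.2) (active K j) (j, 0))
  else (j, mex ((active K j).map fun k => k.2)) :: K

/-- The greedy algorithm, for jobs sorted by their starts: a maximum `m`-colorable subgraph and a
coloring of it. -/
def greedy (m : ℕ) (L : List Job) : List (Job × ℕ) := L.foldl (greedyStep m) []

/-- `x` lies in `[u, v)`. -/
def inBlock (o : ℕ × ℕ) (x : ℕ) : Bool := Nat.ble o.1 x && !Nat.ble o.2 x

/-- The strips of `o` are free at time `s`. -/
def fits (F : List ℕ) (s : ℕ) (o : ℕ × ℕ) : Bool :=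
  F.zipIdx.all fun x => !inBlock o x.2 || Nat.ble x.1 s

/-- Occupy the strips of `o` until time `e`. -/
def occupy (F : List ℕ) (e : ℕ) (o : ℕ × ℕ) : List ℕ :=
  F.zipIdx.map fun x => if inBlock o x.2 = true then e else x.1

/-- The number of colors in the strips of `o`. -/
def blockLen (W d : ℕ) (o : ℕ × ℕ) : ℕ := Nat.min (o.2 * d) W - o.1 * d

/-- Extend a partial solution by giving the strips of `o` to `j`. -/
def extend (W d : ℕ) (j : Job) (c : Cand) (o : ℕ × ℕ) : Cand :=
  -- An empty interval must not move the times: its end could set back a strip that is still in use.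
  (if Nat.ble j.2.2 j.2.1 = true then c.1 else occupy c.1 j.2.2 o,
    c.2.1 + blockLen W d o, (j.1, o.1 * d + 1, blockLen W d o) :: c.2.2)

/-- All extensions of a partial solution by the job `j`. -/
def expand (W d : ℕ) (opts : List (ℕ × ℕ)) (j : Job) (c : Cand) : List Cand :=
  (opts.filter fun o => Nat.ble j.2.2 j.2.1 || fits c.1 j.2.1 o).map (extend W d j c)

/-- Equality of lists of numbers. -/
def listBeq (l l' : List ℕ) : Bool :=
  (l.foldl (fun (s : Bool × List ℕ) b =>
    (s.1 && (!s.2.isEmpty && Nat.beq s.2.headI b), s.2.tail)) (true, l')).1 &&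
  (l.foldl (fun (s : Bool × List ℕ) b =>
    (s.1 && (!s.2.isEmpty && Nat.beq s.2.headI b), s.2.tail)) (true, l')).2.isEmpty

/-- Insert a partial solution into a table with one best entry for every state. -/
def insertCand (T : List Cand) (c : Cand) : List Cand :=
  if T.all (fun x => !(listBeq x.1 c.1 && Nat.ble c.2.1 x.2.1)) = true then
    c :: T.filter fun x => !listBeq x.1 c.1
  else T

/-- Keep one best partial solution for every state. -/
def prune (l : List Cand) : List Cand := l.foldl insertCand []

/-- One step of the dynamic program. -/
def dpStep (W d : ℕ) (opts : List (ℕ × ℕ)) (T : List Cand) (j : Job) : List Cand :=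
  prune (T.flatMap (expand W d opts j))

/-- The dynamic program, for jobs sorted by their starts, with `C` strips. -/
def dp (C W d : ℕ) (opts : List (ℕ × ℕ)) (L : List Job) : List Cand :=
  L.foldl (dpStep W d opts) [(List.replicate C 0, 0, [])]

/-- The list of blocks of an optimal partial solution. -/
def best (T : List Cand) : List (ℕ × ℕ × ℕ) := (argmax (fun c => c.2.1) T ([], 0, [])).2.2

/-- Comparison of fractions. -/
def ratLt (x y : ℕ × ℕ) : Bool := !Nat.ble (y.1 * x.2) (x.1 * y.2)

/-- The endpoints of the jobs. -/
def endpoints (r : Raw) : List (ℕ × ℕ) := r.2.flatMap fun j => [j.1.1, j.1.2]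

/-- The number of elements of `E` below `x`. -/
def rank (E : List (ℕ × ℕ)) (x : ℕ × ℕ) : ℕ := (E.filter fun y => ratLt y x).length

/-- The jobs with their indices and the ranks of their endpoints. -/
def jobs (r : Raw) : List Job :=
  r.2.zipIdx.map fun p => (p.2, rank (endpoints r) p.1.1.1, rank (endpoints r) p.1.1.2)

/-- The jobs in the order of their starts. -/
def sortedJobs (r : Raw) : List Job :=
  (List.range (endpoints r).length).flatMap fun t => (jobs r).filter fun j => Nat.beq j.2.1 t

/-- The common maximum requirement. -/
def maxReq (r : Raw) : ℕ := r.2.headI.2.1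

/-- The number `⌈W / Max⌉`. -/
def ceilDiv (r : Raw) : ℕ := (r.1 + maxReq r - 1) / maxReq r

/-- The width of the strips, for `ε = a / b`. -/
def width (a b : ℕ) (r : Raw) : ℕ := a * maxReq r / (4 * b) + (1 - a * maxReq r / (4 * b))

/-- All pairs of numbers up to `C`. -/
def allPairs (C : ℕ) : List (ℕ × ℕ) :=
  (List.range (C + 1)).flatMap fun u => (List.range (C + 1)).map fun v => (u, v)

/-- The blocks of strips with at most `Max` colors. -/
def options (C W d Max : ℕ) : List (ℕ × ℕ) :=
  (allPairs C).filter fun o => Nat.ble (blockLen W d o) Max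

/-- The blocks that the algorithm assigns, for `ε = a / b` and at most `C` strips. -/
def assignment (a b C : ℕ) (r : Raw) : List (ℕ × ℕ × ℕ) :=
  if Nat.ble (ceilDiv r * a) b = true then
    best (dp C r.1 (width a b r) (options C r.1 (width a b r) (maxReq r)) (sortedJobs r))
  -- No color is left here, whereas the greedy algorithm with m = 0 would still keep the jobs with
  -- empty intervals.
  else if Nat.ble (ceilDiv r) 1 = true then []
  else (greedy (ceilDiv r - 1) (sortedJobs r)).map fun k =>
    (k.1.1, k.2 * maxReq r + 1, maxReq r)

/-- The first color and the length of the block with index `i`. -/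
def lookup (A : List (ℕ × ℕ × ℕ)) (i : ℕ) : ℕ × ℕ :=
  ((A.filter fun x => Nat.beq x.1 i).map fun x => x.2).headI

/-- The output of the algorithm. -/
def solve (a b C : ℕ) (r : Raw) : List (ℕ × ℕ) :=
  r.2.zipIdx.map fun p => lookup (assignment a b C r) p.2

/-! ### Running time -/

namespace PT
variable {α β : Type} [Enc α] [Enc β]

@[fun_prop]
theorem argmax [Inhabited β] {f : α → β → ℕ} {l : α → List β} {d : α → β}
    (hf : PT fun x : α × β => f x.1 x.2) (hl : PT l) (hd : PT d) :
    PT fun a => FSAP.argmax (f a) (l a) (d a) := by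
  unfold FSAP.argmax
  refine foldl_of_growth (f := fun a b x => if Nat.ble (f a x) (f a b) = true then b else x)
    (G := fun a => sz (l a)) hl hd ?_ hl.pb_sz fun a s b hb => ?_
  · exact ite (ble (comp (f := fun x : α × β × β => (x.1, x.2.2)) hf (by fun_prop))
      (comp (f := fun x : α × β × β => (x.1, x.2.1)) hf (by fun_prop))) (by fun_prop) (by fun_prop)
  · have := sz_lt_of_mem hb
    split_ifs <;> omega

@[fun_prop]
theorem mex {l : α → List ℕ} (hl : PT l) : PT fun a => FSAP.mex (l a) := by
  unfold FSAP.mex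
  fun_prop

@[fun_prop]
theorem active {K : α → List (Job × ℕ)} {j : α → Job} (hK : PT K) (hj : PT j) :
    PT fun a => FSAP.active (K a) (j a) := by
  unfold FSAP.active
  fun_prop

@[fun_prop]
theorem exchange {K : α → List (Job × ℕ)} {j : α → Job} {l : α → Job × ℕ} (hK : PT K) (hj : PT j)
    (hl : PT l) : PT fun a => FSAP.exchange (K a) (j a) (l a) := by
  unfold FSAP.exchange
  fun_prop

@[fun_prop]
theorem greedyStep {m : α → ℕ} {K : α → List (Job × ℕ)} {j : α → Job} (hm : PT m) (hK : PT K)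
    (hj : PT j) : PT fun a => FSAP.greedyStep (m a) (K a) (j a) := by
  unfold FSAP.greedyStep
  fun_prop

@[fun_prop]
theorem inBlock {o : α → ℕ × ℕ} {x : α → ℕ} (ho : PT o) (hx : PT x) :
    PT fun a => FSAP.inBlock (o a) (x a) := by
  unfold FSAP.inBlock
  fun_prop

@[fun_prop]
theorem fits {F : α → List ℕ} {s : α → ℕ} {o : α → ℕ × ℕ} (hF : PT F) (hs : PT s) (ho : PT o) :
    PT fun a => FSAP.fits (F a) (s a) (o a) := by
  unfold FSAP.fits
  fun_prop

@[fun_prop]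
theorem occupy {F : α → List ℕ} {s : α → ℕ} {o : α → ℕ × ℕ} (hF : PT F) (hs : PT s) (ho : PT o) :
    PT fun a => FSAP.occupy (F a) (s a) (o a) := by
  unfold FSAP.occupy
  fun_prop

@[fun_prop]
theorem blockLen {W d : α → ℕ} {o : α → ℕ × ℕ} (hW : PT W) (hd : PT d) (ho : PT o) :
    PT fun a => FSAP.blockLen (W a) (d a) (o a) := by
  unfold FSAP.blockLen
  fun_prop

@[fun_prop]
theorem extend {W d : α → ℕ} {j : α → Job} {c : α → Cand} {o : α → ℕ × ℕ} (hW : PT W) (hd : PT d)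
    (hj : PT j) (hc : PT c) (ho : PT o) :
    PT fun a => FSAP.extend (W a) (d a) (j a) (c a) (o a) := by
  unfold FSAP.extend
  fun_prop

@[fun_prop]
theorem expand {W d : α → ℕ} {os : α → List (ℕ × ℕ)} {j : α → Job} {c : α → Cand} (hW : PT W)
    (hd : PT d) (ho : PT os) (hj : PT j) (hc : PT c) :
    PT fun a => FSAP.expand (W a) (d a) (os a) (j a) (c a) := by
  unfold FSAP.expand
  fun_prop

@[fun_prop]
theorem listBeq {l l' : α → List ℕ} (hl : PT l) (hl' : PT l') :
    PT fun a => FSAP.listBeq (l a) (l' a) := by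
  have : PT fun a => (l a).foldl (fun (s : Bool × List ℕ) b =>
      (s.1 && (!s.2.isEmpty && Nat.beq s.2.headI b), s.2.tail)) (true, l' a) := by
    refine foldl_of_growth (f := fun _ (s : Bool × List ℕ) b =>
      (s.1 && (!s.2.isEmpty && Nat.beq s.2.headI b), s.2.tail)) (G := fun _ => 2) hl (by fun_prop)
      (by fun_prop) (PB.const 2) fun a s b hb => ?_
    rw [sz_pair, sz_pair]
    have h1 := sz_bool_le (s.1 && (!s.2.isEmpty && Nat.beq s.2.headI b))
    have h2 := sz_le_of_sublist s.2.tail_sublist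
    dsimp only
    omega
  unfold FSAP.listBeq
  fun_prop

@[fun_prop]
theorem insertCand {T : α → List Cand} {c : α → Cand} (hT : PT T) (hc : PT c) :
    PT fun a => FSAP.insertCand (T a) (c a) := by
  unfold FSAP.insertCand
  fun_prop

@[fun_prop]
theorem prune {l : α → List Cand} (hl : PT l) : PT fun a => FSAP.prune (l a) := by
  unfold FSAP.prune
  refine foldl_of_growth (f := fun _ => FSAP.insertCand) (G := fun a => sz (l a)) hl (by fun_prop)
    (by fun_prop) hl.pb_sz fun a T c hc => ?_
  have h1 := sz_lt_of_mem hc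
  have h2 : sz (T.filter fun x => !FSAP.listBeq x.1 c.1) ≤ sz T :=
    sz_le_of_sublist List.filter_sublist
  unfold FSAP.insertCand
  split_ifs
  · rw [sz_cons]; omega
  · omega

@[fun_prop]
theorem dpStep {W d : α → ℕ} {os : α → List (ℕ × ℕ)} {T : α → List Cand} {j : α → Job} (hW : PT W)
    (hd : PT d) (ho : PT os) (hT : PT T) (hj : PT j) :
    PT fun a => FSAP.dpStep (W a) (d a) (os a) (T a) (j a) := by
  unfold FSAP.dpStep
  fun_prop

@[fun_prop]
theorem best {T : α → List Cand} (hT : PT T) : PT fun a => FSAP.best (T a) := by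
  unfold FSAP.best
  fun_prop

@[fun_prop]
theorem ratLt {x y : α → ℕ × ℕ} (hx : PT x) (hy : PT y) : PT fun a => FSAP.ratLt (x a) (y a) := by
  unfold FSAP.ratLt
  fun_prop

@[fun_prop]
theorem rank {E : α → List (ℕ × ℕ)} {x : α → ℕ × ℕ} (hE : PT E) (hx : PT x) :
    PT fun a => FSAP.rank (E a) (x a) := by
  unfold FSAP.rank
  fun_prop

@[fun_prop]
theorem endpoints {r : α → Raw} (hr : PT r) : PT fun a => FSAP.endpoints (r a) := by
  unfold FSAP.endpoints
  fun_prop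

@[fun_prop]
theorem jobs {r : α → Raw} (hr : PT r) : PT fun a => FSAP.jobs (r a) := by
  unfold FSAP.jobs
  fun_prop

@[fun_prop]
theorem sortedJobs {r : α → Raw} (hr : PT r) : PT fun a => FSAP.sortedJobs (r a) := by
  unfold FSAP.sortedJobs
  fun_prop

@[fun_prop]
theorem maxReq {r : α → Raw} (hr : PT r) : PT fun a => FSAP.maxReq (r a) := by
  unfold FSAP.maxReq
  fun_prop

@[fun_prop]
theorem ceilDiv {r : α → Raw} (hr : PT r) : PT fun a => FSAP.ceilDiv (r a) := by
  unfold FSAP.ceilDiv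
  fun_prop

@[fun_prop]
theorem width {a b : ℕ} {r : α → Raw} (hr : PT r) : PT fun x => FSAP.width a b (r x) := by
  unfold FSAP.width
  fun_prop

@[fun_prop]
theorem options {C : ℕ} {W d M : α → ℕ} (hW : PT W) (hd : PT d) (hM : PT M) :
    PT fun a => FSAP.options C (W a) (d a) (M a) := by
  unfold FSAP.options
  fun_prop

@[fun_prop]
theorem lookup {A : α → List (ℕ × ℕ × ℕ)} {i : α → ℕ} (hA : PT A) (hi : PT i) :
    PT fun a => FSAP.lookup (A a) (i a) := by
  unfold FSAP.lookup
  fun_prop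

end PT
end FSAP

/-! ### Selection of colors and jobs, and the steps of the greedy algorithm. -/

namespace FSAP

@[simp]
theorem ble_eq_false {a b : ℕ} : Nat.ble a b = false ↔ b < a := by
  rw [← Bool.not_eq_true, Nat.ble_eq, not_le]

@[simp]
theorem beq_eq_false {a b : ℕ} : Nat.beq a b = false ↔ a ≠ b := by
  rw [← Bool.not_eq_true, Nat.beq_eq]

theorem headI_mem {α : Type} [Inhabited α] {l : List α} (h : l ≠ []) : l.headI ∈ l := by
  cases l with
  | nil => exact absurd rfl h
  | cons a l => simp

theorem mex_le (cs : List ℕ) : mex cs ≤ cs.length := by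
  unfold mex
  by_cases h : ((List.range (0 :: cs).length).filter fun c => cs.all fun x => !Nat.beq x c) = []
  · rw [h]; exact Nat.zero_le _
  · exact Nat.lt_succ_iff.1 (by simpa using (headI_mem h |> List.mem_filter.1).1)

theorem mex_notMem (cs : List ℕ) : mex cs ∉ cs := by
  have h : ((List.range (0 :: cs).length).filter fun c => cs.all fun x => !Nat.beq x c) ≠ [] := by
    intro h
    rw [List.filter_eq_nil_iff] at h
    have hs : List.range (cs.length + 1) ⊆ cs := by
      intro c hc
      by_contra hcs
      refine h c (by simpa using hc) ?_
      simp only [List.all_eq_true, Bool.not_eq_true', beq_eq_false]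
      exact fun x hx hxc => hcs (hxc ▸ hx)
    -- Pigeonhole: `cs` would contain `cs.length + 1` distinct numbers.
    have := (List.nodup_range.subperm hs).length_le
    simp at this
  have := (List.mem_filter.1 (headI_mem h)).2
  simp only [List.all_eq_true, Bool.not_eq_true', beq_eq_false] at this
  exact fun hm => this _ hm rfl

theorem argmax_spec {β : Type} (f : β → ℕ) (l : List β) (d : β) :
    argmax f l d ∈ d :: l ∧ ∀ x ∈ d :: l, f x ≤ f (argmax f l d) := by
  unfold argmax
  induction l generalizing d with
  | nil => simp
  | cons b l ih =>
    rw [List.foldl_cons]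
    by_cases h : f b ≤ f d
    · obtain ⟨h1, h2⟩ := ih d
      rw [if_pos (by simpa using h)]
      refine ⟨?_, fun x hx => ?_⟩
      · rcases List.mem_cons.1 h1 with h1 | h1
        · rw [h1]; simp
        · exact List.mem_cons_of_mem _ (List.mem_cons_of_mem _ h1)
      rcases List.mem_cons.1 hx with rfl | hx
      · exact h2 _ (by simp)
      rcases List.mem_cons.1 hx with rfl | hx
      · exact h.trans (h2 _ (by simp))
      · exact h2 _ (by simp [hx])
    · obtain ⟨h1, h2⟩ := ih b
      rw [if_neg (by simpa using h)]
      refine ⟨?_, fun x hx => ?_⟩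
      · rcases List.mem_cons.1 h1 with h1 | h1
        · rw [h1]; simp
        · exact List.mem_cons_of_mem _ (List.mem_cons_of_mem _ h1)
      rcases List.mem_cons.1 hx with rfl | hx
      · exact (by omega : f x ≤ f b).trans (h2 _ (by simp))
      rcases List.mem_cons.1 hx with rfl | hx
      · exact h2 _ (by simp)
      · exact h2 _ (by simp [hx])

theorem mem_active {K : List (Job × ℕ)} {j : Job} {k : Job × ℕ} :
    k ∈ active K j ↔ k ∈ K ∧ j.2.1 < k.1.2.2 := by
  simp [active, List.mem_filter]

theorem greedy_concat (m : ℕ) (L : List Job) (j : Job) :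
    greedy m (L ++ [j]) = greedyStep m (greedy m L) j := by
  simp [greedy, List.foldl_append]

/-- The three cases of a step of the greedy algorithm. -/
theorem greedyStep_cases (m : ℕ) (K : List (Job × ℕ)) (j : Job) :
    (j.2.2 ≤ j.2.1 ∧ greedyStep m K j = (j, 0) :: K) ∨
    (j.2.1 < j.2.2 ∧ (active K j).length < m ∧
      greedyStep m K j = (j, mex ((active K j).map fun k => k.2)) :: K) ∨
    (j.2.1 < j.2.2 ∧ m ≤ (active K j).length ∧ (∀ k ∈ active K j, k.1.2.2 ≤ j.2.2) ∧
      greedyStep m K j = K) ∨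
    (j.2.1 < j.2.2 ∧ m ≤ (active K j).length ∧ ∃ l ∈ active K j, j.2.2 < l.1.2.2 ∧
      (∀ k ∈ active K j, k.1.2.2 ≤ l.1.2.2) ∧
      greedyStep m K j = (j, l.2) :: K.filter fun k => !Nat.beq k.1.1 l.1.1) := by
  unfold greedyStep
  by_cases h1 : j.2.2 ≤ j.2.1
  · exact Or.inl ⟨h1, if_pos (by simpa using h1)⟩
  rw [if_neg (by simpa using h1)]
  by_cases h2 : m ≤ (active K j).length
  · rw [if_pos (by simpa using h2)]
    obtain ⟨h3, h4⟩ := argmax_spec (fun k : Job × ℕ => k.1.2.2) (active K j) (j, 0)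
    unfold exchange
    by_cases h5 : (argmax (fun k : Job × ℕ => k.1.2.2) (active K j) (j, 0)).1.2.2 ≤ j.2.2
    · rw [if_pos (by simpa using h5)]
      exact Or.inr <| Or.inr <| Or.inl ⟨by omega, h2, fun k hk => (h4 k (by simp [hk])).trans h5, rfl⟩
    · rw [if_neg (by simpa using h5)]
      refine Or.inr <| Or.inr <| Or.inr ⟨by omega, h2, _, ?_, by omega,
        fun k hk => h4 k (by simp [hk]), rfl⟩
      rcases List.mem_cons.1 h3 with h3 | h3
      · rw [h3] at h5; simp at h5
      · exact h3
  · rw [if_neg (by simpa using h2)]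
    exact Or.inr <| Or.inl ⟨by omega, by omega, rfl⟩

/-- Needed for the running time only. A color is 0, inherited, or a least free number, which is at
most the number of active jobs; so it stays below the length of the list whatever `m` is. -/
theorem greedy_bounds (m : ℕ) (L : List Job) :
    (greedy m L).length ≤ L.length ∧ ∀ k ∈ greedy m L, k.1 ∈ L ∧ k.2 ≤ L.length := by
  induction L using List.reverseRecOn with
  | nil => simp [greedy]
  | append_singleton L j ih =>
    obtain ⟨ih1, ih2⟩ := ih
    have hK : ∀ k ∈ greedy m L, k.1 ∈ L ++ [j] ∧ k.2 ≤ (L ++ [j]).length := fun k hk =>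
      ⟨by simp [(ih2 k hk).1], by have := (ih2 k hk).2; simp; omega⟩
    rw [greedy_concat]
    rcases greedyStep_cases m (greedy m L) j with ⟨_, h⟩ | ⟨_, _, h⟩ | ⟨_, _, _, h⟩ |
      ⟨_, _, l, hl, _, _, h⟩ <;> rw [h]
    · refine ⟨by simpa using ih1, fun k hk => ?_⟩
      rcases List.mem_cons.1 hk with rfl | hk
      · simp
      · exact hK k hk
    · refine ⟨by simpa using ih1, fun k hk => ?_⟩
      rcases List.mem_cons.1 hk with rfl | hk
      · refine ⟨by simp, ?_⟩
        have h1 := mex_le ((active (greedy m L) j).map fun k => k.2)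
        have h2 : (active (greedy m L) j).length ≤ (greedy m L).length := List.length_filter_le _ _
        simp only [List.length_map, List.length_append] at *
        omega
      · exact hK k hk
    · exact ⟨by simp; omega, hK⟩
    · refine ⟨?_, fun k hk => ?_⟩
      · have := List.length_filter_le (fun k : Job × ℕ => !Nat.beq k.1.1 l.1.1) (greedy m L)
        simp; omega
      · rcases List.mem_cons.1 hk with rfl | hk
        · exact ⟨by simp, (hK l (mem_active.1 hl).1).2⟩
        · exact hK k (List.mem_of_mem_filter hk)

@[fun_prop]
theorem PT.greedy {α : Type} [Enc α] {m : α → ℕ} {L : α → List Job} (hm : PT m) (hL : PT L) :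
    PT fun a => FSAP.greedy (m a) (L a) := by
  unfold FSAP.greedy
  refine PT.foldl (f := fun a => FSAP.greedyStep (m a))
    (B := fun a => sz (L a) * (sz (L a) + (sz (L a) + 1) + 1 + 1) + 1) hL (by fun_prop)
    (by fun_prop)
    ((hL.pb_sz.mul (((hL.pb_sz.add (hL.pb_sz.add (PB.const 1))).add (PB.const 1)).add
      (PB.const 1))).add (PB.const 1)) fun a p hp => ?_
  have h0 : p.foldl (FSAP.greedyStep (m a)) [] = FSAP.greedy (m a) p := rfl
  obtain ⟨h1, h2⟩ := greedy_bounds (m a) p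
  have h3 := length_lt_sz (L a)
  have h4 := hp.length_le
  rw [h0]
  refine (sz_list_le (B := sz (L a) + (sz (L a) + 1) + 1) fun k hk => ?_).trans ?_
  · have h5 := sz_lt_of_mem (hp.subset (h2 k hk).1)
    have h6 := sz_nat_le k.2
    have h7 := (h2 k hk).2
    rw [sz_pair]; omega
  · exact Nat.add_le_add_right (Nat.mul_le_mul_right _ (by omega)) _

/-! ### Correctness of the greedy algorithm -/

/-- Two jobs whose (nonempty) intervals intersect. -/
def Job.conflict (j j' : Job) : Prop :=
  j.2.1 < j.2.2 ∧ j'.2.1 < j'.2.2 ∧ j.2.1 < j'.2.2 ∧ j'.2.1 < j.2.2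

theorem Job.conflict_symm {j j' : Job} (h : j.conflict j') : j'.conflict j :=
  ⟨h.2.1, h.1, h.2.2.2, h.2.2.1⟩

/-- Jobs with distinct indices in the order of their starts. -/
def Sorted (L : List Job) : Prop :=
  L.Pairwise (fun j j' => j.2.1 ≤ j'.2.1) ∧ (L.map fun j => j.1).Nodup

theorem Sorted.of_concat {L : List Job} {j : Job} (h : Sorted (L ++ [j])) :
    Sorted L ∧ (∀ i ∈ L, i.2.1 ≤ j.2.1) ∧ ∀ i ∈ L, i.1 ≠ j.1 := by
  obtain ⟨h1, h2⟩ := h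
  rw [List.pairwise_append] at h1
  rw [List.map_append, List.nodup_append] at h2
  exact ⟨⟨h1.1, h2.1⟩, fun i hi => h1.2.2 i hi j (by simp),
    fun i hi => h2.2.2 _ (List.mem_map_of_mem hi) _ (by simp)⟩

/-- The greedy algorithm finds jobs with distinct indices and a proper coloring of them. -/
theorem greedy_sound {m : ℕ} (hm : 0 < m) {L : List Job} (hL : Sorted L) :
    ((greedy m L).map fun k => k.1.1).Nodup ∧ (∀ k ∈ greedy m L, k.1 ∈ L ∧ k.2 < m) ∧
    ∀ k ∈ greedy m L, ∀ k' ∈ greedy m L, k.1.conflict k'.1 → k.1.1 ≠ k'.1.1 → k.2 ≠ k'.2 := by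
  induction L using List.reverseRecOn with
  | nil => simp [greedy]
  | append_singleton L j ih =>
    obtain ⟨hL, hs, hid⟩ := hL.of_concat
    obtain ⟨ih1, ih2, ih3⟩ := ih hL
    have hK : ∀ k ∈ greedy m L, k.1 ∈ L ++ [j] ∧ k.2 < m := fun k hk =>
      ⟨by simp [(ih2 k hk).1], (ih2 k hk).2⟩
    have hidK : ∀ k ∈ greedy m L, k.1.1 ≠ j.1 := fun k hk => hid _ (ih2 k hk).1
    -- The three cases that keep the new job differ only in the sublist retained and in the color,
    -- which must avoid the colors of the conflicting jobs.
    have key : ∀ (K : List (Job × ℕ)) (c : ℕ), K.Sublist (greedy m L) → c < m →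
        (∀ k ∈ K, k.1.conflict j → k.2 ≠ c) →
        (((j, c) :: K).map fun k => k.1.1).Nodup ∧
        (∀ k ∈ (j, c) :: K, k.1 ∈ L ++ [j] ∧ k.2 < m) ∧
        ∀ k ∈ (j, c) :: K, ∀ k' ∈ (j, c) :: K, k.1.conflict k'.1 → k.1.1 ≠ k'.1.1 → k.2 ≠ k'.2 := by
      intro K c hsub hc hcol
      refine ⟨?_, ?_, ?_⟩
      · rw [List.map_cons, List.nodup_cons]
        refine ⟨?_, (hsub.map _).nodup ih1⟩
        intro h
        obtain ⟨k, hk, hkj⟩ := List.mem_map.1 h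
        exact hidK k (hsub.subset hk) hkj
      · intro k hk
        rcases List.mem_cons.1 hk with rfl | hk
        · exact ⟨by simp, hc⟩
        · exact hK k (hsub.subset hk)
      · intro k hk k' hk' hcf hne
        rcases List.mem_cons.1 hk with rfl | hk <;> rcases List.mem_cons.1 hk' with rfl | hk'
        · exact absurd rfl hne
        · exact (hcol k' hk' (Job.conflict_symm hcf)).symm
        · exact hcol k hk hcf
        · exact ih3 k (hsub.subset hk) k' (hsub.subset hk') hcf hne
    rw [greedy_concat]
    rcases greedyStep_cases m (greedy m L) j with ⟨h0, h⟩ | ⟨h0, h1, h⟩ | ⟨h0, h1, h2, h⟩ |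
      ⟨h0, h1, l, hl, h2, h3, h⟩ <;> rw [h]
    · refine key _ 0 (List.Sublist.refl _) hm fun k _ hcf => ?_
      exact absurd hcf.2.1 (by omega)
    · refine key _ _ (List.Sublist.refl _) ?_ fun k hk hcf hc => ?_
      · exact (mex_le _).trans_lt (by simpa using h1)
      · refine mex_notMem ((active (greedy m L) j).map fun k => k.2) ?_
        rw [← hc]
        exact List.mem_map_of_mem (f := fun k : Job × ℕ => k.2) (mem_active.2 ⟨hk, hcf.2.2.2⟩)
    · exact ⟨ih1, hK, ih3⟩
    · obtain ⟨hlK, hla⟩ := mem_active.1 hl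
      refine key _ _ List.filter_sublist (ih2 l hlK).2 fun k hk hcf => ?_
      simp only [List.mem_filter, Bool.not_eq_true', beq_eq_false] at hk
      -- A retained job in conflict with `j` and the discarded job `l` both started no later than
      -- `j` and both still run at its start. Hence they conflict with each other, and the color of
      -- `l` is safe for `j`.
      refine ih3 k hk.1 l hlK ?_ hk.2
      have h4 := hs _ (ih2 l hlK).1
      have h5 := hs _ (ih2 k hk.1).1
      have h6 := hcf.2.2.2
      have h7 := hcf.1
      exact ⟨h7, by omega, by omega, by omega⟩

theorem countP_le_add {α : Type} {p q r : α → Bool} {l : List α}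
    (h : ∀ x ∈ l, p x = true → q x = true ∨ r x = true) :
    l.countP p ≤ l.countP q + l.countP r := by
  induction l with
  | nil => simp
  | cons a l ih =>
    have h1 := ih fun x hx => h x (by simp [hx])
    have h2 := h a (by simp)
    simp only [List.countP_cons]
    by_cases hp : p a = true
    · rcases h2 hp with h3 | h3 <;> simp only [hp, h3, if_true] <;> omega
    · rw [if_neg hp]; omega

/-- The greedy algorithm finds a maximum set of jobs of which at most `m` run at the same time. -/
theorem countP_le_greedy {m : ℕ} (hm : 0 < m) {L : List Job} (hL : Sorted L) (T : Job → Bool)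
    (hT : ∀ τ, L.countP (fun j => T j && (Nat.ble j.2.1 τ && !Nat.ble j.2.2 τ)) ≤ m) :
    ∀ τ, (∀ j ∈ L, j.2.1 ≤ τ) → L.countP (fun j => T j && Nat.ble j.2.2 τ) ≤
      (greedy m L).countP (fun k => Nat.ble k.1.2.2 τ) := by
  induction L using List.reverseRecOn with
  | nil => simp
  | append_singleton L j ih =>
    intro τ hτ
    obtain ⟨hL', hs, hid⟩ := hL.of_concat
    obtain ⟨hnd, hK, -⟩ := greedy_sound hm hL'
    have IH := ih hL' fun τ => ((List.sublist_append_left L [j]).countP_le).trans (hT τ)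
    have hIH := IH τ fun i hi => hτ i (by simp [hi])
    have hsj := hτ j (by simp)
    have hcat : ∀ τ, (L ++ [j]).countP (fun j => T j && Nat.ble j.2.2 τ) =
        L.countP (fun j => T j && Nat.ble j.2.2 τ) +
          if (T j && Nat.ble j.2.2 τ) = true then 1 else 0 := by
      intro τ; rw [List.countP_append, List.countP_singleton]
    have hadd : (L ++ [j]).countP (fun j => T j && Nat.ble j.2.2 τ) ≤
        L.countP (fun j => T j && Nat.ble j.2.2 τ) +
          if Nat.ble j.2.2 τ = true then 1 else 0 := by
      rw [hcat]
      by_cases h : Nat.ble j.2.2 τ = true <;> cases T j <;> simp [h]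
    -- With at least m kept jobs active at the start of `j`: the jobs of `T` that have ended by then
    -- are dominated by the kept ones that have ended, by induction, and at most m jobs of `T` run
    -- at that moment. So there are no more jobs of `T` than kept jobs.
    have hfull : j.2.1 < j.2.2 → m ≤ (active (greedy m L) j).length →
        (L ++ [j]).countP (fun j => T j && Nat.ble j.2.2 τ) ≤ (greedy m L).length := by
      intro h0 h1
      have h2 : (L ++ [j]).countP (fun i => T i && Nat.ble i.2.2 τ) ≤
          (L ++ [j]).countP (fun i => T i && Nat.ble i.2.2 j.2.1) +
          (L ++ [j]).countP (fun i => T i && (Nat.ble i.2.1 j.2.1 && !Nat.ble i.2.2 j.2.1)) := by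
        refine countP_le_add fun i hi hp => ?_
        have h3 : i.2.1 ≤ j.2.1 := by
          rcases List.mem_append.1 hi with hi | hi
          · exact hs i hi
          · rw [List.mem_singleton.1 hi]
        simp only [Bool.and_eq_true, Nat.ble_eq, Bool.not_eq_true', ble_eq_false] at hp ⊢
        by_cases h4 : i.2.2 ≤ j.2.1
        · exact Or.inl ⟨hp.1, h4⟩
        · exact Or.inr ⟨hp.1, h3, by omega⟩
      have h3 := hT j.2.1
      have h4 := IH j.2.1 hs
      have h5 := List.length_eq_countP_add_countP (l := greedy m L)
        (fun k : Job × ℕ => Nat.ble k.1.2.2 j.2.1)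
      have h6 : (active (greedy m L) j).length =
          (greedy m L).countP fun k => !Nat.ble k.1.2.2 j.2.1 := List.countP_eq_length_filter.symm
      have h7 : (greedy m L).countP (fun k => decide ¬Nat.ble k.1.2.2 j.2.1 = true) =
          (greedy m L).countP fun k => !Nat.ble k.1.2.2 j.2.1 := by
        congr 1; funext k; rw [Bool.eq_iff_iff]; simp
      rw [hcat j.2.1, if_neg (by simp [h0])] at h2
      omega
    -- Once the active jobs have all ended by τ, all kept jobs count at τ, and `hfull` applies.
    have hall : ∀ b, j.2.1 ≤ b → b ≤ τ → (∀ k ∈ active (greedy m L) j, k.1.2.2 ≤ b) →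
        ∀ k ∈ greedy m L, k.1.2.2 ≤ τ := by
      intro b h0 h1 h2 k hk
      by_cases h3 : k.1.2.2 ≤ j.2.1
      · omega
      · exact (h2 k (mem_active.2 ⟨hk, by omega⟩)).trans h1
    rw [greedy_concat]
    rcases greedyStep_cases m (greedy m L) j with ⟨h0, h⟩ | ⟨h0, h1, h⟩ | ⟨h0, h1, h2, h⟩ |
      ⟨h0, h1, l, hl, h2, h3, h⟩ <;> rw [h]
    · rw [List.countP_cons]; exact hadd.trans (Nat.add_le_add_right hIH _)
    · rw [List.countP_cons]; exact hadd.trans (Nat.add_le_add_right hIH _)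
    · by_cases h4 : j.2.2 ≤ τ
      · refine (hfull h0 h1).trans (le_of_eq (List.countP_eq_length.2 fun k hk => ?_).symm)
        simpa using hall _ h0.le h4 h2 k hk
      · rw [if_neg (by simpa using h4)] at hadd
        exact hadd.trans hIH
    · have hinj : ∀ k ∈ greedy m L, k.1.1 = l.1.1 → k = l := fun k hk hkl =>
        List.inj_on_of_nodup_map hnd hk (mem_active.1 hl).1 hkl
      -- If `l`, the last active job to end, has ended by τ, so has every kept job and also `j`, and
      -- the exchange preserves the total. Otherwise `l` was not counted at τ and removing it costs
      -- nothing.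
      by_cases h4 : l.1.2.2 ≤ τ
      · have hlen : (greedy m L).length ≤
            ((greedy m L).filter fun k => !Nat.beq k.1.1 l.1.1).length + 1 := by
          have h5 := List.length_eq_countP_add_countP (l := greedy m L)
            (fun k : Job × ℕ => !Nat.beq k.1.1 l.1.1)
          rw [List.countP_eq_length_filter] at h5
          have h6 : (greedy m L).countP (fun k => decide ¬(!Nat.beq k.1.1 l.1.1) = true) ≤
              ((greedy m L).map fun k => k.1.1).count l.1.1 := by
            rw [List.count, List.countP_map]
            refine List.countP_mono_left fun k _ hk => ?_
            simpa using hk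
          have h7 := List.nodup_iff_count_le_one.1 hnd l.1.1
          omega
        refine (hfull h0 h1).trans (hlen.trans (le_of_eq ?_))
        symm
        rw [← List.length_cons (a := (j, l.2)), List.countP_eq_length]
        intro k hk
        rcases List.mem_cons.1 hk with rfl | hk
        · simp only [Nat.ble_eq]; omega
        · simpa using hall _ (h0.le.trans h2.le) h4 h3 k (List.mem_of_mem_filter hk)
      · rw [List.countP_cons, List.countP_filter]
        refine hadd.trans (Nat.add_le_add_right (hIH.trans ?_) _)
        refine List.countP_mono_left fun k hk hkτ => ?_
        simp only [Bool.and_eq_true, Nat.ble_eq, Bool.not_eq_true', beq_eq_false] at hkτ ⊢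
        refine ⟨hkτ, fun hkl => h4 ?_⟩
        rw [← hinj k hk hkl]; exact hkτ

end FSAP

namespace FSAP

/-! ### Correctness of the dynamic program -/

theorem listBeq_iff {l l' : List ℕ} : listBeq l l' = true ↔ l = l' := by
  have key : ∀ (l l' : List ℕ) (b : Bool),
      ((l.foldl (fun (s : Bool × List ℕ) b =>
        (s.1 && (!s.2.isEmpty && Nat.beq s.2.headI b), s.2.tail)) (b, l')).1 = true ∧
      (l.foldl (fun (s : Bool × List ℕ) b =>
        (s.1 && (!s.2.isEmpty && Nat.beq s.2.headI b), s.2.tail)) (b, l')).2.isEmpty = true) ↔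
      (b = true ∧ l = l') := by
    intro l
    induction l with
    | nil => intro l' b; cases l' <;> simp
    | cons a l ih =>
      intro l' b
      rw [List.foldl_cons, ih]
      cases l' with
      | nil => simp
      | cons a' l' =>
        simp only [List.isEmpty_cons, List.headI_cons, List.tail_cons, Bool.not_false,
          Bool.true_and, Bool.and_eq_true, Nat.beq_eq, List.cons.injEq]
        constructor
        · rintro ⟨⟨h1, rfl⟩, rfl⟩; exact ⟨h1, rfl, rfl⟩
        · rintro ⟨h1, rfl, rfl⟩; exact ⟨⟨h1, rfl⟩, rfl⟩
  rw [listBeq, Bool.and_eq_true, key]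
  simp

theorem listBeq_eq_false {l l' : List ℕ} : listBeq l l' = false ↔ l ≠ l' := by
  rw [← Bool.not_eq_true, listBeq_iff]

theorem insertCand_cases (T : List Cand) (c : Cand) :
    ((∃ x ∈ T, x.1 = c.1 ∧ c.2.1 ≤ x.2.1) ∧ insertCand T c = T) ∨
    ((∀ x ∈ T, x.1 = c.1 → x.2.1 < c.2.1) ∧
      insertCand T c = c :: T.filter fun x => !listBeq x.1 c.1) := by
  unfold insertCand
  by_cases h : T.all (fun x => !(listBeq x.1 c.1 && Nat.ble c.2.1 x.2.1)) = true
  · rw [if_pos h]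
    refine Or.inr ⟨fun x hx hk => ?_, rfl⟩
    have := List.all_eq_true.1 h x hx
    rw [Bool.not_eq_true', Bool.and_eq_false_iff, listBeq_eq_false, ble_eq_false] at this
    exact this.resolve_left (not_not.2 hk)
  · rw [if_neg h]
    refine Or.inl ⟨?_, rfl⟩
    rw [List.all_eq_true] at h
    push Not at h
    obtain ⟨x, hx, hxc⟩ := h
    rw [ne_eq, Bool.not_eq_true, Bool.not_eq_false', Bool.and_eq_true, listBeq_iff, Nat.ble_eq] at hxc
    exact ⟨x, hx, hxc⟩

/-- Entries with equal states have the same possible extensions, so only the most profitable one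
matters. Distinctness of the states bounds the size of the table. -/
theorem prune_spec (l : List Cand) :
    prune l ⊆ l ∧ (∀ c ∈ l, ∃ x ∈ prune l, x.1 = c.1 ∧ c.2.1 ≤ x.2.1) ∧
      ((prune l).map fun c => c.1).Nodup := by
  induction l using List.reverseRecOn with
  | nil => simp [prune]
  | append_singleton l c ih =>
    obtain ⟨ih1, ih2, ih3⟩ := ih
    have h0 : prune (l ++ [c]) = insertCand (prune l) c := by simp [prune, List.foldl_append]
    rw [h0]
    rcases insertCand_cases (prune l) c with ⟨h1, h⟩ | ⟨h1, h⟩ <;> rw [h]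
    · refine ⟨fun x hx => by simp [ih1 hx], fun x hx => ?_, ih3⟩
      rcases List.mem_append.1 hx with hx | hx
      · exact ih2 x hx
      · rw [List.mem_singleton.1 hx]; exact h1
    · refine ⟨?_, fun x hx => ?_, ?_⟩
      · intro x hx
        rcases List.mem_cons.1 hx with rfl | hx
        · simp
        · simp [ih1 (List.mem_of_mem_filter hx)]
      · rcases List.mem_append.1 hx with hx | hx
        · obtain ⟨y, hy, hyx, hle⟩ := ih2 x hx
          by_cases hk : y.1 = c.1
          · exact ⟨c, by simp, hk ▸ hyx, hle.trans (h1 y hy hk).le⟩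
          · refine ⟨y, List.mem_cons_of_mem _ (List.mem_filter.2 ⟨hy, ?_⟩), hyx, hle⟩
            rw [Bool.not_eq_true', listBeq_eq_false]; exact hk
        · rw [List.mem_singleton.1 hx]; exact ⟨c, by simp, rfl, le_rfl⟩
      · rw [List.map_cons, List.nodup_cons]
        refine ⟨fun hc => ?_, (List.filter_sublist.map _).nodup ih3⟩
        obtain ⟨x, hx, hxc⟩ := List.mem_map.1 hc
        have := (List.mem_filter.1 hx).2
        rw [Bool.not_eq_true', listBeq_eq_false] at this
        exact this hxc

theorem inBlock_iff {o : ℕ × ℕ} {x : ℕ} : inBlock o x = true ↔ o.1 ≤ x ∧ x < o.2 := by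
  simp [inBlock]

theorem fits_iff {F : List ℕ} {s : ℕ} {o : ℕ × ℕ} :
    fits F s o = true ↔ ∀ x f, F[x]? = some f → inBlock o x = true → f ≤ s := by
  rw [fits, List.all_eq_true]
  constructor
  · intro h x f hf hx
    have := h (f, x) (by rw [List.mem_zipIdx_iff_getElem?]; simpa using hf)
    simpa [hx] using this
  · rintro h ⟨f, x⟩ hx
    rw [List.mem_zipIdx_iff_getElem?] at hx
    have := h x f (by simpa using hx)
    by_cases hb : inBlock o x = true
    · simpa [hb] using this hb
    · simp [hb]

theorem getElem?_occupy {F : List ℕ} {e : ℕ} {o : ℕ × ℕ} {x : ℕ} :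
    (occupy F e o)[x]? = F[x]?.map fun f => if inBlock o x = true then e else f := by
  simp only [occupy, List.getElem?_map, List.getElem?_zipIdx, Option.map_map]
  congr 1
  funext f
  simp

theorem length_occupy {F : List ℕ} {e : ℕ} {o : ℕ × ℕ} : (occupy F e o).length = F.length := by
  simp [occupy]

theorem mem_occupy {F : List ℕ} {e : ℕ} {o : ℕ × ℕ} {y : ℕ} (h : y ∈ occupy F e o) :
    y = e ∨ y ∈ F := by
  obtain ⟨p, hp, rfl⟩ := List.mem_map.1 h
  split_ifs
  · exact Or.inl rfl
  · exact Or.inr (List.fst_mem_of_mem_zipIdx hp)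

theorem dp_concat (C W d : ℕ) (opts : List (ℕ × ℕ)) (L : List Job) (j : Job) :
    dp C W d opts (L ++ [j]) = prune ((dp C W d opts L).flatMap (expand W d opts j)) := by
  simp [dp, dpStep, List.foldl_append]

theorem mem_expand {W d : ℕ} {opts : List (ℕ × ℕ)} {j : Job} {c c' : Cand} :
    c' ∈ expand W d opts j c ↔ ∃ o ∈ opts, (j.2.1 < j.2.2 → fits c.1 j.2.1 o = true) ∧
      c' = extend W d j c o := by
  simp only [expand, List.mem_map, List.mem_filter, Bool.or_eq_true, Nat.ble_eq]
  constructor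
  · rintro ⟨o, ⟨h1, h2⟩, rfl⟩
    exact ⟨o, h1, fun h => h2.resolve_left (by omega), rfl⟩
  · rintro ⟨o, h1, h2, rfl⟩
    refine ⟨o, ⟨h1, ?_⟩, rfl⟩
    by_cases h : j.2.2 ≤ j.2.1
    · exact Or.inl h
    · exact Or.inr (h2 (by omega))

theorem exists_of_mem_dp {C W d : ℕ} {opts : List (ℕ × ℕ)} {L : List Job} {j : Job} {c' : Cand}
    (h : c' ∈ dp C W d opts (L ++ [j])) :
    ∃ c ∈ dp C W d opts L, ∃ o ∈ opts, (j.2.1 < j.2.2 → fits c.1 j.2.1 o = true) ∧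
      c' = extend W d j c o := by
  rw [dp_concat] at h
  obtain ⟨c, hc, hcc⟩ := List.mem_flatMap.1 ((prune_spec _).1 h)
  exact ⟨c, hc, mem_expand.1 hcc⟩

theorem dp_nodup (C W d : ℕ) (opts : List (ℕ × ℕ)) (L : List Job) :
    ((dp C W d opts L).map fun c => c.1).Nodup := by
  induction L using List.reverseRecOn with
  | nil => simp [dp]
  | append_singleton L j _ => rw [dp_concat]; exact (prune_spec _).2.2

/-- Each job adds one block to the record and one term to the profit, so an entry grows by at most
`G` per job, while the state keeps its length. -/
theorem dp_bounds {C W d N G : ℕ} {opts : List (ℕ × ℕ)} {L : List Job} (hN : ∀ j ∈ L, j.2.2 ≤ N)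
    (hG : ∀ j ∈ L, ∀ o ∈ opts,
      sz (blockLen W d o) + sz (j.1, o.1 * d + 1, blockLen W d o) + 1 ≤ G) :
    ∀ c ∈ dp C W d opts L, c.1.length = C ∧ (∀ x ∈ c.1, x ≤ N) ∧
      sz c.2.1 + sz c.2.2 ≤ 2 + L.length * G := by
  induction L using List.reverseRecOn with
  | nil =>
    intro c hc
    rw [dp, List.foldl_nil, List.mem_singleton] at hc
    subst hc
    refine ⟨by simp, fun x hx => ?_, by simp [sz, enc_nil, enc_nat, Data.size]⟩
    rw [(List.mem_replicate.1 hx).2]; exact Nat.zero_le _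
  | append_singleton L j ih =>
    intro c' hc'
    obtain ⟨c, hc, o, ho, -, rfl⟩ := exists_of_mem_dp hc'
    obtain ⟨h1, h2, h3⟩ := ih (fun i hi => hN i (by simp [hi])) (fun i hi => hG i (by simp [hi])) c hc
    have h4 := hG j (by simp) o ho
    have h5 := hN j (by simp)
    unfold extend
    dsimp only
    refine ⟨?_, ?_, ?_⟩
    · split_ifs
      · exact h1
      · rw [length_occupy, h1]
    · split_ifs
      · exact h2
      · intro x hx
        rcases mem_occupy hx with rfl | hx
        · exact h5
        · exact h2 x hx
    · have h6 := sz_add_le c.2.1 (blockLen W d o)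
      rw [sz_cons, List.length_append, List.length_singleton, Nat.add_mul, Nat.one_mul]
      omega

theorem length_le_pow {C N : ℕ} {l : List (List ℕ)} (hl : l.Nodup)
    (h : ∀ F ∈ l, F.length = C ∧ ∀ x ∈ F, x ≤ N) : l.length ≤ (N + 1) ^ C := by
  have h1 : l.toFinset ⊆
      (Fintype.piFinset fun _ : Fin C => Finset.range (N + 1)).image List.ofFn := by
    intro F hF
    obtain ⟨h2, h3⟩ := h F (List.mem_toFinset.1 hF)
    subst h2
    refine Finset.mem_image.2 ⟨F.get, Fintype.mem_piFinset.2 fun i => ?_, List.ofFn_get F⟩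
    exact Finset.mem_range.2 (Nat.lt_succ_of_le (h3 _ (List.get_mem F i)))
  have h2 := (Finset.card_le_card h1).trans Finset.card_image_le
  rw [List.toFinset_card_of_nodup hl] at h2
  simpa using h2

/-- The table has at most (N+1)^C entries of polynomial size. This is polynomial because `C` is
fixed and the ends of the jobs are polynomially bounded in value. -/
theorem PT.dp {α : Type} [Enc α] {C : ℕ} {W d : α → ℕ} {opts : α → List (ℕ × ℕ)}
    {L : α → List Job} {N : α → ℕ} (hW : PT W) (hd : PT d) (ho : PT opts) (hL : PT L) (hN : PB N)
    (h : ∀ a, ∀ j ∈ L a, j.2.2 ≤ N a) : PT fun a => FSAP.dp C (W a) (d a) (opts a) (L a) := by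
  have h1 : PT fun x : α × Job × (ℕ × ℕ) => (FSAP.blockLen (W x.1) (d x.1) x.2.2,
      (x.2.1.1, x.2.2.1 * d x.1 + 1, FSAP.blockLen (W x.1) (d x.1) x.2.2)) := by fun_prop
  obtain ⟨P, hP⟩ := h1.pb_sz
  let G : α → ℕ := fun a => P.eval (sz a + sz (L a) + sz (opts a) + 2)
  have hG : PB G := (((PB.sz.add hL.pb_sz).add ho.pb_sz).add (PB.const 2)).eval P
  let E : α → ℕ := fun a => C * (N a + 2) + 1 + (2 + (L a).length * G a) + 2
  have hE : PB E := ((((PB.const C).mul (hN.add (PB.const 2))).add (PB.const 1)).add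
    ((PB.const 2).add ((PB.length hL).mul hG))).add (PB.const 2)
  refine PT.foldl (f := fun a => FSAP.dpStep (W a) (d a) (opts a))
    (i := fun _ => [(List.replicate C 0, 0, [])])
    (B := fun a => (N a + 1) ^ C * (E a + 1) + 1) hL (PT.const _) (by fun_prop)
    ((((hN.add (PB.const 1)).pow C).mul (hE.add (PB.const 1))).add (PB.const 1)) fun a p hp => ?_
  have hb := dp_bounds (C := C) (W := W a) (d := d a) (N := N a) (G := G a) (opts := opts a) (L := p)
    (fun j hj => h a j (hp.subset hj)) (fun j hj o hoo => by
      have h2 := hP (a, j, o)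
      have h3 := sz_lt_of_mem (hp.subset hj)
      have h4 := sz_lt_of_mem hoo
      rw [sz_pair] at h2
      refine h2.trans (eval_mono P ?_)
      rw [sz_pair (a, j, o).2]
      dsimp only
      omega)
  have h0 : p.foldl (FSAP.dpStep (W a) (d a) (opts a)) [(List.replicate C 0, 0, [])] =
    FSAP.dp C (W a) (d a) (opts a) p := rfl
  rw [h0]
  refine (sz_list_le (B := E a) fun c hc => ?_).trans ?_
  · obtain ⟨h5, h6, h7⟩ := hb c hc
    have h8 : sz c.1 ≤ c.1.length * (N a + 2) + 1 :=
      sz_list_le fun x hx => (sz_nat_le x).trans (Nat.add_le_add_right (h6 x hx) 1)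
    have h9 : p.length * G a ≤ (L a).length * G a := Nat.mul_le_mul_right _ hp.length_le
    rw [h5] at h8
    rw [sz_pair c, sz_pair c.2]
    simp only [E]
    omega
  · have h5 := length_le_pow (dp_nodup C (W a) (d a) (opts a) p) (N := N a) (C := C) (fun F hF => by
      obtain ⟨c, hc, rfl⟩ := List.mem_map.1 hF
      exact ⟨(hb c hc).1, (hb c hc).2.1⟩)
    rw [List.length_map] at h5
    exact Nat.add_le_add_right (Nat.mul_le_mul_right _ h5) _

/-- Every entry of the table comes from a choice of options for which conflicting jobs have no
strip in common. -/
theorem dp_sound {C W d : ℕ} {opts : List (ℕ × ℕ)} (hC : ∀ o ∈ opts, o.2 ≤ C) (L : List Job) :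
    ∀ c ∈ dp C W d opts L, c.1.length = C ∧ ∃ g : List (Job × (ℕ × ℕ)),
      c.2.2 = g.map (fun p => (p.1.1, p.2.1 * d + 1, blockLen W d p.2)) ∧
      g.map (fun p => p.1) = L.reverse ∧ (∀ p ∈ g, p.2 ∈ opts) ∧
      c.2.1 = (g.map fun p => blockLen W d p.2).sum ∧
      -- The invariant: the time recorded for a strip is at least the end of every job with a
      -- nonempty interval that was given this strip.
      (∀ p ∈ g, p.1.2.1 < p.1.2.2 → ∀ x f, inBlock p.2 x = true → c.1[x]? = some f →
        p.1.2.2 ≤ f) ∧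
      g.Pairwise fun p q => p.1.conflict q.1 → ∀ x, inBlock p.2 x = true → ¬ inBlock q.2 x = true := by
  induction L using List.reverseRecOn with
  | nil =>
    intro c hc
    rw [dp, List.foldl_nil, List.mem_singleton] at hc
    subst hc
    exact ⟨by simp, [], by simp⟩
  | append_singleton L j ih =>
    intro c' hc'
    obtain ⟨c, hc, o, ho, hfit, rfl⟩ := exists_of_mem_dp hc'
    obtain ⟨hlen, g, h1, h2, h3, h4, h5, h6⟩ := ih c hc
    unfold extend
    dsimp only
    refine ⟨?_, (j, o) :: g, by simp [h1], by simp [h2], ?_, ?_, ?_, ?_⟩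
    · split_ifs
      · exact hlen
      · rw [length_occupy, hlen]
    · intro p hp
      rcases List.mem_cons.1 hp with rfl | hp
      · exact ho
      · exact h3 p hp
    · rw [h4, List.map_cons, List.sum_cons, Nat.add_comm]
    · intro p hp hne x f hx hf
      rcases List.mem_cons.1 hp with rfl | hp
      · rw [if_neg (by simpa using hne), getElem?_occupy] at hf
        dsimp only at hx
        simp only [hx, if_true, Option.map_eq_some_iff] at hf
        obtain ⟨_, _, rfl⟩ := hf
        exact le_rfl
      · by_cases hj : j.2.2 ≤ j.2.1
        · rw [if_pos (by simpa using hj)] at hf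
          exact h5 p hp hne x f hx hf
        · rw [if_neg (by simpa using hj), getElem?_occupy, Option.map_eq_some_iff] at hf
          obtain ⟨f', hf', rfl⟩ := hf
          have h7 := h5 p hp hne x f' hx hf'
          split_ifs with hox
          -- A strip is reoccupied only if it is free at the start of `j`, so its recorded time
          -- never decreases.
          · have := fits_iff.1 (hfit (by omega)) x f' hf' hox
            omega
          · exact h7
    · rw [List.pairwise_cons]
      refine ⟨fun p hp hcf x hx hpx => ?_, h6⟩
      have hxC : x < c.1.length := by
        rw [hlen]; exact (inBlock_iff.1 hx).2.trans_le (hC o ho)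
      have hf : c.1[x]? = some c.1[x] := List.getElem?_eq_getElem hxC
      have h7 := h5 p hp hcf.2.1 x _ hpx hf
      have h8 := fits_iff.1 (hfit hcf.1) x _ hf hx
      have h9 := hcf.2.2.1
      dsimp only at h9
      omega

/-- The table has an entry that is at least as good as any given choice of options for which
conflicting jobs have no strip in common. -/
theorem dp_complete {C W d : ℕ} {opts : List (ℕ × ℕ)} {L : List Job} (hL : Sorted L)
    (o : Job → ℕ × ℕ) (ho : ∀ j ∈ L, o j ∈ opts)
    (hdis : ∀ j ∈ L, ∀ j' ∈ L, j.1 ≠ j'.1 → j.conflict j' → ∀ x, inBlock (o j) x = true →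
      ¬ inBlock (o j') x = true) :
    ∃ c ∈ dp C W d opts L, (L.map fun j => blockLen W d (o j)).sum ≤ c.2.1 ∧
      -- The second part is an invariant of the state alone. It therefore survives pruning, where
      -- the entry may be replaced by a different partial solution with the same state.
      ∀ x f, c.1[x]? = some f →
        f = 0 ∨ ∃ j ∈ L, j.2.1 < j.2.2 ∧ inBlock (o j) x = true ∧ f = j.2.2 := by
  induction L using List.reverseRecOn with
  | nil =>
    refine ⟨_, by rw [dp, List.foldl_nil]; exact List.mem_singleton.2 rfl, by simp, fun x f hf => ?_⟩
    have := List.mem_of_getElem? hf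
    exact Or.inl (List.mem_replicate.1 this).2
  | append_singleton L j ih =>
    obtain ⟨hL', hs, hid⟩ := hL.of_concat
    obtain ⟨c, hc, h1, h2⟩ := ih hL' (fun i hi => ho i (by simp [hi]))
      fun i hi i' hi' => hdis i (by simp [hi]) i' (by simp [hi'])
    have hfit : j.2.1 < j.2.2 → fits c.1 j.2.1 (o j) = true := by
      intro hj
      refine fits_iff.2 fun x f hf hx => ?_
      rcases h2 x f hf with rfl | ⟨i, hi, hie, hix, rfl⟩
      · exact Nat.zero_le _
      · by_contra hlt
        have h3 := hs i hi
        -- The order of the starts enters here: a strip that is not yet free belongs to an earlier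
        -- job that still runs when `j` starts, so the two jobs conflict.
        exact hdis i (by simp [hi]) j (by simp) (hid i hi) ⟨hie, hj, by omega, by omega⟩ x hix hx
    have hmem : extend W d j c (o j) ∈ (dp C W d opts L).flatMap (expand W d opts j) :=
      List.mem_flatMap.2 ⟨c, hc, mem_expand.2 ⟨o j, ho j (by simp), hfit, rfl⟩⟩
    obtain ⟨c', hc', hk, hle⟩ := (prune_spec _).2.1 _ hmem
    refine ⟨c', by rw [dp_concat]; exact hc', ?_, fun x f hf => ?_⟩
    · rw [List.map_append, List.sum_append]
      simp only [List.map_cons, List.map_nil, List.sum_singleton]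
      exact (Nat.add_le_add_right h1 _).trans hle
    · rw [hk] at hf
      unfold extend at hf
      dsimp only at hf
      have hold : ∀ f, c.1[x]? = some f → f = 0 ∨ ∃ i ∈ L ++ [j], i.2.1 < i.2.2 ∧
          inBlock (o i) x = true ∧ f = i.2.2 := by
        intro f hf
        rcases h2 x f hf with h3 | ⟨i, hi, h3⟩
        · exact Or.inl h3
        · exact Or.inr ⟨i, by simp [hi], h3⟩
      by_cases hj : j.2.2 ≤ j.2.1
      · rw [if_pos (by simpa using hj)] at hf
        exact hold f hf
      · rw [if_neg (by simpa using hj), getElem?_occupy, Option.map_eq_some_iff] at hf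
        obtain ⟨f', hf', rfl⟩ := hf
        split_ifs with hx
        · exact Or.inr ⟨j, by simp, by omega, hx, rfl⟩
        · exact hold f' hf'

end FSAP

namespace FSAP

/-! ## Residues and color classes -/

namespace Instance

variable {I : Instance}

/-- A coloring with `m * M` colors and blocks of at most `M` colors splits, by the residues of the
colors modulo `M`, into `M` subgraphs that are `m`-colorable. -/
theorem exists_residue_classes {M m : ℕ} (hM : 0 < M) {c : I.Coloring}
    (hcol : ∀ i, c i ⊆ Finset.Icc 1 (m * M)) (hcon : ∀ i, ∃ a b, c i = Finset.Ico a b)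
    (hcard : ∀ i, (c i).card ≤ M) (hdis : ∀ i j, I.graph.Adj i j → Disjoint (c i) (c j)) :
    ∃ T : ℕ → Finset (Fin I.n),
      (∀ r, (I.graph.induce (T r : Set (Fin I.n))).Colorable m) ∧
      ∑ i, (c i).card = ∑ r ∈ Finset.range M, (T r).card := by
  classical
  -- The r-th family consists of the jobs that own a color x with x - 1 ≡ r modulo M; shifting by 1
  -- makes the quotients range over 0, …, m - 1.
  refine ⟨fun r => Finset.univ.filter fun i => r ∈ (c i).image fun x => (x - 1) % M, ?_, ?_⟩
  · intro r
    have h : ∀ i : ↥((Finset.univ.filter fun i => r ∈ (c i).image fun x => (x - 1) % M :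
        Finset (Fin I.n)) : Set (Fin I.n)), ∃ x ∈ c i.1, (x - 1) % M = r := by
      intro i
      have h1 := (Finset.mem_filter.1 (Finset.mem_coe.1 i.2)).2
      exact Finset.mem_image.1 h1
    choose x hx hxr using h
    have hlt : ∀ i, (x i - 1) / M < m := fun i => by
      have h1 := Finset.mem_Icc.1 (hcol _ (hx i))
      rw [Nat.div_lt_iff_lt_mul hM]; omega
    refine ⟨SimpleGraph.Coloring.mk (fun i => (⟨(x i - 1) / M, hlt i⟩ : Fin m)) ?_⟩
    intro i j hij hc
    have hd : (x i - 1) / M = (x j - 1) / M := by simpa using hc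
    have h1 := Nat.div_add_mod (x i - 1) M
    have h2 := Nat.div_add_mod (x j - 1) M
    rw [hxr] at h1 h2
    rw [hd] at h1
    have h3 := Finset.mem_Icc.1 (hcol _ (hx i))
    have h4 := Finset.mem_Icc.1 (hcol _ (hx j))
    have h5 : x i = x j := by omega
    -- Equal quotients and equal residues give a common color of two adjacent jobs.
    exact Finset.disjoint_left.1 (hdis i.1 j.1 hij) (hx i) (h5 ▸ hx j)
  · have h1 : ∀ i, (c i).card = ((c i).image fun x => (x - 1) % M).card := by
      intro i
      symm
      refine Finset.card_image_of_injOn ?_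
      have key : ∀ x ∈ c i, ∀ y ∈ c i, x < y → (x - 1) % M ≠ (y - 1) % M := by
        intro x hx y hy hlt hmod
        have h2 := Finset.mem_Icc.1 (hcol i hx)
        have h3 := Finset.mem_Icc.1 (hcol i hy)
        obtain ⟨a, b, hab⟩ := hcon i
        have h4 := hcard i
        rw [hab, Nat.card_Ico] at h4
        rw [hab, Finset.mem_Ico] at hx hy
        have h5 : M ∣ (y - 1) - (x - 1) := (Nat.modEq_iff_dvd' (by omega)).1 hmod
        have h6 := Nat.le_of_dvd (by omega) h5
        omega
      intro x hx y hy hmod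
      rcases lt_trichotomy x y with h | h | h
      · exact absurd hmod (key x hx y hy h)
      · exact h
      · exact absurd hmod.symm (key y hy x hx h)
    have h2 : ∀ i, ((c i).image fun x => (x - 1) % M).card =
        ∑ r ∈ Finset.range M, if r ∈ (c i).image (fun x => (x - 1) % M) then 1 else 0 := by
      intro i
      rw [Finset.sum_boole, Nat.cast_id]
      congr 1
      ext r
      rw [Finset.mem_filter, Finset.mem_range, iff_and_self]
      intro hr
      obtain ⟨x, _, rfl⟩ := Finset.mem_image.1 hr
      exact Nat.mod_lt _ hM
    rw [Finset.sum_congr rfl fun i _ => (h1 i).trans (h2 i), Finset.sum_comm]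
    refine Finset.sum_congr rfl fun r _ => ?_
    rw [Finset.sum_boole, Nat.cast_id]

/-- Omitting a smallest color class. -/
theorem card_mul_le_of_colorable {m : ℕ} {S T : Finset (Fin I.n)} (hS : I.IsMaxColorable m S)
    (hT : (I.graph.induce (T : Set (Fin I.n))).Colorable (m + 1)) :
    T.card * m ≤ S.card * (m + 1) := by
  classical
  obtain ⟨f⟩ := hT
  let col : Fin I.n → Fin (m + 1) := fun i => if h : i ∈ T then f ⟨i, h⟩ else 0
  have hcol : ∀ i j, i ∈ T → j ∈ T → I.graph.Adj i j → col i ≠ col j := by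
    intro i j hi hj hij
    simp only [col, hi, hj, dif_pos]
    exact f.valid (v := ⟨i, hi⟩) (w := ⟨j, hj⟩) hij
  have hsum : T.card = ∑ a : Fin (m + 1), (T.filter fun i => col i = a).card :=
    Finset.card_eq_sum_card_fiberwise fun i _ => Finset.mem_coe.2 (Finset.mem_univ _)
  -- Some color class is at most as large as the average; the rest uses only m colors.
  obtain ⟨a, ha⟩ : ∃ a, (m + 1) * (T.filter fun i => col i = a).card ≤ T.card := by
    by_contra! h
    have h1 : ∑ _a : Fin (m + 1), T.card <
        ∑ a : Fin (m + 1), (m + 1) * (T.filter fun i => col i = a).card :=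
      Finset.sum_lt_sum_of_nonempty Finset.univ_nonempty fun a _ => h a
    rw [← Finset.mul_sum, ← hsum, Finset.sum_const, Finset.card_univ, Fintype.card_fin,
      smul_eq_mul] at h1
    exact lt_irrefl _ h1
  have hcard : (T.filter fun i => col i = a).card + (T.filter fun i => ¬ col i = a).card = T.card :=
    Finset.card_filter_add_card_filter_not _
  have hle : (T.filter fun i => ¬ col i = a).card ≤ S.card := by
    refine hS.2 _ ?_
    have hc : Fintype.card {b : Fin (m + 1) // b ≠ a} = m := by
      rw [Fintype.card_subtype_compl, Fintype.card_fin, Fintype.card_subtype_eq]; omega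
    have hmem : ∀ i : ↥((T.filter fun i => ¬ col i = a : Finset (Fin I.n)) : Set (Fin I.n)),
        i.1 ∈ T ∧ col i.1 ≠ a := fun i => Finset.mem_filter.1 (Finset.mem_coe.1 i.2)
    have hmk : (I.graph.induce ((T.filter fun i => ¬ col i = a : Finset (Fin I.n)) :
        Set (Fin I.n))).Colorable (Fintype.card {b : Fin (m + 1) // b ≠ a}) := by
      refine (SimpleGraph.Coloring.mk (fun i => (⟨col i.1, (hmem i).2⟩ :
        {b : Fin (m + 1) // b ≠ a})) ?_).colorable
      intro i j hij h
      exact hcol i.1 j.1 (hmem i).1 (hmem j).1 hij (congrArg Subtype.val h)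
    rwa [hc] at hmk
  nlinarith

end Instance

/-! ## Rounding to strips -/

section rounding

variable (M d q : ℕ)

/-- The indicator function of the numbers that are congruent to one of `0, d, …, (q - 1) d`
modulo `M`. -/
def sample (z : ℕ) : ℕ := if z % M % d = 0 ∧ z % M / d < q then 1 else 0

/-- The number of samples in `[z, z + l)`. -/
def sampleCount (z l : ℕ) : ℕ := ∑ k ∈ Finset.range l, sample M d q (z + k)

variable {M d q}

theorem sampleCount_add (z l l' : ℕ) :
    sampleCount M d q z (l + l') = sampleCount M d q z l + sampleCount M d q (z + l) l' := by
  simp only [sampleCount, Finset.sum_range_add, Nat.add_assoc]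

theorem sampleCount_mono (z : ℕ) : Monotone (sampleCount M d q z) := by
  intro l l' h
  obtain ⟨e, rfl⟩ := Nat.exists_eq_add_of_le h
  rw [sampleCount_add]
  exact Nat.le_add_right _ _

/-- When a window of length M moves by one, the positions entering and leaving are congruent modulo
M. So it suffices to count in [0, M). -/
theorem sampleCount_period (hd : 0 < d) (hq : d * q ≤ M) (z : ℕ) : sampleCount M d q z M = q := by
  induction z with
  | zero =>
    have h1 : ∀ k ∈ Finset.range M, sample M d q (0 + k) = if k % d = 0 ∧ k / d < q then 1 else 0 := by
      intro k hk
      rw [sample, Nat.zero_add, Nat.mod_eq_of_lt (Finset.mem_range.1 hk)]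
    rw [sampleCount, Finset.sum_congr rfl h1, Finset.sum_boole, Nat.cast_id]
    have h2 : (Finset.range M).filter (fun k => k % d = 0 ∧ k / d < q) =
        (Finset.range q).image fun x => d * x := by
      ext k
      simp only [Finset.mem_filter, Finset.mem_range, Finset.mem_image]
      constructor
      · rintro ⟨_, h2, h3⟩
        exact ⟨k / d, h3, Nat.mul_div_cancel' (Nat.dvd_of_mod_eq_zero h2)⟩
      · rintro ⟨x, hx, rfl⟩
        refine ⟨lt_of_lt_of_le (Nat.mul_lt_mul_of_pos_left hx hd) hq, Nat.mul_mod_right _ _, ?_⟩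
        rwa [Nat.mul_div_cancel_left _ hd]
    rw [h2, Finset.card_image_of_injective _ fun x y h => Nat.eq_of_mul_eq_mul_left hd h,
      Finset.card_range]
  | succ z ih =>
    have h1 := sampleCount_add (M := M) (d := d) (q := q) z 1 M
    have h2 := sampleCount_add (M := M) (d := d) (q := q) z M 1
    have h3 : sampleCount M d q (z + M) 1 = sampleCount M d q z 1 := by
      have h4 : z + M + 0 = z + 0 + M := by omega
      simp only [sampleCount, sample, Finset.sum_range_one, h4, Nat.add_mod_right]
    rw [Nat.add_comm 1 M] at h1
    omega

theorem sample_le_one (z : ℕ) : sample M d q z ≤ 1 := by unfold sample; split_ifs <;> omega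

/-- Within a period samples are distinct multiples of d; across a period boundary the gap is large
enough because the last sample (q-1)d is followed by at least 2d positions of its period. -/
theorem sample_gap (hM : d * (q + 1) ≤ M) {y y' : ℕ} (hy : sample M d q y = 1)
    (hy' : sample M d q y' = 1) (hlt : y < y') : y + d ≤ y' := by
  have h1 : y % M % d = 0 ∧ y % M / d < q := by
    by_contra h; rw [sample, if_neg h] at hy; omega
  have h2 : y' % M % d = 0 ∧ y' % M / d < q := by
    by_contra h; rw [sample, if_neg h] at hy'; omega
  have h3 := Nat.div_add_mod y M
  have h4 := Nat.div_add_mod y' M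
  have h5 := Nat.div_add_mod (y % M) d
  have h6 := Nat.div_add_mod (y' % M) d
  have h7 : y / M ≤ y' / M := Nat.div_le_div_right hlt.le
  rcases h7.eq_or_lt with h8 | h8
  · have h9 : y % M / d < y' % M / d := by
      by_contra h
      have := Nat.mul_le_mul_left d (not_lt.1 h)
      rw [h8] at h3
      omega
    have := Nat.mul_le_mul_left d (Nat.succ_le_of_lt h9)
    rw [h8] at h3
    rw [Nat.mul_succ] at this
    omega
  · have h9 := Nat.mul_le_mul_left M (Nat.succ_le_of_lt h8)
    have h10 := Nat.mul_le_mul_left d (Nat.succ_le_of_lt h1.2)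
    rw [Nat.mul_succ] at h9 h10 hM
    omega

theorem sampleCount_le_one (hM : d * (q + 1) ≤ M) (z l : ℕ) (hl : l ≤ d) :
    sampleCount M d q z l ≤ 1 := by
  induction l with
  | zero => simp [sampleCount]
  | succ l ih =>
    have h1 := ih (by omega)
    have h2 := sampleCount_add (M := M) (d := d) (q := q) z l 1
    have h3 : sampleCount M d q (z + l) 1 = sample M d q (z + l) := by simp [sampleCount]
    have h4 := sample_le_one (M := M) (d := d) (q := q) (z + l)
    by_contra h
    have h5 : sample M d q (z + l) = 1 := by omega
    have h6 : sampleCount M d q z l ≠ 0 := by omega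
    rw [sampleCount] at h6
    obtain ⟨k, hk, hk0⟩ := Finset.exists_ne_zero_of_sum_ne_zero h6
    have h7 := sample_le_one (M := M) (d := d) (q := q) (z + k)
    have h8 := sample_gap hM (y := z + k) (y' := z + l) (by omega) h5
      (by have := Finset.mem_range.1 hk; omega)
    omega

/-- The window is cut into pieces of length at most d, each with at most one sample. -/
theorem mul_sampleCount_lt (hd : 0 < d) (hM : d * (q + 1) ≤ M) (z l : ℕ) :
    d * sampleCount M d q z l < l + d := by
  induction l using Nat.strong_induction_on generalizing z with
  | _ l ih =>
    rcases Nat.eq_zero_or_pos l with rfl | hl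
    · simpa [sampleCount] using hd
    by_cases h : l ≤ d
    · have := Nat.mul_le_mul_left d (sampleCount_le_one hM z l h)
      omega
    · obtain ⟨l', rfl⟩ := Nat.exists_eq_add_of_le (not_le.1 h).le
      have h1 := ih l' (by omega) (z + d)
      have h2 := Nat.mul_le_mul_left d (sampleCount_le_one hM z d le_rfl)
      rw [sampleCount_add, Nat.mul_add]
      omega

/-- A full period contributes dq ≤ M - d. The spare d, which is why d(q+1) ≤ M is assumed, pays for
the rounding up in the rest of the window. -/
theorem mul_sampleCount_le (hd : 0 < d) (hM : d * (q + 1) ≤ M) (z l : ℕ) (hl : M ≤ l) :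
    d * sampleCount M d q z l ≤ l := by
  obtain ⟨l', rfl⟩ := Nat.exists_eq_add_of_le hl
  have h1 := mul_sampleCount_lt hd hM (z + M) l'
  have h2 : d * q ≤ M := by rw [Nat.mul_succ] at hM; omega
  rw [sampleCount_add, Nat.mul_add, sampleCount_period hd h2]
  rw [Nat.mul_succ] at hM
  omega

/-- Double counting: each of the l positions is a sample for exactly q of the M shifts. -/
theorem sum_sampleCount (hd : 0 < d) (hM : d * q ≤ M) (z l : ℕ) :
    ∑ t ∈ Finset.range M, sampleCount M d q (t + z) l = l * q := by
  simp only [sampleCount]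
  rw [Finset.sum_comm]
  have h : ∀ k ∈ Finset.range l, ∑ t ∈ Finset.range M, sample M d q (t + z + k) = q := by
    intro k _
    refine Eq.trans (Finset.sum_congr rfl fun t _ => ?_) (sampleCount_period hd hM (z + k))
    rw [show t + z + k = z + k + t by omega]
  rw [Finset.sum_congr rfl h]
  simp

namespace Instance

variable {I : Instance}

/-- The profit of a feasible coloring is nearly preserved by a suitable rounding to strips. -/
theorem exists_stripColoring (hd : 0 < d) (hM : d * (q + 1) ≤ M) (hW : M ≤ I.W)
    (hr : ∀ i, I.rmax i = M) {c : I.Coloring} (hc : I.IsFeasible c) :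
    ∃ c', I.IsFeasible c' ∧ I.IsStripColoring d c' ∧
      d * q * ∑ i, (c i).card ≤ M * ∑ i, (c' i).card := by
  have hdq : d * q ≤ M := by rw [Nat.mul_succ] at hM; omega
  have hab : ∀ i, ∃ a l, c i = Finset.Ico (a + 1) (a + l + 1) ∧ a + l ≤ I.W ∧ l ≤ M := by
    intro i
    obtain ⟨a, b, h⟩ := hc.contiguous i
    have h1 := hc.card_le i
    have h2 := hc.subset i
    rcases le_or_gt b a with hba | hba
    · exact ⟨0, 0, by rw [h, Finset.Ico_eq_empty_of_le hba]; simp, Nat.zero_le _, Nat.zero_le _⟩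
    · rw [h] at h1 h2
      rw [hr, Nat.card_Ico] at h1
      have h3 := Finset.mem_Icc.1 (h2 (Finset.mem_Ico.2 ⟨le_rfl, hba⟩))
      have h4 := Finset.mem_Icc.1 (h2 (Finset.mem_Ico.2 ⟨Nat.le_sub_one_of_lt hba, by omega⟩))
      refine ⟨a - 1, b - a, ?_, by omega, h1⟩
      rw [h]
      congr 1 <;> omega
  choose a l hcab haW hlM using hab
  -- For the shift `t`, both ends of every block go through the same monotone map z ↦ d · (number of
  -- samples in [t, t + z)). All values are multiples of d, hence boundaries of strips.
  let r : ℕ → I.Coloring := fun t i =>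
    Finset.Ico (d * sampleCount M d q t (a i) + 1) (d * sampleCount M d q t (a i + l i) + 1)
  have hrcard : ∀ t i, (r t i).card = d * sampleCount M d q (t + a i) (l i) := by
    intro t i
    simp only [r, Nat.card_Ico, sampleCount_add, Nat.mul_add]
    omega
  have hfeas : ∀ t, I.IsFeasible (r t) := by
    intro t
    refine ⟨fun i x hx => ?_, fun i => ⟨_, _, rfl⟩, fun i => ?_, fun i j hij => ?_⟩
    · rw [Finset.mem_Ico] at hx
      have h1 := Nat.mul_le_mul_left d (sampleCount_mono (M := M) (d := d) (q := q) t (haW i))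
      have h2 := mul_sampleCount_le hd hM t I.W hW
      exact Finset.mem_Icc.2 ⟨by omega, by omega⟩
    · rw [hrcard, hr]
      have h1 := Nat.mul_le_mul_left d
        (sampleCount_mono (M := M) (d := d) (q := q) (t + a i) (hlM i))
      rw [sampleCount_period hd hdq] at h1
      exact h1.trans hdq
    · have h1 := hc.disjoint i j hij
      rw [hcab i, hcab j] at h1
      have h2 : l i = 0 ∨ l j = 0 ∨ a i + l i ≤ a j ∨ a j + l j ≤ a i := by
        by_contra! h
        obtain ⟨h3, h4, h5, h6⟩ := h
        refine Finset.disjoint_left.1 h1 (show max (a i) (a j) + 1 ∈ _ from ?_) ?_ <;>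
          rw [Finset.mem_Ico] <;> omega
      have hm : ∀ {x y}, x ≤ y → d * sampleCount M d q t x ≤ d * sampleCount M d q t y :=
        fun h => Nat.mul_le_mul_left d (sampleCount_mono t h)
      rw [Finset.disjoint_left]
      intro x hx hy
      simp only [r, Finset.mem_Ico] at hx hy
      rcases h2 with h2 | h2 | h2 | h2
      · rw [h2] at hx; simp only [Nat.add_zero] at hx; omega
      · rw [h2] at hy; simp only [Nat.add_zero] at hy; omega
      · have := hm h2; omega
      · have := hm h2; omega
  have hstrip : ∀ t, I.IsStripColoring d (r t) := by
    intro t i j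
    have h2 := mul_sampleCount_le hd hM t I.W hW
    rcases lt_or_ge j (sampleCount M d q t (a i)) with h | h
    · right
      rw [Finset.disjoint_left]
      intro x hx hy
      simp only [r, Finset.mem_Ico, strip, Finset.mem_Icc] at hx hy
      have h1 := Nat.mul_le_mul_left d (Nat.succ_le_of_lt h)
      rw [Nat.mul_comm d (j + 1)] at h1
      omega
    rcases lt_or_ge j (sampleCount M d q t (a i + l i)) with h' | h'
    · left
      intro x hx
      simp only [r, Finset.mem_Ico, strip, Finset.mem_Icc] at hx ⊢
      have h1 := Nat.mul_le_mul_left d (Nat.succ_le_of_lt h')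
      have h3 := Nat.mul_le_mul_left d h
      rw [Nat.mul_comm d (j + 1)] at h1
      rw [Nat.mul_comm d j] at h3
      omega
    · right
      rw [Finset.disjoint_left]
      intro x hx hy
      simp only [r, Finset.mem_Ico, strip, Finset.mem_Icc] at hx hy
      have h3 := Nat.mul_le_mul_left d h'
      rw [Nat.mul_comm d j] at h3
      omega
  -- The total over all shifts is exactly dq times the original profit, so some shift reaches the
  -- average.
  have hsum : ∑ t ∈ Finset.range M, ∑ i, (r t i).card = d * q * ∑ i, (c i).card := by
    rw [Finset.sum_comm, Finset.mul_sum]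
    refine Finset.sum_congr rfl fun i _ => ?_
    have h1 : (c i).card = l i := by rw [hcab i, Nat.card_Ico]; omega
    simp only [hrcard]
    rw [← Finset.mul_sum, sum_sampleCount hd hdq, h1]
    ring
  have hM0 : 0 < M := lt_of_lt_of_le (Nat.mul_pos hd q.succ_pos) hM
  by_contra! h
  have h1 : ∑ t ∈ Finset.range M, M * ∑ i, (r t i).card <
      ∑ _t ∈ Finset.range M, d * q * ∑ i, (c i).card :=
    Finset.sum_lt_sum_of_nonempty (Finset.nonempty_range_iff.2 hM0.ne') fun t _ =>
      h _ (hfeas t) (hstrip t)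
  rw [← Finset.mul_sum, hsum, Finset.sum_const, Finset.card_range, smul_eq_mul] at h1
  exact lt_irrefl _ h1

end Instance

end rounding

end FSAP

namespace FSAP

/-! ## The algorithm on instances -/

section lists

/-- The keys will be ranks, which are smaller than the number of endpoints, so one bucket per
possible key is affordable and no comparison sort is needed. -/
theorem bucket_sorted {l : List Job} (hl : (l.map fun j => j.1).Nodup) (N : ℕ) :
    Sorted ((List.range N).flatMap fun t => l.filter fun j => Nat.beq j.2.1 t) ∧
    ∀ j, j ∈ ((List.range N).flatMap fun t => l.filter fun j => Nat.beq j.2.1 t) ↔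
      j ∈ l ∧ j.2.1 < N := by
  have hmem : ∀ N j, j ∈ ((List.range N).flatMap fun t => l.filter fun j => Nat.beq j.2.1 t) ↔
      j ∈ l ∧ j.2.1 < N := by
    intro N j
    simp only [List.mem_flatMap, List.mem_range, List.mem_filter, Nat.beq_eq]
    constructor
    · rintro ⟨t, ht, hj, rfl⟩; exact ⟨hj, ht⟩
    · rintro ⟨hj, ht⟩; exact ⟨_, ht, hj, rfl⟩
  refine ⟨?_, hmem N⟩
  induction N with
  | zero => simp [Sorted]
  | succ N ih =>
    have hlast : ∀ j ∈ l.filter (fun j => Nat.beq j.2.1 N), j ∈ l ∧ j.2.1 = N := by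
      intro j hj
      have := List.mem_filter.1 hj
      exact ⟨this.1, by simpa using this.2⟩
    rw [List.range_succ, List.flatMap_append, List.flatMap_singleton]
    refine ⟨List.pairwise_append.2 ⟨ih.1, ?_, ?_⟩, ?_⟩
    · refine List.pairwise_of_forall_mem_list fun i hi j hj => ?_
      rw [(hlast i hi).2, (hlast j hj).2]
    · intro i hi j hj
      rw [(hlast j hj).2]
      exact ((hmem N i).1 hi).2.le
    · rw [List.map_append, List.nodup_append]
      refine ⟨ih.2, (List.filter_sublist.map _).nodup hl, ?_⟩
      intro a ha b hb hab
      obtain ⟨i, hi, rfl⟩ := List.mem_map.1 ha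
      obtain ⟨j, hj, rfl⟩ := List.mem_map.1 hb
      have h1 := (hmem N i).1 hi
      have h2 := hlast j hj
      have := List.inj_on_of_nodup_map hl h1.1 h2.1 hab
      subst this
      omega

variable {A : List (ℕ × ℕ × ℕ)}

theorem lookup_of_mem (hA : (A.map fun x => x.1).Nodup) {i : ℕ} {x : ℕ × ℕ} (h : (i, x) ∈ A) :
    lookup A i = x := by
  have h1 : ∀ y ∈ (A.filter fun x => Nat.beq x.1 i).map fun x => x.2, y = x := by
    intro y hy
    obtain ⟨z, hz, rfl⟩ := List.mem_map.1 hy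
    obtain ⟨hz1, hz2⟩ := List.mem_filter.1 hz
    rw [Nat.beq_eq] at hz2
    rw [List.inj_on_of_nodup_map hA hz1 h hz2]
  refine h1 _ (headI_mem ?_)
  refine List.ne_nil_of_mem (a := x) (List.mem_map.2 ⟨(i, x), List.mem_filter.2 ⟨h, ?_⟩, rfl⟩)
  simp

theorem lookup_of_notMem {i : ℕ} (h : i ∉ A.map fun x => x.1) : lookup A i = (0, 0) := by
  have : (A.filter fun x => Nat.beq x.1 i) = [] := by
    rw [List.filter_eq_nil_iff]
    intro x hx hxi
    rw [Nat.beq_eq] at hxi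
    exact h (hxi ▸ List.mem_map_of_mem hx)
  rw [lookup, this]
  rfl

theorem sum_lookup {n : ℕ} (hA : (A.map fun x => x.1).Nodup) (hn : ∀ x ∈ A, x.1 < n) :
    ∑ i : Fin n, (lookup A i).2 = (A.map fun x => x.2.2).sum := by
  have h1 : (A.map fun x => x.2.2) = (A.map fun x => x.1).map fun i => (lookup A i).2 := by
    rw [List.map_map]
    exact List.map_congr_left fun x hx => by
      simp only [Function.comp_apply]; rw [lookup_of_mem hA (x := x.2) hx]
  rw [h1, ← List.sum_toFinset _ hA, Fin.sum_univ_eq_sum_range (fun i => (lookup A i).2)]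
  symm
  refine Finset.sum_subset (fun i hi => ?_) fun i _ hi => ?_
  · obtain ⟨x, hx, rfl⟩ := List.mem_map.1 (List.mem_toFinset.1 hi)
    exact Finset.mem_range.2 (hn x hx)
  · rw [lookup_of_notMem fun h => hi (List.mem_toFinset.2 h)]

end lists

theorem Data.ofList_injective : Function.Injective Data.ofList := by
  intro l
  induction l with
  | nil => intro l' h; cases l' with
    | nil => rfl
    | cons a l' => simp [Data.ofList] at h
  | cons a l ih => intro l' h; cases l' with
    | nil => simp [Data.ofList] at h
    | cons a' l' =>
      simp only [Data.ofList, Data.node.injEq] at h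
      rw [h.1, ih h.2]

/-- A nonnegative rational as a pair of numbers. -/
def fraction (q : ℚ≥0) : ℕ × ℕ := (q.num, q.den)

theorem ratLt_fraction {x y : ℚ≥0} : ratLt (fraction x) (fraction y) = true ↔ x < y := by
  simp only [ratLt, fraction, Bool.not_eq_true', ble_eq_false]
  exact NNRat.lt_def.symm

/-- If x < y, then x itself is counted for y but not for x; this is where membership of x in the
list is used. -/
theorem rank_lt_rank {E : List (ℕ × ℕ)} (hE : ∀ z ∈ E, ∃ w, z = fraction w) {x y : ℚ≥0}
    (hx : fraction x ∈ E) : rank E (fraction x) < rank E (fraction y) ↔ x < y := by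
  have hmono : ∀ x y : ℚ≥0, x ≤ y →
      E.filter (fun z => ratLt z (fraction x)) =
        (E.filter fun z => ratLt z (fraction y)).filter fun z => ratLt z (fraction x) := by
    intro x y hxy
    rw [List.filter_filter]
    refine List.filter_congr fun z hz => ?_
    obtain ⟨w, rfl⟩ := hE z hz
    rw [Bool.eq_iff_iff, Bool.and_eq_true, ratLt_fraction, ratLt_fraction]
    exact ⟨fun h => ⟨h, h.trans_le hxy⟩, fun h => h.1⟩
  constructor
  · intro h
    by_contra hxy
    have h1 := hmono y x (not_lt.1 hxy)
    rw [rank, rank, h1] at h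
    exact absurd h (not_lt.2 (List.length_filter_le _ _))
  · intro h
    rw [rank, hmono x y h.le, rank, List.length_filter_lt_length_iff_exists]
    exact ⟨_, List.mem_filter.2 ⟨hx, ratLt_fraction.2 h⟩, by rw [ratLt_fraction]; exact lt_irrefl x⟩

theorem rank_lt_length {E : List (ℕ × ℕ)} {x : ℚ≥0} (hx : fraction x ∈ E) :
    rank E (fraction x) < E.length := by
  rw [rank, List.length_filter_lt_length_iff_exists]
  exact ⟨_, hx, by rw [ratLt_fraction]; exact lt_irrefl x⟩

theorem rank_le_length (E : List (ℕ × ℕ)) (x : ℕ × ℕ) : rank E x ≤ E.length :=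
  List.length_filter_le _ _

namespace Instance

variable (I : Instance)

/-- The instance as an input of the algorithm. -/
def raw : Raw :=
  (I.W, List.ofFn fun i => ((fraction (I.s i), fraction (I.e i)), (I.rmax i, fraction (I.p i))))

theorem enc_raw : Enc.enc I.raw = I.encode := by
  simp only [raw, encode, enc_pair, enc_nat]
  congr 1
  change Data.ofList (List.map _ _) = _
  rw [List.map_ofFn]
  rfl

/-- The job `i` with the ranks of its endpoints. -/
def job (i : Fin I.n) : Job :=
  (i, rank (endpoints I.raw) (fraction (I.s i)), rank (endpoints I.raw) (fraction (I.e i)))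

theorem jobs_raw : jobs I.raw = List.ofFn I.job := by
  refine List.ext_getElem (by simp [jobs, raw]) fun i h1 h2 => ?_
  simp [jobs, raw, job]

theorem mem_endpoints {z : ℕ × ℕ} :
    z ∈ endpoints I.raw ↔ ∃ i, z = fraction (I.s i) ∨ z = fraction (I.e i) := by
  simp only [endpoints, raw, List.mem_flatMap, List.mem_ofFn]
  constructor
  · rintro ⟨_, ⟨i, rfl⟩, h⟩; exact ⟨i, by simpa using h⟩
  · rintro ⟨i, h⟩; exact ⟨_, ⟨i, rfl⟩, by simpa using h⟩

theorem nodup_jobs : ((jobs I.raw).map fun j => j.1).Nodup := by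
  rw [jobs_raw, List.map_ofFn, List.nodup_ofFn]
  exact Fin.val_injective

theorem sorted_sortedJobs : Sorted (sortedJobs I.raw) := (bucket_sorted I.nodup_jobs _).1

theorem mem_sortedJobs {j : Job} : j ∈ sortedJobs I.raw ↔ ∃ i, j = I.job i := by
  rw [sortedJobs, (bucket_sorted I.nodup_jobs _).2, jobs_raw, List.mem_ofFn]
  constructor
  · rintro ⟨⟨i, rfl⟩, _⟩; exact ⟨i, rfl⟩
  · rintro ⟨i, rfl⟩
    exact ⟨⟨i, rfl⟩, rank_lt_length (I.mem_endpoints.2 ⟨i, Or.inl rfl⟩)⟩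

theorem sortedJobs_perm : (sortedJobs I.raw).Perm (List.ofFn I.job) := by
  refine (List.perm_ext_iff_of_nodup I.sorted_sortedJobs.2.of_map ?_).2 fun j => ?_
  · rw [← jobs_raw]; exact I.nodup_jobs.of_map
  · rw [I.mem_sortedJobs, List.mem_ofFn]
    exact ⟨fun ⟨i, h⟩ => ⟨i, h.symm⟩, fun ⟨i, h⟩ => ⟨i, h.symm⟩⟩

theorem sum_sortedJobs (f : Job → ℕ) : ((sortedJobs I.raw).map f).sum = ∑ i, f (I.job i) := by
  rw [(I.sortedJobs_perm.map f).sum_eq, List.map_ofFn, List.sum_ofFn]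
  rfl

theorem countP_sortedJobs (p : Job → Bool) :
    (sortedJobs I.raw).countP p = (Finset.univ.filter fun i => p (I.job i) = true).card := by
  have h : ∀ l : List Job, l.countP p = (l.map fun j => if p j = true then 1 else 0).sum := by
    intro l
    induction l with
    | nil => rfl
    | cons a l ih => rw [List.countP_cons, ih, List.map_cons, List.sum_cons, Nat.add_comm]
  rw [h, sum_sortedJobs, Finset.sum_boole, Nat.cast_id]

variable {I}

theorem job_eq_of_fst {j : Job} (hj : j ∈ sortedJobs I.raw) {i : Fin I.n} (h : j.1 = i) :
    j = I.job i := by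
  obtain ⟨i', rfl⟩ := I.mem_sortedJobs.1 hj
  rw [Fin.ext h]

/-- Half-open intervals meet exactly when both starts precede both ends. These four strict
inequalities are preserved by passing to ranks. -/
theorem adj_iff {i j : Fin I.n} : I.graph.Adj i j ↔ i ≠ j ∧ (I.job i).conflict (I.job j) := by
  have hE : ∀ z ∈ endpoints I.raw, ∃ w, z = fraction w := fun z hz => by
    obtain ⟨i, h | h⟩ := I.mem_endpoints.1 hz <;> exact ⟨_, h⟩
  have hs : ∀ i, fraction (I.s i) ∈ endpoints I.raw := fun i => I.mem_endpoints.2 ⟨i, Or.inl rfl⟩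
  change i ≠ j ∧ (I.interval i ∩ I.interval j).Nonempty ↔ _
  rw [interval, interval, Set.Ico_inter_Ico, Set.nonempty_Ico, max_lt_iff, lt_min_iff, lt_min_iff]
  simp only [Job.conflict, job, rank_lt_rank hE (hs _), NNRat.cast_lt]
  tauto

variable (I) in
/-- The coloring described by a list of indices, first colors and lengths of blocks. -/
def coloringOf (A : List (ℕ × ℕ × ℕ)) : I.Coloring := fun i =>
  Finset.Ico (lookup A i).1 ((lookup A i).1 + (lookup A i).2)

theorem card_coloringOf (A : List (ℕ × ℕ × ℕ)) (i : Fin I.n) :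
    (I.coloringOf A i).card = (lookup A i).2 := by
  rw [coloringOf, Nat.card_Ico]; omega

/-! ### The dynamic program -/

theorem mem_options {C W d Max : ℕ} {o : ℕ × ℕ} :
    o ∈ options C W d Max ↔ o.1 ≤ C ∧ o.2 ≤ C ∧ blockLen W d o ≤ Max := by
  obtain ⟨u, v⟩ := o
  simp [options, allPairs, and_assoc]

/-- The blocks that are unions of strips. -/
theorem exists_option {C d : ℕ} (hd : 0 < d) (hC : I.W ≤ C * d) {c : Finset ℕ}
    (hsub : c ⊆ Finset.Icc 1 I.W) (hcon : ∃ a b, c = Finset.Ico a b)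
    (hstrip : ∀ j, I.strip d j ⊆ c ∨ Disjoint (I.strip d j) c) :
    ∃ o : ℕ × ℕ, o.1 ≤ C ∧ o.2 ≤ C ∧
      c = Finset.Ico (o.1 * d + 1) (o.1 * d + 1 + blockLen I.W d o) ∧
      ∀ x, inBlock o x = true → x * d + 1 ∈ c := by
  obtain ⟨a, b, rfl⟩ := hcon
  rcases le_or_gt b a with hba | hab
  · refine ⟨(0, 0), Nat.zero_le _, Nat.zero_le _, ?_, fun x hx => ?_⟩
    · rw [Finset.Ico_eq_empty_of_le hba]; simp [blockLen]
    · have := inBlock_iff.1 hx; omega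
  have ha : a ∈ Finset.Ico a b := Finset.mem_Ico.2 ⟨le_rfl, hab⟩
  have hb : b - 1 ∈ Finset.Ico a b := Finset.mem_Ico.2 ⟨by omega, by omega⟩
  have ha1 := Finset.mem_Icc.1 (hsub ha)
  have hb1 := Finset.mem_Icc.1 (hsub hb)
  -- The color x lies in strip (x-1)/d, and a block made of strips contains the whole strip of each
  -- of its colors. So the first color of the block begins a strip and the last one ends a strip,
  -- possibly the one cut off at W.
  have key : ∀ x ∈ Finset.Ico a b, I.strip d ((x - 1) / d) ⊆ Finset.Ico a b ∧
      (x - 1) / d * d + 1 ≤ x ∧ x ≤ ((x - 1) / d + 1) * d := by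
    intro x hx
    have h1 := Finset.mem_Icc.1 (hsub hx)
    have h2 := Nat.div_add_mod (x - 1) d
    have h3 := Nat.mod_lt (x - 1) hd
    rw [Nat.mul_comm] at h2
    have h4 : (x - 1) / d * d + 1 ≤ x ∧ x ≤ ((x - 1) / d + 1) * d := by
      rw [Nat.add_mul, Nat.one_mul]; omega
    refine ⟨(hstrip _).resolve_right fun h => ?_, h4⟩
    exact Finset.disjoint_left.1 h
      (Finset.mem_Icc.2 ⟨h4.1, le_min h4.2 h1.2⟩) hx
  obtain ⟨k1, k2, k3⟩ := key a ha
  obtain ⟨l1, l2, l3⟩ := key (b - 1) hb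
  have ha2 : (a - 1) / d * d + 1 = a := by
    have h1 := Finset.mem_Ico.1 (k1 (Finset.mem_Icc.2 ⟨le_rfl, le_min (by omega) (by omega)⟩))
    omega
  have hb2 : min (((b - 1 - 1) / d + 1) * d) I.W = b - 1 := by
    refine le_antisymm ?_ (le_min l3 hb1.2)
    have h1 := Finset.mem_Ico.1 (l1 (Finset.mem_Icc.2 ⟨l2.trans (le_min l3 hb1.2), le_rfl⟩))
    omega
  have hle : (b - 1 - 1) / d < C := (Nat.div_lt_iff_lt_mul hd).2 (by omega)
  have hle' : (a - 1) / d ≤ (b - 1 - 1) / d := Nat.div_le_div_right (by omega)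
  refine ⟨((a - 1) / d, (b - 1 - 1) / d + 1), by dsimp only; omega, by dsimp only; omega, ?_,
    fun x hx => ?_⟩
  · have h1 : Nat.min (((b - 1 - 1) / d + 1) * d) I.W = b - 1 := hb2
    simp only [blockLen, h1]
    congr 1 <;> omega
  · obtain ⟨h1, h2⟩ := inBlock_iff.1 hx
    have h3 := Nat.mul_le_mul_right d h1
    have h4 := Nat.mul_le_mul_right d (Nat.lt_succ_iff.1 h2)
    dsimp only at h3
    exact Finset.mem_Ico.2 ⟨by omega, by omega⟩

/-- The dynamic program finds a best coloring by strips of width `d`. -/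
theorem best_dp {Max C d : ℕ} (hI : I.IsUniform Max) (hd : 0 < d) (hC : I.W ≤ C * d) :
    let c := I.coloringOf (best (dp C I.W d (options C I.W d Max) (sortedJobs I.raw)))
    I.IsFeasible c ∧ I.IsStripColoring d c ∧
      ∀ c', I.IsFeasible c' → I.IsStripColoring d c' → ∑ i, (c' i).card ≤ ∑ i, (c i).card := by
  intro c
  set T := dp C I.W d (options C I.W d Max) (sortedJobs I.raw) with hT
  have hcT : c = I.coloringOf (best T) := rfl
  clear_value c
  -- The default entry assigns no block, so at this point the chosen entry is only known to list
  -- some of the jobs.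
  obtain ⟨hbest, hmax⟩ := argmax_spec (fun c : Cand => c.2.1) T ([], 0, [])
  set b := argmax (fun c : Cand => c.2.1) T ([], 0, []) with hb
  obtain ⟨g, hg1, hg2, hg3, hg4, hg5⟩ : ∃ g : List (Job × (ℕ × ℕ)),
      b.2.2 = g.map (fun p => (p.1.1, p.2.1 * d + 1, blockLen I.W d p.2)) ∧
      (g.map fun p => p.1).Sublist (sortedJobs I.raw).reverse ∧
      (∀ p ∈ g, p.2 ∈ options C I.W d Max) ∧ b.2.1 = (g.map fun p => blockLen I.W d p.2).sum ∧
      g.Pairwise fun p q => p.1.conflict q.1 → ∀ x, inBlock p.2 x = true →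
        ¬ inBlock q.2 x = true := by
    rcases List.mem_cons.1 hbest with h | h
    · rw [h]; exact ⟨[], by simp⟩
    · obtain ⟨-, g, h1, h2, h3, h4, -, h6⟩ :=
        dp_sound (fun o ho => (mem_options.1 ho).2.1) _ b h
      exact ⟨g, h1, h2 ▸ List.Sublist.refl _, h3, h4, h6⟩
  have hA : best T = g.map fun p => (p.1.1, p.2.1 * d + 1, blockLen I.W d p.2) := hg1
  have hids : (g.map fun p => p.1.1).Nodup := by
    have h1 := hg2.map fun j => j.1
    rw [List.map_map, List.map_reverse] at h1
    exact h1.nodup (List.nodup_reverse.2 I.sorted_sortedJobs.2)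
  have hjob : ∀ p ∈ g, p.1 ∈ sortedJobs I.raw := fun p hp =>
    List.mem_reverse.1 (hg2.subset (List.mem_map_of_mem hp))
  have hAids : ((best T).map fun x => x.1).Nodup := by
    rw [hA, List.map_map]; exact hids
  have hci : ∀ i, (∃ p ∈ g, p.1 = I.job i ∧ lookup (best T) i = (p.2.1 * d + 1, blockLen I.W d p.2))
      ∨ lookup (best T) i = (0, 0) := by
    intro i
    by_cases h : (i : ℕ) ∈ (best T).map fun x => x.1
    · left
      rw [hA, List.map_map] at h
      obtain ⟨p, hp, hpi⟩ := List.mem_map.1 h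
      have hpi' : p.1.1 = i := hpi
      refine ⟨p, hp, job_eq_of_fst (hjob p hp) hpi', lookup_of_mem hAids ?_⟩
      rw [hA, ← hpi']
      exact List.mem_map_of_mem (f := fun p : Job × (ℕ × ℕ) =>
        (p.1.1, p.2.1 * d + 1, blockLen I.W d p.2)) hp
    · exact Or.inr (lookup_of_notMem h)
  have hmin : ∀ o : ℕ × ℕ, blockLen I.W d o = min (o.2 * d) I.W - o.1 * d := fun _ => rfl
  refine ⟨⟨fun i => ?_, fun i => ⟨_, _, congrFun hcT i⟩, fun i => ?_, fun i j hij => ?_⟩,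
    fun i j => ?_, ?_⟩
  · rcases hci i with ⟨p, hp, -, h⟩ | h
    · intro x hx
      simp only [hcT, coloringOf, h, hmin, Finset.mem_Ico] at hx
      exact Finset.mem_Icc.2 ⟨by omega, by omega⟩
    · simp [hcT, coloringOf, h]
  · rw [hcT, card_coloringOf, hI.rmax_eq]
    rcases hci i with ⟨p, hp, -, h⟩ | h
    · rw [h]; exact (mem_options.1 (hg3 p hp)).2.2
    · rw [h]; exact Nat.zero_le _
  · obtain ⟨hne, hcf⟩ := adj_iff.1 hij
    rcases hci i with ⟨p, hp, hpi, h⟩ | h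
    · rcases hci j with ⟨q, hq, hqj, h'⟩ | h'
      · have hpq : p ≠ q := by
          rintro rfl
          rw [hpi] at hqj
          exact hne (Fin.ext (congrArg Prod.fst hqj))
        have : Std.Symm fun p q : Job × (ℕ × ℕ) => p.1.conflict q.1 →
            ∀ x, inBlock p.2 x = true → ¬ inBlock q.2 x = true :=
          ⟨fun p q h hcf x hx hx' => h (Job.conflict_symm hcf) x hx' hx⟩
        have h1 := hg5.forall hp hq hpq (by rw [hpi, hqj]; exact hcf)
        rw [Finset.disjoint_left]
        intro x hx hx'
        simp only [hcT, coloringOf, h, h', hmin, Finset.mem_Ico] at hx hx'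
        -- A color common to two blocks would put its strip into both options.
        have h2 : ∀ o : ℕ × ℕ, o.1 * d + 1 ≤ x →
            x < o.1 * d + 1 + (min (o.2 * d) I.W - o.1 * d) → inBlock o ((x - 1) / d) = true :=
          fun o h3 h4 => inBlock_iff.2 ⟨(Nat.le_div_iff_mul_le hd).2 (by omega),
            (Nat.div_lt_iff_lt_mul hd).2 (by omega)⟩
        exact h1 _ (h2 _ hx.1 hx.2) (h2 _ hx'.1 hx'.2)
      · simp [hcT, coloringOf, h']
    · simp [hcT, coloringOf, h]
  · rcases hci i with ⟨p, hp, -, h⟩ | h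
    · have hc : c i = Finset.Ico (p.2.1 * d + 1) (p.2.1 * d + 1 + blockLen I.W d p.2) := by
        simp only [hcT, coloringOf, h]
      rw [hc, hmin]
      by_cases hj : p.2.1 ≤ j ∧ j < p.2.2
      · left
        intro x hx
        have hx' := Finset.mem_Icc.1 hx
        have h1 := Nat.mul_le_mul_right d hj.1
        have h2 := Nat.mul_le_mul_right d (Nat.succ_le_of_lt hj.2)
        rw [Nat.succ_eq_add_one] at h2
        exact Finset.mem_Ico.2 ⟨by omega, by omega⟩
      · right
        rw [Finset.disjoint_left]
        intro x hx hx'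
        rw [strip, Finset.mem_Icc] at hx
        rw [Finset.mem_Ico] at hx'
        by_cases hj1 : p.2.1 ≤ j
        · have h1 := Nat.mul_le_mul_right d (not_lt.1 fun h => hj ⟨hj1, h⟩)
          omega
        · have h1 := Nat.mul_le_mul_right d (Nat.succ_le_of_lt (not_le.1 hj1))
          rw [Nat.succ_eq_add_one] at h1
          omega
    · right
      simp [hcT, coloringOf, h]
  · intro c' hc' hs'
    have hprofit : ∑ i, (c i).card = b.2.1 := by
      simp only [hcT, card_coloringOf]
      rw [sum_lookup hAids, hA, List.map_map, hg4]
      · rfl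
      · intro x hx
        rw [hA] at hx
        obtain ⟨p, hp, rfl⟩ := List.mem_map.1 hx
        obtain ⟨i, hi⟩ := I.mem_sortedJobs.1 (hjob p hp)
        dsimp only
        rw [hi]
        exact i.2
    rw [hprofit]
    have hopt := fun i => exists_option hd hC (hc'.subset i) (hc'.contiguous i) (hs' i)
    choose o ho1 ho2 ho3 ho4 using hopt
    have hlen : ∀ i, (c' i).card = blockLen I.W d (o i) := by
      intro i; rw [ho3 i, Nat.card_Ico]; omega
    let f : Job → ℕ × ℕ := fun j => if h : j.1 < I.n then o ⟨j.1, h⟩ else (0, 0)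
    have hf : ∀ i, f (I.job i) = o i := fun i => dif_pos i.2
    obtain ⟨x, hx, hle, -⟩ := dp_complete (C := C) (W := I.W) (d := d)
      (opts := options C I.W d Max) I.sorted_sortedJobs f (fun j hj => by
        obtain ⟨i, rfl⟩ := I.mem_sortedJobs.1 hj
        rw [hf, mem_options, ← hlen]
        exact ⟨ho1 i, ho2 i, (hc'.card_le i).trans (hI.rmax_eq i).le⟩) (fun j hj j' hj' hne hcf x hx hx' => by
        obtain ⟨i, rfl⟩ := I.mem_sortedJobs.1 hj
        obtain ⟨i', rfl⟩ := I.mem_sortedJobs.1 hj'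
        rw [hf] at hx hx'
        refine Finset.disjoint_left.1 (hc'.disjoint i i' (adj_iff.2 ⟨?_, hcf⟩)) (ho4 i x hx)
          (ho4 i' x hx')
        rintro rfl
        exact hne rfl)
    rw [sum_sortedJobs] at hle
    calc ∑ i, (c' i).card = ∑ i, blockLen I.W d (f (I.job i)) :=
          Finset.sum_congr rfl fun i _ => by rw [hf, hlen]
      _ ≤ x.2.1 := hle
      _ ≤ b.2.1 := hmax x (List.mem_cons_of_mem _ hx)

end Instance

end FSAP

namespace FSAP
namespace Instance
variable {I : Instance}

/-! ### The greedy algorithm -/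

/-- The jobs chosen by the greedy algorithm form a maximum `m`-colorable subgraph. -/
theorem isMaxColorable_greedy {m : ℕ} (hm : 0 < m) :
    I.IsMaxColorable m (Finset.univ.filter fun i : Fin I.n =>
      (i : ℕ) ∈ (greedy m (sortedJobs I.raw)).map fun k => k.1.1) := by
  set K := greedy m (sortedJobs I.raw) with hK
  obtain ⟨hnd, hmem, hcol⟩ := greedy_sound hm I.sorted_sortedJobs
  rw [← hK] at hnd hmem hcol
  constructor
  · have h : ∀ i : ↥((Finset.univ.filter fun i : Fin I.n => (i : ℕ) ∈ K.map fun k => k.1.1 :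
        Finset (Fin I.n)) : Set (Fin I.n)), ∃ k ∈ K, k.1 = I.job i.1 := by
      intro i
      obtain ⟨k, hk, hki⟩ := List.mem_map.1 (Finset.mem_filter.1 (Finset.mem_coe.1 i.2)).2
      exact ⟨k, hk, job_eq_of_fst (hmem k hk).1 hki⟩
    choose k hk hki using h
    refine ⟨SimpleGraph.Coloring.mk (fun i => (⟨(k i).2, (hmem _ (hk i)).2⟩ : Fin m)) ?_⟩
    intro i j hij h
    obtain ⟨hne, hcf⟩ := adj_iff.1 (show I.graph.Adj i.1 j.1 from hij)
    rw [← hki, ← hki] at hcf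
    refine hcol _ (hk i) _ (hk j) hcf (fun hid => hne (Fin.ext ?_)) (congrArg Fin.val h)
    rw [hki, hki] at hid
    exact hid
  · intro T hT
    obtain ⟨f⟩ := hT
    let p : Job → Bool := fun j => decide (∃ i ∈ T, (i : ℕ) = j.1)
    have hp : ∀ i, p (I.job i) = true ↔ i ∈ T := by
      intro i
      rw [decide_eq_true_iff]
      constructor
      · rintro ⟨i', hi', h⟩
        rwa [← Fin.ext h]
      · intro h; exact ⟨i, h, rfl⟩
    -- Jobs that run at the same time are pairwise adjacent, so an m-coloring of `T` leaves room for
    -- at most m of them.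
    have hclique : ∀ τ, (sortedJobs I.raw).countP
        (fun j => p j && (Nat.ble j.2.1 τ && !Nat.ble j.2.2 τ)) ≤ m := by
      intro τ
      rw [countP_sortedJobs]
      have h1 : ∀ i ∈ (Finset.univ.filter fun i => (p (I.job i) &&
          (Nat.ble (I.job i).2.1 τ && !Nat.ble (I.job i).2.2 τ)) = true),
          i ∈ T ∧ (I.job i).2.1 ≤ τ ∧ τ < (I.job i).2.2 := by
        intro i hi
        have h2 := (Finset.mem_filter.1 hi).2
        simpa [hp] using h2
      let col : Fin I.n → ℕ := fun i => if h : i ∈ T then (f ⟨i, h⟩ : Fin m) else 0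
      have h3 := Finset.card_le_card_of_injOn (t := Finset.range m) col (fun i hi => by
        have h4 := (h1 i hi).1
        simp only [col, h4, dif_pos, Finset.coe_range, Set.mem_Iio]
        exact (f ⟨i, h4⟩).2) (fun i hi j hj hij => by
        obtain ⟨hi1, hi2, hi3⟩ := h1 i hi
        obtain ⟨hj1, hj2, hj3⟩ := h1 j hj
        by_contra hne
        simp only [col, hi1, hj1, dif_pos] at hij
        have hadj : I.graph.Adj i j :=
          adj_iff.2 ⟨hne, by omega, by omega, by omega, by omega⟩
        exact f.valid (v := ⟨i, hi1⟩) (w := ⟨j, hj1⟩) hadj (Fin.ext hij))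
      rwa [Finset.card_range] at h3
    have hle : ∀ i, (I.job i).2.1 ≤ (endpoints I.raw).length ∧
        (I.job i).2.2 ≤ (endpoints I.raw).length :=
      fun i => ⟨rank_le_length _ _, rank_le_length _ _⟩
    -- No rank exceeds the number of endpoints, so at this time every job has started and ended, and
    -- the comparison covers all jobs.
    have h1 := countP_le_greedy hm I.sorted_sortedJobs p hclique (endpoints I.raw).length
      fun j hj => by
        obtain ⟨i, rfl⟩ := I.mem_sortedJobs.1 hj
        exact (hle i).1
    rw [countP_sortedJobs] at h1
    have h2 : (Finset.univ.filter fun i => (p (I.job i) &&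
        Nat.ble (I.job i).2.2 (endpoints I.raw).length) = true) = T := by
      ext i
      rw [Finset.mem_filter, Bool.and_eq_true, hp, Nat.ble_eq]
      exact ⟨fun h => h.2.1, fun h => ⟨Finset.mem_univ _, h, (hle i).2⟩⟩
    rw [h2] at h1
    refine h1.trans (List.countP_le_length.trans ?_)
    have h3 : (K.map fun k => k.1.1).toFinset ⊆ (Finset.univ.filter fun i : Fin I.n =>
        (i : ℕ) ∈ K.map fun k => k.1.1).image fun i : Fin I.n => (i : ℕ) := by
      intro x hx
      rw [List.mem_toFinset] at hx
      obtain ⟨k, hk, rfl⟩ := List.mem_map.1 hx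
      obtain ⟨i, hi⟩ := I.mem_sortedJobs.1 (hmem k hk).1
      have h4 : (i : ℕ) = k.1.1 := by rw [hi]; rfl
      exact Finset.mem_image.2 ⟨i, Finset.mem_filter.2 ⟨Finset.mem_univ _, h4 ▸ hx⟩, h4⟩
    have h4 := (Finset.card_le_card h3).trans Finset.card_image_le
    rwa [List.toFinset_card_of_nodup hnd, List.length_map] at h4

theorem coloringOf_nil (i : Fin I.n) : I.coloringOf [] i = ∅ := by
  simp [coloringOf, lookup_of_notMem]

theorem isFeasible_nil : I.IsFeasible (I.coloringOf []) := by
  refine ⟨fun i => ?_, fun i => ⟨0, 0, ?_⟩, fun i => ?_, fun i j _ => ?_⟩ <;>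
    simp [coloringOf_nil]

/-- The coloring that is obtained from the greedy algorithm. -/
theorem greedy_coloring {Max m : ℕ} (hI : I.IsUniform Max) (hm : 0 < m) (hW : m * Max ≤ I.W) :
    let c := I.coloringOf ((greedy m (sortedJobs I.raw)).map fun k =>
      (k.1.1, k.2 * Max + 1, Max))
    I.IsFeasible c ∧ ∃ S, I.IsMaxColorable m S ∧
      (∀ i ∈ S, (c i).card = Max ∧ c i ⊆ Finset.Icc 1 (m * Max)) ∧ ∀ i ∉ S, c i = ∅ := by
  intro c
  set K := greedy m (sortedJobs I.raw) with hK
  set A : List (ℕ × ℕ × ℕ) := K.map fun k => (k.1.1, k.2 * Max + 1, Max) with hA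
  have hcA : c = I.coloringOf A := rfl
  clear_value c
  obtain ⟨hnd, hmem, hcol⟩ := greedy_sound hm I.sorted_sortedJobs
  rw [← hK] at hnd hmem hcol
  have hids : (A.map fun x => x.1) = K.map fun k => k.1.1 := by rw [hA, List.map_map]; rfl
  have hin : ∀ i : Fin I.n, (i : ℕ) ∈ K.map (fun k => k.1.1) →
      ∃ k ∈ K, k.1 = I.job i ∧ c i = Finset.Ico (k.2 * Max + 1) (k.2 * Max + 1 + Max) := by
    intro i hi
    obtain ⟨k, hk, hki⟩ := List.mem_map.1 hi
    refine ⟨k, hk, job_eq_of_fst (hmem k hk).1 hki, ?_⟩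
    have h1 : lookup A i = (k.2 * Max + 1, Max) := by
      refine lookup_of_mem (hids ▸ hnd) ?_
      rw [← hki, hA]
      exact List.mem_map_of_mem (f := fun k : Job × ℕ => (k.1.1, k.2 * Max + 1, Max)) hk
    simp only [hcA, coloringOf, h1]
  have hout : ∀ i : Fin I.n, (i : ℕ) ∉ K.map (fun k => k.1.1) → c i = ∅ := by
    intro i hi
    simp only [hcA, coloringOf, lookup_of_notMem (hids ▸ hi)]
    simp
  have hsub : ∀ i, c i ⊆ Finset.Icc 1 (m * Max) ∧ (c i).card ≤ Max := by
    intro i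
    by_cases hi : (i : ℕ) ∈ K.map fun k => k.1.1
    · obtain ⟨k, hk, -, h⟩ := hin i hi
      have h1 := Nat.mul_le_mul_right Max (Nat.succ_le_of_lt (hmem k hk).2)
      rw [Nat.succ_mul] at h1
      rw [h, Nat.card_Ico]
      refine ⟨fun x hx => ?_, by omega⟩
      rw [Finset.mem_Ico] at hx
      exact Finset.mem_Icc.2 ⟨by omega, by omega⟩
    · rw [hout i hi]; simp
  refine ⟨⟨fun i => (hsub i).1.trans (Finset.Icc_subset_Icc le_rfl hW),
    fun i => ⟨_, _, congrFun hcA i⟩, fun i => (hsub i).2.trans (hI.rmax_eq i).ge,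
    fun i j hij => ?_⟩, _, isMaxColorable_greedy hm, fun i hi => ⟨?_, (hsub i).1⟩,
    fun i hi => hout i fun h => hi (Finset.mem_filter.2 ⟨Finset.mem_univ _, h⟩)⟩
  · by_cases hi : (i : ℕ) ∈ K.map fun k => k.1.1
    · by_cases hj : (j : ℕ) ∈ K.map fun k => k.1.1
      · obtain ⟨k, hk, hki, h⟩ := hin i hi
        obtain ⟨k', hk', hkj, h'⟩ := hin j hj
        obtain ⟨hne, hcf⟩ := adj_iff.1 hij
        rw [← hki, ← hkj] at hcf
        have h1 := hcol k hk k' hk' hcf fun hid => hne (Fin.ext (by rw [hki, hkj] at hid; exact hid))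
        rw [h, h', Finset.disjoint_left]
        intro x hx hx'
        rw [Finset.mem_Ico] at hx hx'
        rcases lt_or_gt_of_ne h1 with h2 | h2
        · have h3 := Nat.mul_le_mul_right Max (Nat.succ_le_of_lt h2)
          rw [Nat.succ_mul] at h3; omega
        · have h3 := Nat.mul_le_mul_right Max (Nat.succ_le_of_lt h2)
          rw [Nat.succ_mul] at h3; omega
      · rw [hout j hj]; exact Finset.disjoint_empty_right _
    · rw [hout i hi]; exact Finset.disjoint_empty_left _
  · obtain ⟨k, -, -, h⟩ := hin i (Finset.mem_filter.1 hi).2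
    rw [h, Nat.card_Ico]; omega

/-! ### The scheme -/

theorem IsUniform.profit_eq {Max : ℕ} (hI : I.IsUniform Max) (c : I.Coloring) :
    I.profit c = ((∑ i, (c i).card : ℕ) : ℝ) := by
  rw [profit, Nat.cast_sum]
  exact Finset.sum_congr rfl fun i _ => by rw [hI.p_eq]; simp

theorem opt_nonneg (I : Instance) : 0 ≤ I.opt := by
  obtain ⟨c, hc, h⟩ := I.isGreatest_opt.1
  rw [← h]
  exact Finset.sum_nonneg fun i _ => by positivity

theorem IsFeasible.profit_le_opt {c : I.Coloring} (hc : I.IsFeasible c) : I.profit c ≤ I.opt :=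
  I.isGreatest_opt.2 ⟨c, hc, rfl⟩

theorem sum_card_eq_of_isMaxColorable {Max : ℕ} {c : I.Coloring} {S : Finset (Fin I.n)}
    (hS : ∀ i ∈ S, (c i).card = Max) (hS' : ∀ i ∉ S, c i = ∅) :
    ∑ i, (c i).card = Max * S.card := by
  classical
  rw [← Finset.sum_subset (Finset.subset_univ S) fun i _ hi => by rw [hS' i hi]; rfl,
    Finset.sum_congr rfl hS, Finset.sum_const, smul_eq_mul, Nat.mul_comm]

/-- With the colors `1, …, m * Max`, nothing is better than a maximum `m`-colorable subgraph. -/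
theorem sum_card_le_of_isMaxColorable {Max m : ℕ} (hI : I.IsUniform Max) {S : Finset (Fin I.n)}
    (hS : I.IsMaxColorable m S) {c : I.Coloring} (hc : I.IsFeasible c)
    (hcol : ∀ i, c i ⊆ Finset.Icc 1 (m * Max)) : ∑ i, (c i).card ≤ Max * S.card := by
  obtain ⟨T, hT, hsum⟩ := exists_residue_classes hI.one_le hcol hc.contiguous
    (fun i => (hc.card_le i).trans (hI.rmax_eq i).le) hc.disjoint
  rw [hsum]
  refine (Finset.sum_le_card_nsmul _ _ S.card fun r _ => hS.2 _ (hT r)).trans ?_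
  rw [Finset.card_range, smul_eq_mul]

/-- A maximum `m`-colorable subgraph loses at most one part in `m + 1` of the optimum for
`(m + 1) * Max` colors. -/
theorem mul_sum_card_le {Max m : ℕ} (hI : I.IsUniform Max) {S : Finset (Fin I.n)}
    (hS : I.IsMaxColorable m S) (hW : I.W ≤ (m + 1) * Max) {c : I.Coloring}
    (hc : I.IsFeasible c) : (∑ i, (c i).card) * m ≤ Max * S.card * (m + 1) := by
  obtain ⟨T, hT, hsum⟩ := exists_residue_classes hI.one_le
    (fun i => (hc.subset i).trans (Finset.Icc_subset_Icc le_rfl hW)) hc.contiguous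
    (fun i => (hc.card_le i).trans (hI.rmax_eq i).le) hc.disjoint
  rw [hsum, Finset.sum_mul]
  refine (Finset.sum_le_card_nsmul _ _ (S.card * (m + 1))
    fun r _ => card_mul_le_of_colorable hS (hT r)).trans ?_
  rw [Finset.card_range, smul_eq_mul, Nat.mul_assoc]

theorem isMaxColorable_zero : I.IsMaxColorable 0 ∅ := by
  refine ⟨⟨SimpleGraph.Coloring.mk (fun i => absurd i.2 (by simp)) fun {i} => absurd i.2 (by simp)⟩,
    fun T hT => ?_⟩
  obtain ⟨f⟩ := hT
  rw [Finset.card_empty, Nat.le_zero, Finset.card_eq_zero, Finset.eq_empty_iff_forall_notMem]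
  exact fun i hi => (f ⟨i, hi⟩).elim0

/-- A strip of width 1 has at most one color. So when d = 0 the dynamic program, run with width 1,
optimizes over all feasible solutions. -/
theorem width_one_isStripColoring (c : I.Coloring) : I.IsStripColoring 1 c := by
  intro i j
  have h : ∀ x ∈ I.strip 1 j, x = j + 1 := by
    intro x hx
    have := Finset.mem_Icc.1 hx
    omega
  by_cases hj : j + 1 ∈ c i
  · exact Or.inl fun x hx => (h x hx).symm ▸ hj
  · exact Or.inr (Finset.disjoint_left.2 fun x hx hx' => hj (h x hx ▸ hx'))

end Instance
end FSAP

/-! ### The program, its output and the approximation guarantee. -/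

namespace FSAP

theorem PT.solve (a b C : ℕ) : PT fun r : Raw => FSAP.solve a b C r := by
  have hdp : PT fun r : Raw => FSAP.dp C r.1 (FSAP.width a b r)
      (FSAP.options C r.1 (FSAP.width a b r) (FSAP.maxReq r)) (FSAP.sortedJobs r) := by
    refine PT.dp (N := fun r => (FSAP.endpoints r).length) (by fun_prop) (by fun_prop)
      (by fun_prop) (by fun_prop) (PB.length (by fun_prop)) fun r j hj => ?_
    obtain ⟨t, -, hj⟩ := List.mem_flatMap.1 hj
    obtain ⟨p, -, rfl⟩ := List.mem_map.1 (List.mem_of_mem_filter hj)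
    exact rank_le_length _ _
  have hA : PT fun r : Raw => FSAP.assignment a b C r := by
    unfold FSAP.assignment
    fun_prop
  unfold FSAP.solve
  fun_prop

/-- A program for the algorithm with `ε = a / b` and at most `C` strips. -/
noncomputable def solver (a b C : ℕ) : Prog := (PT.solve a b C).choose

namespace Instance
variable {I : Instance}

theorem solve_raw (a b C : ℕ) : solve a b C I.raw =
    List.ofFn fun i : Fin I.n => lookup (assignment a b C I.raw) i := by
  refine List.ext_getElem (by simp [solve, raw]) fun i h1 h2 => ?_
  simp [solve]

theorem maxReq_raw {Max : ℕ} (hI : I.IsUniform Max) (hn : 0 < I.n) : maxReq I.raw = Max := by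
  have h1 : ∀ l : List (((ℕ × ℕ) × (ℕ × ℕ)) × (ℕ × (ℕ × ℕ))), ∀ h : 0 < l.length,
      l.headI = l[0] := by
    intro l h
    cases l with
    | nil => simp at h
    | cons a l => rfl
  rw [maxReq, h1 _ (by simpa [raw] using hn)]
  simp [raw, hI.rmax_eq]

theorem ceilDiv_raw {Max : ℕ} (hI : I.IsUniform Max) (hn : 0 < I.n) :
    ⌈(I.W : ℚ) / (Max : ℚ)⌉₊ = ceilDiv I.raw := by
  have hM : (0 : ℚ) < Max := by exact_mod_cast hI.one_le
  refine eq_of_forall_ge_iff fun n => ?_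
  rw [Nat.ceil_le, div_le_iff₀ hM, ceilDiv, maxReq_raw hI hn, ← Nat.lt_succ_iff,
    Nat.div_lt_iff_lt_mul hI.one_le, Nat.succ_mul]
  have h1 := hI.one_le
  have h2 : ((I.W : ℚ) ≤ n * Max) ↔ I.W ≤ n * Max := by exact_mod_cast Iff.rfl
  rw [h2]
  change _ ↔ I.W + Max - 1 < _
  omega

theorem floor_width (a b Max : ℕ) :
    ⌊(a : ℚ) / (b : ℚ) * (Max : ℚ) / 4⌋₊ = a * Max / (4 * b) := by
  have : (a : ℚ) / (b : ℚ) * (Max : ℚ) / 4 = ((a * Max : ℕ) : ℚ) / ((4 * b : ℕ) : ℚ) := by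
    push_cast
    rw [div_mul_eq_mul_div, div_div, mul_comm (b : ℚ) 4]
  rw [this, Nat.floor_div_eq_div]

/-- Without jobs the common requirement cannot be read off the input, but then there is only one
coloring. -/
theorem isSchemeOutcome_of_isEmpty (hn : I.n = 0) (Max : ℕ) (ε : ℚ) (c : I.Coloring) :
    I.IsFeasible c ∧ I.IsSchemeOutcome Max ε c := by
  have : IsEmpty (Fin I.n) := by rw [hn]; infer_instance
  refine ⟨⟨isEmptyElim, isEmptyElim, isEmptyElim, isEmptyElim⟩,
    fun _ _ => ⟨isEmptyElim, fun c' _ _ => ?_⟩, fun _ _ => ?_, fun _ => ⟨⟨∅, ⟨?_, fun T _ => ?_⟩,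
      fun i => isEmptyElim i, fun i => isEmptyElim i⟩, fun c' _ _ => ?_⟩⟩
  · rw [Subsingleton.elim c' c]
  · obtain ⟨c', -, h⟩ := I.isGreatest_opt.1
    rw [← h, Subsingleton.elim c' c]
  · exact ⟨SimpleGraph.Coloring.mk (fun i => isEmptyElim i.1) fun {i} => isEmptyElim i.1⟩
  · rw [Finset.eq_empty_of_isEmpty T]
  · rw [Subsingleton.elim c' c]

/-- The algorithm computes an outcome of the scheme. -/
theorem isSchemeOutcome_assignment {Max a b : ℕ} (hI : I.IsUniform Max) (ha : 0 < a) (hb : 0 < b) :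
    I.IsFeasible (I.coloringOf (assignment a b (8 * b ^ 2) I.raw)) ∧
    I.IsSchemeOutcome Max ((a : ℚ) / b) (I.coloringOf (assignment a b (8 * b ^ 2) I.raw)) := by
  rcases Nat.eq_zero_or_pos I.n with hn | hn
  · exact isSchemeOutcome_of_isEmpty hn _ _ _
  have ha' : (0 : ℚ) < a := by exact_mod_cast ha
  have hb' : (0 : ℚ) < b := by exact_mod_cast hb
  have hk : (((ceilDiv I.raw : ℕ) : ℚ) ≤ 1 / ((a : ℚ) / b)) ↔ ceilDiv I.raw * a ≤ b := by
    rw [one_div_div, le_div_iff₀ ha']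
    exact_mod_cast Iff.rfl
  have hM := maxReq_raw hI hn
  have hone := hI.one_le
  have hWk : I.W ≤ ceilDiv I.raw * Max ∧ (ceilDiv I.raw - 1) * Max ≤ I.W ∧ 0 < ceilDiv I.raw := by
    have h0 : ceilDiv I.raw = (I.W + Max - 1) / Max := by rw [ceilDiv, hM]; rfl
    have h1 := Nat.div_add_mod (I.W + Max - 1) Max
    have h2 := Nat.mod_lt (I.W + Max - 1) hone
    have h3 : 0 < ceilDiv I.raw := by
      rw [h0]; exact Nat.div_pos (by have := I.W_pos; omega) hone
    rw [← h0, Nat.mul_comm] at h1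
    refine ⟨by omega, ?_, h3⟩
    rw [Nat.sub_mul, Nat.one_mul]
    omega
  rw [IsSchemeOutcome, ceilDiv_raw hI hn, floor_width]
  simp only [hk, ← not_le]
  by_cases hcase : ceilDiv I.raw * a ≤ b
  · have hw : width a b I.raw = a * Max / (4 * b) + (1 - a * Max / (4 * b)) := by rw [width, hM]
    have hA : assignment a b (8 * b ^ 2) I.raw = best (dp (8 * b ^ 2) I.W (width a b I.raw)
        (options (8 * b ^ 2) I.W (width a b I.raw) Max) (sortedJobs I.raw)) := by
      rw [assignment, if_pos (by simpa using hcase), hM]; rfl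
    -- The width is max(d, 1) by truncated subtraction, so twice the width is at least d + 1 and
    -- hence a·Max ≤ 8b · width. Together with W ≤ k·Max and ka ≤ b this bounds the number of strips
    -- by 8b².
    have hC : I.W ≤ 8 * b ^ 2 * width a b I.raw := by
      have h1 := Nat.lt_mul_div_succ (a * Max) (show 0 < 4 * b by omega)
      have h2 : a * Max / (4 * b) + 1 ≤ 2 * width a b I.raw := by omega
      have h3 := Nat.mul_le_mul_left (4 * b) h2
      have h4 : a * Max ≤ 8 * b * width a b I.raw := by
        calc a * Max ≤ 4 * b * (2 * width a b I.raw) := by omega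
          _ = _ := by ring
      calc I.W ≤ a * I.W := Nat.le_mul_of_pos_left _ ha
        _ ≤ a * (ceilDiv I.raw * Max) := Nat.mul_le_mul_left _ hWk.1
        _ = ceilDiv I.raw * a * Max := by ring
        _ ≤ b * Max := Nat.mul_le_mul_right _ hcase
        _ ≤ b * (a * Max) := Nat.mul_le_mul_left _ (Nat.le_mul_of_pos_left _ ha)
        _ ≤ b * (8 * b * width a b I.raw) := Nat.mul_le_mul_left _ h4
        _ = 8 * b ^ 2 * width a b I.raw := by ring
    obtain ⟨h1, h2, h3⟩ := best_dp hI (show 0 < width a b I.raw by omega) hC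
    rw [← hA] at h1 h2 h3
    refine ⟨h1, fun _ hd => ?_, fun _ hd => ?_, fun h => absurd hcase h⟩
    · have hd' : width a b I.raw = a * Max / (4 * b) := by omega
      rw [hd'] at h2 h3
      refine ⟨h2, fun c' hc' hs => ?_⟩
      rw [hI.profit_eq, hI.profit_eq]
      exact_mod_cast h3 c' hc' hs
    · have hd' : width a b I.raw = 1 := by omega
      rw [hd'] at h3
      obtain ⟨c', hc', hopt⟩ := I.isGreatest_opt.1
      refine le_antisymm h1.profit_le_opt ?_
      rw [← hopt, hI.profit_eq, hI.profit_eq]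
      exact_mod_cast h3 c' hc' (width_one_isStripColoring c')
  · have key : ∃ c, c = I.coloringOf (assignment a b (8 * b ^ 2) I.raw) ∧ I.IsFeasible c ∧
        ∃ S, I.IsMaxColorable (ceilDiv I.raw - 1) S ∧
        (∀ i ∈ S, (c i).card = Max ∧ c i ⊆ Finset.Icc 1 ((ceilDiv I.raw - 1) * Max)) ∧
        ∀ i ∉ S, c i = ∅ := by
      by_cases h1 : ceilDiv I.raw ≤ 1
      · have hA : assignment a b (8 * b ^ 2) I.raw = [] := by
          rw [assignment, if_neg (by simpa using hcase), if_pos (by simpa using h1)]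
        rw [hA, Nat.sub_eq_zero_of_le h1]
        exact ⟨_, rfl, isFeasible_nil, ∅, isMaxColorable_zero,
          fun i hi => absurd hi (Finset.notMem_empty i), fun i _ => coloringOf_nil i⟩
      · have hA : assignment a b (8 * b ^ 2) I.raw =
            (greedy (ceilDiv I.raw - 1) (sortedJobs I.raw)).map fun k =>
              (k.1.1, k.2 * Max + 1, Max) := by
          rw [assignment, if_neg (by simpa using hcase), if_neg (by simpa using h1), hM]
        rw [hA]
        exact ⟨_, rfl, greedy_coloring hI (by omega) hWk.2.1⟩
    obtain ⟨c, hc, hfeas, S, hS, hS1, hS2⟩ := key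
    rw [← hc]
    refine ⟨hfeas, fun h => absurd h hcase, fun h => absurd h hcase,
      fun _ => ⟨⟨S, hS, hS1, hS2⟩, fun c' hc' hcol => ?_⟩⟩
    rw [hI.profit_eq, hI.profit_eq,
      sum_card_eq_of_isMaxColorable (fun i hi => (hS1 i hi).1) hS2]
    exact_mod_cast sum_card_le_of_isMaxColorable hI hS hc' hcol

/-- An outcome of the scheme has at least `1 - ε` times the optimal profit. -/
theorem IsSchemeOutcome.le_profit {Max : ℕ} {ε : ℚ} (hI : I.IsUniform Max) (hε : 0 < ε)
    {c : I.Coloring} (hs : I.IsSchemeOutcome Max ε c) : (1 - (ε : ℝ)) * I.opt ≤ I.profit c := by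
  obtain ⟨h1, h2, h3⟩ := hs
  have hM : (0 : ℚ) < Max := by exact_mod_cast hI.one_le
  have hMr : (0 : ℝ) < Max := by exact_mod_cast hI.one_le
  have hεr : (0 : ℝ) < ε := by exact_mod_cast hε
  have hopt0 := opt_nonneg I
  obtain ⟨c0, hc0, hopt⟩ := I.isGreatest_opt.1
  have hkW : I.W ≤ ⌈(I.W : ℚ) / (Max : ℚ)⌉₊ * Max := by
    have := Nat.le_ceil ((I.W : ℚ) / (Max : ℚ))
    rw [div_le_iff₀ hM] at this
    exact_mod_cast this
  have hk1 : 1 ≤ ⌈(I.W : ℚ) / (Max : ℚ)⌉₊ :=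
    Nat.one_le_ceil_iff.2 (div_pos (by exact_mod_cast I.W_pos) hM)
  generalize ⌈(I.W : ℚ) / (Max : ℚ)⌉₊ = k at *
  rcases le_or_gt (k : ℚ) (1 / ε) with hk | hk
  · rcases Nat.eq_zero_or_pos ⌊ε * (Max : ℚ) / 4⌋₊ with hd | hd
    · rw [h2 hk hd]; nlinarith
    · have hd4 : (⌊ε * (Max : ℚ) / 4⌋₊ : ℚ) ≤ ε * Max / 4 := Nat.floor_le (by positivity)
      generalize ⌊ε * (Max : ℚ) / 4⌋₊ = d at *
      have hε1 : ε ≤ 1 := by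
        have h4 : (1 : ℚ) ≤ 1 / ε := le_trans (by exact_mod_cast hk1) hk
        rw [le_div_iff₀ hε] at h4
        linarith
      have hdM : d ≤ Max := by
        have h4 : (d : ℚ) ≤ Max := by nlinarith
        exact_mod_cast h4
      have hdiv : 1 ≤ Max / d := (Nat.le_div_iff_mul_le hd).2 (by omega)
      -- Here q = ⌊Max/d⌋ - 1: one sample is given up as the reserve required by the rounding, which
      -- yields dq ≥ Max - 2d.
      obtain ⟨q, hq⟩ := Nat.exists_eq_add_of_le hdiv
      have hq1 : d * (q + 1) ≤ Max := by
        rw [Nat.add_comm q 1, ← hq]; exact Nat.mul_div_le _ _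
      have hq2 : Max ≤ d * q + 2 * d := by
        have := Nat.lt_mul_div_succ Max hd
        rw [hq] at this
        nlinarith
      obtain ⟨c', hc', hs', hle⟩ := exists_stripColoring hd hq1 hI.le_W hI.rmax_eq hc0
      have h5 := (h1 hk hd).2 c' hc' hs'
      have h6 : ((d * q : ℕ) : ℝ) * I.opt ≤ Max * I.profit c' := by
        rw [← hopt, hI.profit_eq, hI.profit_eq]
        exact_mod_cast hle
      have h7 : (Max : ℝ) * (1 - ε) ≤ ((d * q : ℕ) : ℝ) := by
        have h8 : (Max : ℝ) ≤ ((d * q : ℕ) : ℝ) + 2 * d := by exact_mod_cast hq2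
        have h9 : (d : ℝ) ≤ ε * Max / 4 := by exact_mod_cast hd4
        nlinarith [mul_pos hεr hMr]
      have h8 := mul_le_mul_of_nonneg_right h7 hopt0
      refine le_of_mul_le_mul_left ?_ hMr
      calc (Max : ℝ) * ((1 - ε) * I.opt) = Max * (1 - ε) * I.opt := by ring
        _ ≤ Max * I.profit c' := h8.trans h6
        _ ≤ Max * I.profit c := mul_le_mul_of_nonneg_left h5 hMr.le
  · obtain ⟨⟨S, hS, hS1, hS2⟩, -⟩ := h3 hk
    obtain ⟨m, rfl⟩ := Nat.exists_eq_add_of_le' hk1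
    rw [Nat.add_sub_cancel] at hS
    have h4 := mul_sum_card_le hI hS hkW hc0
    rw [← sum_card_eq_of_isMaxColorable (fun i hi => (hS1 i hi).1) hS2] at h4
    -- With k = m + 1 the profit is at least (1 - 1/k) times the optimum, and 1/k < ε.
    have h5 : I.opt * m ≤ I.profit c * (m + 1) := by
      rw [← hopt, hI.profit_eq, hI.profit_eq]
      exact_mod_cast h4
    rw [div_lt_iff₀ hε] at hk
    have h6 : (1 : ℝ) < ((m + 1 : ℕ) : ℝ) * ε := by exact_mod_cast hk
    push_cast at h6
    have hm : (0 : ℝ) < m + 1 := by positivity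
    refine le_of_mul_le_mul_right ?_ hm
    nlinarith

/-- The encoding of lists is injective, so an output describes only one coloring. -/
theorem Describes.eq_coloringOf {a b C : ℕ} {c : I.Coloring}
    (h : I.Describes (Enc.enc (solve a b C I.raw)) c) : c = I.coloringOf (assignment a b C I.raw) := by
  obtain ⟨s, l, h1, h2⟩ := h
  have h3 : Enc.enc (solve a b C I.raw) = Data.ofList ((solve a b C I.raw).map Enc.enc) := rfl
  rw [h3, solve_raw, List.map_ofFn] at h1
  have h4 := List.ofFn_injective (Data.ofList_injective h1)
  funext i
  have h5 := congrFun h4 i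
  simp only [Function.comp_apply, Enc.enc, Data.node.injEq, Data.leaf.injEq] at h5
  rw [h2, coloringOf, h5.1, h5.2]

theorem describes_coloringOf (a b C : ℕ) :
    I.Describes (Enc.enc (solve a b C I.raw)) (I.coloringOf (assignment a b C I.raw)) := by
  refine ⟨fun i => (lookup (assignment a b C I.raw) i).1,
    fun i => (lookup (assignment a b C I.raw) i).2, ?_, fun i => rfl⟩
  rw [solve_raw]
  change Data.ofList (List.map _ _) = _
  rw [List.map_ofFn]
  rfl

end Instance

theorem solver_runs (a b C : ℕ) : ∃ P : Polynomial ℕ, ∀ I : Instance, ∃ t,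
    Runs (solver a b C) I.encode (Enc.enc (solve a b C I.raw)) t ∧ t ≤ P.eval I.encode.size := by
  obtain ⟨P, hP⟩ := (PT.solve a b C).choose_spec
  refine ⟨P, fun I => ?_⟩
  have := hP I.raw
  rw [sz, I.enc_raw] at this
  exact this

/-- The algorithm needs ε as a fraction. A smaller rational gives a stronger guarantee, and a
rational ε is kept so that its exact k and d are used. -/
theorem exists_rat_below (ε : ℝ) : ∃ q : ℚ, 0 < ε → 0 < q ∧ (q : ℝ) ≤ ε ∧ ∀ r : ℚ, (r : ℝ) = ε → q = r := by
  by_cases h : ∃ r : ℚ, (r : ℝ) = ε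
  · obtain ⟨r, rfl⟩ := h
    exact ⟨r, fun h => ⟨by exact_mod_cast h, le_rfl, fun s hs => by exact_mod_cast hs.symm⟩⟩
  · by_cases hε : 0 < ε
    · obtain ⟨q, h1, h2⟩ := exists_rat_btwn hε
      exact ⟨q, fun _ => ⟨by exact_mod_cast h1, h2.le, fun r hr => absurd ⟨r, hr⟩ h⟩⟩
    · exact ⟨0, fun h => absurd h hε⟩

theorem num_toNat_div_den {q : ℚ} (hq : 0 < q) : ((q.num.toNat : ℕ) : ℚ) / (q.den : ℚ) = q := by
  have h : ((q.num.toNat : ℕ) : ℤ) = q.num := Int.toNat_of_nonneg (Rat.num_pos.2 hq).le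
  have h' : ((q.num.toNat : ℕ) : ℚ) = (q.num : ℚ) := by exact_mod_cast congrArg (Int.cast (R := ℚ)) h
  rw [h', Rat.num_div_den]

end FSAP

theorem mainTheorem4 :
    ∃ A : ℝ → FSAP.Prog,
      FSAP.IsPTAS (fun I => ∃ Max : ℕ, I.IsUniform Max) A ∧
      ∀ ε : ℚ, 0 < ε → ∀ (I : FSAP.Instance) (Max : ℕ), I.IsUniform Max →
        ∀ (y : FSAP.Data) (t : ℕ) (c : I.Coloring),
          FSAP.Runs (A (ε : ℝ)) I.encode y t → I.Describes y c →
            I.IsSchemeOutcome Max ε c := by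
  choose q hq using FSAP.exists_rat_below
  have hspec : ∀ ε : ℝ, 0 < ε → ∀ (I : FSAP.Instance) (Max : ℕ), I.IsUniform Max →
      let c := I.coloringOf
        (FSAP.assignment (q ε).num.toNat (q ε).den (8 * (q ε).den ^ 2) I.raw)
      I.IsFeasible c ∧ I.IsSchemeOutcome Max (q ε) c := by
    intro ε hε I Max hI
    have h1 := (hq ε hε).1
    have h2 := FSAP.Instance.isSchemeOutcome_assignment hI (a := (q ε).num.toNat) (b := (q ε).den)
      (by have := Rat.num_pos.2 h1; omega) (q ε).den_pos
    rwa [FSAP.num_toNat_div_den h1] at h2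
  refine ⟨fun ε => FSAP.solver (q ε).num.toNat (q ε).den (8 * (q ε).den ^ 2),
    fun ε hε => ?_, fun ε hε I Max hI y t c hrun hdesc => ?_⟩
  · obtain ⟨P, hP⟩ := FSAP.solver_runs (q ε).num.toNat (q ε).den (8 * (q ε).den ^ 2)
    refine ⟨P, fun I ⟨Max, hI⟩ => ?_⟩
    obtain ⟨t, hrun, hle⟩ := hP I
    obtain ⟨hfeas, hout⟩ := hspec ε hε I Max hI
    refine ⟨_, t, _, hrun, hle, FSAP.Instance.describes_coloringOf _ _ _, hfeas, ?_⟩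
    refine le_trans (mul_le_mul_of_nonneg_right ?_ I.opt_nonneg) (hout.le_profit hI (hq ε hε).1)
    linarith [(hq ε hε).2.1]
  · have hε' : (0 : ℝ) < ε := by exact_mod_cast hε
    obtain ⟨P, hP⟩ := FSAP.solver_runs (q ε).num.toNat (q ε).den (8 * (q ε).den ^ 2)
    obtain ⟨t', hrun', -⟩ := hP I
    -- The claim concerns an arbitrary run; by determinism it is the run already known.
    obtain ⟨rfl, -⟩ := hrun.deterministic hrun'
    have h1 := (hspec ε hε' I Max hI).2
    rw [hdesc.eq_coloringOf]
    rwa [(hq ε hε').2.2 ε rfl] at h1 ⊢
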